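/- Let $\mathcal V$ be a real vector space of dimension $2g$ with symplectic form $\omega$, $\mathcal Z\subset\mathcal V$ a self-dual lattice (i.e. $\mathcal Z=\{X:\omega(X,W)\in\mathbb Z\ \forall W\in\mathcal Z\}$), $\mathcal T=\mathcal V/\mathcal Z$, and $k$ a positive even integer. Let $\mathcal L\to\mathcal T$ be the quotient of $\mathcal V\times\mathbb C$ by the action $W\cdot(X,\lambda)=(X+W,e^{\pi i k\omega(W,X)}\lambda)$ of $\mathcal Z$, with the connection induced by $d-2\pi i k\,\theta_0$, $(\theta_0)_X(Y)=\tfrac12\omega(X,Y)$, and the standard hermitian metric $(\cdot,\cdot)$ (antilinear in the first variable). An invariant real polarization $\mathcal P$ of $(\mathcal T,k\omega)$ is given by a Lagrangian subspace $L_{\mathcal P}\subset\mathcal V$ spanned by $L_{\mathcal P}\cap\mathcal Z$; its leaves are the images in $\mathcal T$ of the translates of $L_{\mathcal P}$. A leaf $\Lambda$ is Bohr–Sommerfeld if the flat bundle $(\mathcal L\otimes|\mathrm{Det}\,\mathcal P^*|^{1/2})|_\Lambda$ (half-densities being differentiated with respect to constant frames of $L_{\mathcal P}$) has trivial holonomy;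 $S_\Lambda$ is the space of its covariantly constant sections, and $\mathcal H_{\mathcal P}=\bigoplus_{\Lambda}S_\Lambda$ over the Bohr–Sommerfeld leaves, with the form for which distinct leaves are orthogonal and $\langle s\otimes\mu,s'\otimes\mu'\rangle=\int_\Lambda (s,s')\,\mu\mu'$ on $S_\Lambda$. For two such polarizations $\mathcal P_1,\mathcal P_2$ (transverse or not) put $L_{12}=L_{\mathcal P_1}\cap L_{\mathcal P_2}$, $h=g-\dim L_{12}$. The BKS pairing $\langle\langle\cdot,\cdot\rangle\rangle:\mathcal H_{\mathcal P_2}\times\mathcal H_{\mathcal P_1}\to\mathbb C$ is the sesquilinear extension of $$\langle\langle s_2\otimes\mu_2,s_1\otimes\mu_1\rangle\rangle=\int_{\Lambda_2\cap\Lambda_1}(s_2,s_1)\,\mu_2*\mu_1,\qquad s_i\otimes\mu_i\in S_{\Lambda_i},$$ where $\mu_2*\mu_1$ is the density on $L_{12}$ with $(\mu_2*\mu_1)(\underline W)=\mu_2(\underline V_2,\underline W)\,\mu_1(\underline V_1,\underline W)$ whenever $\underline W$, $(\underline V_1,\underline W)$, $(\underline V_2,\underline W)$ are bases of $L_{12},L_{\mathcal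 P_1},L_{\mathcal P_2}$ such that, for some vectors $T_j$, $k\omega(W_i,T_j)=\delta_{ij}$, $k\omega(V_{2i},V_{1j})=\delta_{ij}$, $\omega(V_{1i},T_j)=\omega(V_{2i},T_j)=0$. **Theorem.** The forms on $\mathcal H_{\mathcal P_1}$ and $\mathcal H_{\mathcal P_2}$ are inner products. There is a unique linear operator $F=F_{\mathcal P_2\mathcal P_1}:\mathcal H_{\mathcal P_1}\to\mathcal H_{\mathcal P_2}$ with $\langle\psi_2,F\psi_1\rangle=\langle\langle\psi_2,\psi_1\rangle\rangle$ for all $\psi_1,\psi_2$, and it is unitary. Moreover, there are symplectic bases $(W_{1i};W_{1i}^\perp)$, $(W_{2i};W_{2i}^\perp)$ of $\mathcal V$ (meaning $\omega(W_i,W_j^\perp)=\delta_{ij}$, $\omega(W_i,W_j)=\omega(W^\perp_i,W^\perp_j)=0$) that are $\mathbb Z$-bases of $\mathcal Z$, with $L_{\mathcal P_a}=\mathrm{span}\{W_{ai}\}$, $a=1,2$, such that $W_{1i}=W_{2i}$ and $W_{1i}^\perp=W_{2i}^\perp$ for $i>h$ and $L_{12}=\mathrm{span}\{W_{1i}: i>h\}$.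 For any such bases, let $\sigma_{a\mathbf q}=s_{a\mathbf q}\otimes\delta_a$, $\mathbf q\in(\mathbb Z/k)^g$, where $\delta_a(W_{a1},\dots,W_{ag})=1$ and $s_{a\mathbf q}$ is the section over the leaf $\{X: k\,\omega(W_{ai},X)\equiv q_i \bmod k,\ i=1,\dots,g\}$ represented by $e^{-2\pi i kK_a(X)}$, $K_a(X)=\tfrac12\sum_i\omega(X,W_{ai}^\perp)\,\omega(W_{ai},X)$. Then $(\sigma_{a\mathbf q})_{\mathbf q}$ is an orthonormal basis of $\mathcal H_{\mathcal P_a}$. With the $h\times h$ matrices $\check\omega(2,1)_{ij}=\omega(W_{2i},W_{1j})$, $\check\omega(2,1^\perp)_{ij}=\omega(W_{2i},W^\perp_{1j})$, $\check\omega(2^\perp,1)_{ij}=\omega(W^\perp_{2i},W_{1j})$, $1\le i,j\le h$, one has $\det\check\omega(2,1)\ne0$, and $F\sigma_{1\mathbf q_1}=\sum_{\mathbf q_2}\mathbf M(2,1)_{\mathbf q_2\mathbf q_1}\sigma_{2\mathbf q_2}$ with $$\mathbf M(2,1)_{\mathbf q_2\mathbf q_1}=\bigl|k^h\det\check\omega(2,1)\bigr|^{-1/2}\prod_{i=h+1}^g\delta_{q_{2i}q_{1i}}\sum_{[\mathbf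 l]\in\mathbb Z^h/\check\omega(2,1)\mathbb Z^h}e^{\frac{\pi i}{k}A_{\mathbf l}},$$ $$A_{\mathbf l}={}^t\check{\mathbf q}_1\check\omega(2,1)^{-1}\check\omega(2,1^\perp)\check{\mathbf q}_1-2\,{}^t\check{\mathbf q}_1\check\omega(2,1)^{-1}(\check{\mathbf q}_2+k\mathbf l)-{}^t(\check{\mathbf q}_2+k\mathbf l)\,\check\omega(2^\perp,1)\check\omega(2,1)^{-1}(\check{\mathbf q}_2+k\mathbf l),$$ where $\check{\mathbf q}_a\in\mathbb Z^h$ consists of the first $h$ entries of any integer vector representing $\mathbf q_a$, and any representatives $\mathbf l$ of the classes may be used. -/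

import Mathlib

noncomputable section

/-- A symplectic torus `V / Z` of dimension `2g`: a symplectic form `ω` on the real vector space `V`
and a full lattice `Z` in `V` (the `ℤ`-span of a real basis with `2g` elements) that is self-dual
with respect to `ω`. -/
structure SymplecticTorus (g : ℕ) (V : Type*) [AddCommGroup V] [Module ℝ V] where
  ω : LinearMap.BilinForm ℝ V
  alt : ω.IsAlt
  nondegenerate : ω.Nondegenerate
  Z : AddSubgroup V
  lattice : ∃ b : Module.Basis (Fin (2 * g)) ℝ V, AddSubgroup.closure (Set.range b) = Z
  selfDual : ∀ X : V, X ∈ Z ↔ ∀ W ∈ Z, ∃ n : ℤ, ω X W = n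

/-- An invariant real polarization of the torus: a rational Lagrangian subspace `L` of `V`. -/
structure RealPolarization {g : ℕ} {V : Type*} [AddCommGroup V] [Module ℝ V]
    (T : SymplecticTorus g V) where
  L : Submodule ℝ V
  isotropic : ∀ X ∈ L, ∀ Y ∈ L, T.ω X Y = 0
  finrank_eq : Module.finrank ℝ L = g
  rational : Submodule.span ℝ ((L : Set V) ∩ (T.Z : Set V)) = L

/-- Complex-valued densities of order `p` on an `n`-dimensional real vector space `U`: functions `ν`
of `n`-tuples with `ν (v · A) = |det A| ^ p * ν v` for `A ∈ GL(n, ℝ)`.  (Such a function vanishes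
on linearly dependent tuples when `p ≠ 0`.) -/
def densities (p : ℝ) (n : ℕ) (U : Type*) [AddCommGroup U] [Module ℝ U] :
    Submodule ℂ ((Fin n → U) → ℂ) where
  carrier := {ν | ∀ (v : Fin n → U) (A : Matrix (Fin n) (Fin n) ℝ), A.det ≠ 0 →
    ν (fun j => ∑ i, A i j • v i) = ((|A.det| ^ p : ℝ) : ℂ) * ν v}
  add_mem' := by
    intro a b ha hb v A hA
    simp only [Pi.add_apply]
    rw [ha v A hA, hb v A hA, mul_add]
  zero_mem' := by
    intro v A _
    simp
  smul_mem' := by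
    intro c a ha v A hA
    simp only [Pi.smul_apply, smul_eq_mul]
    rw [ha v A hA]
    ring

section Quantization

variable {g : ℕ} {V : Type*} [AddCommGroup V] [Module ℝ V] {T : SymplecticTorus g V}

/-- The subgroup `L + Z` of `V`. -/
def leafGroup (T : SymplecticTorus g V) (U : Submodule ℝ V) : AddSubgroup V :=
  U.toAddSubgroup ⊔ T.Z

/-- The leaf space of the foliation of `V / Z` by the images of the translates of `U`.  A leaf `Λ`
is identified with its preimage in `V`, a coset of `U + Z`. -/
abbrev Leaf (T : SymplecticTorus g V) (U : Submodule ℝ V) : Type _ := V ⧸ leafGroup T U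

/-- The image in the torus of the point `X` lies on the leaf `Λ`. -/
def OnLeaf {U : Submodule ℝ V} (Λ : Leaf T U) (X : V) : Prop :=
  (QuotientAddGroup.mk X : Leaf T U) = Λ

/-- The fibre of the (pulled back, trivial) bundle `ℂ ⊗ |Det P*|^(1/2)`: complex-valued
half-densities on the Lagrangian subspace. -/
abbrev halfDensities (P : RealPolarization T) : Submodule ℂ ((Fin g → P.L) → ℂ) :=
  densities (1 / 2) g P.L

/-- The invariant symplectic potential `θ₀`, evaluated at the point `X` on the vector `Y`. -/
def thetaZero (T : SymplecticTorus g V) (X Y : V) : ℝ := 1 / 2 * T.ω X Y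

/-- `u t`, an element of the fibre over `X + t Y`, is parallel along the line `t ↦ X + t Y` for the
connection that is `d - 2πik θ₀` on the line bundle and the canonical flat one (constant frames of
`L` are parallel) on half-densities. -/
def IsParallelAlong (k : ℕ) (P : RealPolarization T) (X Y : V)
    (u : ℝ → (Fin g → P.L) → ℂ) : Prop :=
  ∀ (w : Fin g → P.L) (t : ℝ),
    HasDerivAt (fun τ : ℝ => u τ w)
      (2 * (Real.pi : ℂ) * Complex.I * (k : ℂ) * (thetaZero T (X + t • Y) Y : ℂ) * u t w) t

/-- The multiplier of the lattice action `W · (X, z) = (X + W, exp (πik ω(W, X)) z)` whose quotient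
is the prequantum line bundle. -/
def multiplier (T : SymplecticTorus g V) (k : ℕ) (W X : V) : ℂ :=
  Complex.exp ((Real.pi : ℂ) * Complex.I * (k : ℂ) * (T.ω W X : ℂ))

/-- Bohr–Sommerfeld leaves: the holonomy along every loop `t ↦ X + t W`, `W ∈ L ∩ Z`, `0 ≤ t ≤ 1`,
of the leaf is trivial, i.e. parallel transport leads from a vector over `X` to the vector over
`X + W` that is identified with it. (These loops represent the fundamental group of the leaf.) -/
def IsBohrSommerfeld (k : ℕ) (P : RealPolarization T) (Λ : Leaf T P.L) : Prop :=
  ∀ X : V, OnLeaf Λ X → ∀ W ∈ T.Z, W ∈ P.L → ∀ u : ℝ → (Fin g → P.L) → ℂ,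
    (∀ t, u t ∈ halfDensities P) → IsParallelAlong k P X W u → u 1 = multiplier T k W X • u 0

/-- The space `S_Λ` of covariantly constant sections over the leaf `Λ` of the prequantum line bundle
tensored with the half-density bundle.  Sections over `Λ` are given as lattice invariant sections
over the preimage of `Λ` in `V`, extended by zero to `V`. -/
def parallelSections (k : ℕ) (P : RealPolarization T) (Λ : Leaf T P.L) :
    Submodule ℂ (V → (Fin g → P.L) → ℂ) where
  carrier := {ψ | (∀ X, ψ X ∈ halfDensities P) ∧ (∀ X, ¬ OnLeaf Λ X → ψ X = 0) ∧
    (∀ W ∈ T.Z, ∀ X, ψ (X + W) = multiplier T k W X • ψ X) ∧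
    (∀ X, OnLeaf Λ X → ∀ Y ∈ P.L, IsParallelAlong k P X Y (fun t => ψ (X + t • Y)))}
  add_mem' := by
    rintro a b ⟨ha0, ha1, ha2, ha3⟩ ⟨hb0, hb1, hb2, hb3⟩
    refine ⟨fun X => add_mem (ha0 X) (hb0 X), fun X hX => ?_, fun W hW X => ?_,
      fun X hX Y hY w t => ?_⟩
    · simp [ha1 X hX, hb1 X hX]
    · simp [ha2 W hW X, hb2 W hW X]
    · have h := (ha3 X hX Y hY w t).add (hb3 X hX Y hY w t)
      refine h.congr_deriv ?_
      change _ = _ * (a (X + t • Y) w + b (X + t • Y) w)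
      ring
  zero_mem' := by
    refine ⟨fun X => zero_mem _, fun X _ => rfl, fun W _ X => by simp, fun X _ Y _ w t => ?_⟩
    simpa using hasDerivAt_const t (0 : ℂ)
  smul_mem' := by
    rintro c a ⟨ha0, ha1, ha2, ha3⟩
    refine ⟨fun X => Submodule.smul_mem _ c (ha0 X), fun X hX => ?_, fun W hW X => ?_,
      fun X hX Y hY w t => ?_⟩
    · simp [ha1 X hX]
    · simp [ha2 W hW X, smul_comm c]
    · have h := (ha3 X hX Y hY w t).const_mul c
      refine h.congr_deriv ?_
      change _ = _ * (c * a (X + t • Y) w)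
      ring

/-- The quantum Hilbert space: the direct sum of the spaces `S_Λ` over the Bohr–Sommerfeld leaves.
Its inner product is `quantumInner`. -/
abbrev QuantumSpace (k : ℕ) (P : RealPolarization T) : Type _ :=
  DirectSum {Λ : Leaf T P.L // IsBohrSommerfeld k P Λ} (fun Λ => parallelSections k P Λ.1)

/-- `w` is a basis of the lattice `U ∩ Z` and linearly independent over `ℝ`. -/
def IsLatticeBasis (T : SymplecticTorus g V) (U : Submodule ℝ V) {d : ℕ} (w : Fin d → U) : Prop :=
  LinearIndependent ℝ w ∧
    AddSubgroup.closure (Set.range fun j => (w j : V)) = T.Z ⊓ U.toAddSubgroup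

open Classical in
/-- The integral of a (lattice invariant) field `ρ` of densities of order one on the `d`-dimensional
rational subspace `U` over the `d`-torus that is the image of `X + U` in `V / Z`: in the coordinates
`t ∈ [0,1]^d` given by a basis `w` of the lattice `U ∩ Z`, one integrates `ρ(w)`. -/
def leafIntegral (T : SymplecticTorus g V) (U : Submodule ℝ V) (d : ℕ)
    (ρ : V → (Fin d → U) → ℂ) (X : V) : ℂ :=
  if h : ∃ w : Fin d → U, IsLatticeBasis T U w then
    ∫ t in Set.Icc (0 : Fin d → ℝ) 1, ρ (X + ∑ j, t j • (h.choose j : V)) h.choose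
  else 0

/-- The inner product of the quantum Hilbert space, antilinear in the first variable: distinct
leaves are orthogonal, and on `S_Λ` it is the integral over `Λ` of `(s, s') μ * μ'`. -/
def quantumInner {k : ℕ} {P : RealPolarization T} (ψ φ : QuantumSpace k P) : ℂ :=
  ∑ᶠ Λ : {Λ : Leaf T P.L // IsBohrSommerfeld k P Λ},
    leafIntegral T P.L g
      (fun X w => (starRingEnd ℂ) ((ψ Λ).1 X w) * (φ Λ).1 X w) (Quotient.out Λ.1)

/-- The intersection of the two Lagrangian subspaces. -/
abbrev interL (P₂ P₁ : RealPolarization T) : Submodule ℝ V := P₁.L ⊓ P₂.L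

/-- The codimension `h = g - dim (L₁ ∩ L₂)`. -/
def codimInter (P₂ P₁ : RealPolarization T) : ℕ := g - Module.finrank ℝ (interL P₂ P₁)

/-- `U₁ = (V₁, w)` and `U₂ = (V₂, w)` are bases of `L₁`, `L₂` that extend the basis `w` of
`L₁ ∩ L₂`, and there are vectors `t` with `kω(wᵢ, tⱼ) = δᵢⱼ`, `kω(V₂ᵢ, V₁ⱼ) = δᵢⱼ` and
`kω(V₁ᵢ, tⱼ) = kω(V₂ᵢ, tⱼ) = 0`. -/
def IsPairingFrame (k : ℕ) (P₂ P₁ : RealPolarization T)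
    (w : Fin (Module.finrank ℝ (interL P₂ P₁)) → interL P₂ P₁)
    (U₂ : Fin g → P₂.L) (U₁ : Fin g → P₁.L) : Prop :=
  LinearIndependent ℝ w ∧ LinearIndependent ℝ U₁ ∧ LinearIndependent ℝ U₂ ∧
  (∀ (i : Fin g) (j : Fin (Module.finrank ℝ (interL P₂ P₁))),
    (i : ℕ) = codimInter P₂ P₁ + j → (U₁ i : V) = w j ∧ (U₂ i : V) = w j) ∧
  (∀ i j : Fin g, (i : ℕ) < codimInter P₂ P₁ → (j : ℕ) < codimInter P₂ P₁ →
    (k : ℝ) * T.ω (U₂ i) (U₁ j) = if i = j then 1 else 0) ∧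
  ∃ t : Fin (Module.finrank ℝ (interL P₂ P₁)) → V,
    (∀ i j, (k : ℝ) * T.ω (w i) (t j) = if i = j then 1 else 0) ∧
    (∀ (i : Fin g) j, (i : ℕ) < codimInter P₂ P₁ →
      (k : ℝ) * T.ω (U₁ i) (t j) = 0 ∧ (k : ℝ) * T.ω (U₂ i) (t j) = 0)

open Classical in
/-- The density `(s₂, s₁) μ₂ * μ₁` on `L₁ ∩ L₂`, whose value on a basis `w` of `L₁ ∩ L₂` is
`(s₂, s₁) μ₂(U₂) μ₁(U₁)` for any frames as in `IsPairingFrame` (the value does not depend on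
them). -/
def pairingDensity (k : ℕ) {P₂ P₁ : RealPolarization T} (ν₂ : (Fin g → P₂.L) → ℂ)
    (ν₁ : (Fin g → P₁.L) → ℂ)
    (w : Fin (Module.finrank ℝ (interL P₂ P₁)) → interL P₂ P₁) : ℂ :=
  if h : ∃ U : (Fin g → P₂.L) × (Fin g → P₁.L), IsPairingFrame k P₂ P₁ w U.1 U.2 then
    (starRingEnd ℂ) (ν₂ h.choose.1) * ν₁ h.choose.2
  else 0

/-- The components of `Λ₂ ∩ Λ₁`: they are the images in the torus of translates of `L₁ ∩ L₂`. -/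
def interComponents {P₂ P₁ : RealPolarization T} (Λ₂ : Leaf T P₂.L) (Λ₁ : Leaf T P₁.L) :
    Set (Leaf T (interL P₂ P₁)) :=
  {c | ∃ X : V, OnLeaf c X ∧ OnLeaf Λ₂ X ∧ OnLeaf Λ₁ X}

/-- The Blattner–Kostant–Sternberg pairing: the sum over pairs of Bohr–Sommerfeld leaves of the
integrals over `Λ₂ ∩ Λ₁` of `(s₂, s₁) μ₂ * μ₁`. -/
def bksPairing {k : ℕ} {P₂ P₁ : RealPolarization T} (ψ₂ : QuantumSpace k P₂)
    (ψ₁ : QuantumSpace k P₁) : ℂ :=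
  ∑ᶠ (Λ₂ : {Λ : Leaf T P₂.L // IsBohrSommerfeld k P₂ Λ})
    (Λ₁ : {Λ : Leaf T P₁.L // IsBohrSommerfeld k P₁ Λ}) (c : interComponents Λ₂.1 Λ₁.1),
    leafIntegral T (interL P₂ P₁) (Module.finrank ℝ (interL P₂ P₁))
      (fun X w => pairingDensity k ((ψ₂ Λ₂).1 X) ((ψ₁ Λ₁).1 X) w) (Quotient.out c.1)

/-- `F` is the linear operator induced by the Blattner–Kostant–Sternberg pairing. -/
def IsBKSOperator {k : ℕ} {P₂ P₁ : RealPolarization T}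
    (F : QuantumSpace k P₁ →ₗ[ℂ] QuantumSpace k P₂) : Prop :=
  ∀ (ψ₂ : QuantumSpace k P₂) (ψ₁ : QuantumSpace k P₁),
    quantumInner ψ₂ (F ψ₁) = bksPairing ψ₂ ψ₁

/-- A symplectic basis `(W; W')` of `V` that is a basis of the lattice, with `W` spanning `L`. -/
structure PolarizationBasis (P : RealPolarization T) where
  W : Fin g → P.L
  W' : Fin g → V
  span_W : Submodule.span ℝ (Set.range fun i => (W i : V)) = P.L
  lattice_eq : AddSubgroup.closure ((Set.range fun i => (W i : V)) ∪ Set.range W') = T.Z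
  pairing : ∀ i j, T.ω (W i) (W' j) = if i = j then 1 else 0
  isotropic' : ∀ i j, T.ω (W' i) (W' j) = 0

/-- The symplectic potential `θ_P` at the point `X` on the vector `Y`: it vanishes on the `Wᵢ` and
its value on `Wᵢ'` is `ω(X, Wᵢ')`.  Note that `ω(Wᵢ, Y)` is the `Wᵢ'`-coordinate of `Y`. -/
def thetaP {P : RealPolarization T} (B : PolarizationBasis P) (X Y : V) : ℝ :=
  ∑ i, T.ω (B.W i) Y * T.ω X (B.W' i)

/-- The function `K_P` with `K_P(0) = 0` and `θ_P = θ₀ + dK_P`; see `hasDerivAt_potentialK`. -/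
def potentialK {P : RealPolarization T} (B : PolarizationBasis P) (X : V) : ℝ :=
  1 / 2 * ∑ i, T.ω X (B.W' i) * T.ω (B.W i) X

/-- The expansion of a vector in a symplectic basis. -/
lemma PolarizationBasis.expand {P : RealPolarization T} (B : PolarizationBasis P) (X : V) :
    X = ∑ i, (T.ω X (B.W' i) • (B.W i : V) + T.ω (B.W i) X • B.W' i) := by
  have hspan : Submodule.span ℝ ((Set.range fun i => (B.W i : V)) ∪ Set.range B.W') = ⊤ := by
    obtain ⟨b, hb⟩ := T.lattice
    rw [eq_top_iff, ← b.span_eq, Submodule.span_le]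
    rintro _ ⟨i, rfl⟩
    have h1 : b i ∈ AddSubgroup.closure
        ((Set.range fun i => (B.W i : V)) ∪ Set.range B.W') := by
      rw [B.lattice_eq, ← hb]
      exact AddSubgroup.subset_closure ⟨i, rfl⟩
    have h2 : AddSubgroup.closure ((Set.range fun i => (B.W i : V)) ∪ Set.range B.W') ≤
        (Submodule.span ℝ ((Set.range fun i => (B.W i : V)) ∪ Set.range B.W')).toAddSubgroup :=
      (AddSubgroup.closure_le _).2 Submodule.subset_span
    exact h2 h1
  let f : V →ₗ[ℝ] V := ∑ i, ((T.ω.flip (B.W' i)).smulRight (B.W i : V) +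
    (T.ω (B.W i)).smulRight (B.W' i))
  have hf : LinearMap.id = f := by
    refine LinearMap.ext_on hspan ?_
    rintro _ (⟨j, rfl⟩ | ⟨j, rfl⟩)
    · have h0 : ∀ i, T.ω (B.W i) (B.W j) = 0 := fun i =>
        P.isotropic _ (B.W i).2 _ (B.W j).2
      simp [f, B.pairing, h0]
    · simp [f, B.pairing, B.isotropic']
  have := LinearMap.congr_fun hf X
  simpa [f] using this

lemma potentialK_zero {P : RealPolarization T} (B : PolarizationBasis P) :
    potentialK B 0 = 0 := by
  simp [potentialK]

/-- `dK_P = θ_P - θ₀`. -/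
lemma hasDerivAt_potentialK {P : RealPolarization T} (B : PolarizationBasis P) (X Y : V) :
    HasDerivAt (fun t : ℝ => potentialK B (X + t • Y)) (thetaP B X Y - thetaZero T X Y) 0 := by
  have hω : T.ω X Y = ∑ i, (T.ω X (B.W' i) * T.ω (B.W i) Y - T.ω (B.W i) X * T.ω Y (B.W' i)) := by
    conv_lhs => rw [B.expand X]
    simp only [map_sum, map_add, map_smul, LinearMap.sum_apply, LinearMap.add_apply,
      LinearMap.smul_apply, smul_eq_mul]
    refine Finset.sum_congr rfl fun i _ => ?_
    rw [← T.alt.neg_eq Y (B.W' i)]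
    ring
  have h : ∀ i, HasDerivAt
      (fun t : ℝ => (T.ω X (B.W' i) + t * T.ω Y (B.W' i)) * (T.ω (B.W i) X + t * T.ω (B.W i) Y))
      (T.ω Y (B.W' i) * T.ω (B.W i) X + T.ω X (B.W' i) * T.ω (B.W i) Y) 0 := by
    intro i
    have h1 := ((hasDerivAt_id (0 : ℝ)).mul_const (T.ω Y (B.W' i))).const_add (T.ω X (B.W' i))
    have h2 := ((hasDerivAt_id (0 : ℝ)).mul_const (T.ω (B.W i) Y)).const_add (T.ω (B.W i) X)
    refine (h1.mul h2).congr_deriv ?_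
    simp
  have hs := (HasDerivAt.fun_sum (u := Finset.univ) fun i _ => h i).const_mul (1 / 2 : ℝ)
  have e : (fun t : ℝ => potentialK B (X + t • Y)) = fun t : ℝ => 1 / 2 * ∑ i,
      (T.ω X (B.W' i) + t * T.ω Y (B.W' i)) * (T.ω (B.W i) X + t * T.ω (B.W i) Y) := by
    ext t
    simp [potentialK]
  rw [e]
  refine hs.congr_deriv ?_
  simp only [thetaP, thetaZero, hω, Finset.mul_sum, ← Finset.sum_sub_distrib]
  refine Finset.sum_congr rfl fun i _ => ?_
  ring

/-- `X` lies over the Bohr–Sommerfeld leaf `Λ_q`, i.e. `k ω(Wᵢ, X) ≡ qᵢ mod k` for all `i`. -/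
def OverOrbit {k : ℕ} {P : RealPolarization T} (B : PolarizationBasis P)
    (q : Fin g → ZMod k) (X : V) : Prop :=
  ∀ i, ∃ n : ℤ, (n : ZMod k) = q i ∧ (k : ℝ) * T.ω (B.W i) X = n

open Classical in
/-- `σ` is the family `σ_q = s_q ⊗ δ_q`: the section `σ_q` is supported on the leaf `Λ_q`, and there
it is `exp (-2πik K_P) δ` with the half-density `δ` such that `δ(W₁, …, W_g) = 1`. -/
def IsStandardFamily {k : ℕ} {P : RealPolarization T} (B : PolarizationBasis P)
    (σ : (Fin g → ZMod k) → QuantumSpace k P) : Prop :=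
  ∀ (q : Fin g → ZMod k) (Λ : {Λ : Leaf T P.L // IsBohrSommerfeld k P Λ}) (X : V),
    (σ q Λ).1 X B.W =
      if OnLeaf Λ.1 X ∧ OverOrbit B q X then
        Complex.exp (-(2 * (Real.pi : ℂ) * Complex.I * (k : ℂ) * (potentialK B X : ℂ)))
      else 0

/-- The bases have `W₁ᵢ = W₂ᵢ`, `W₁ᵢ' = W₂ᵢ'` for the last `dim (L₁ ∩ L₂)` indices, and these `W₁ᵢ`
span `L₁ ∩ L₂`.  For transverse polarizations there is no condition. -/
def AreCompatible {P₂ P₁ : RealPolarization T} (B₂ : PolarizationBasis P₂)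
    (B₁ : PolarizationBasis P₁) : Prop :=
  (∀ i : Fin g, codimInter P₂ P₁ ≤ (i : ℕ) →
    (B₁.W i : V) = B₂.W i ∧ B₁.W' i = B₂.W' i) ∧
  Submodule.span ℝ ((fun i => (B₁.W i : V)) '' {i : Fin g | codimInter P₂ P₁ ≤ (i : ℕ)}) =
    interL P₂ P₁

/-- The inclusion of the first `h` indices. -/
def head (P₂ P₁ : RealPolarization T) (i : Fin (codimInter P₂ P₁)) : Fin g :=
  Fin.castLE (Nat.sub_le _ _) i

/-- The `h × h` matrix `ω(2,1)ᵢⱼ = ω(W₂ᵢ, W₁ⱼ)`. -/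
def omega21 {P₂ P₁ : RealPolarization T} (B₂ : PolarizationBasis P₂) (B₁ : PolarizationBasis P₁) :
    Matrix (Fin (codimInter P₂ P₁)) (Fin (codimInter P₂ P₁)) ℝ :=
  Matrix.of fun i j => T.ω (B₂.W (head P₂ P₁ i)) (B₁.W (head P₂ P₁ j))

/-- The `h × h` matrix `ω(2,1')ᵢⱼ = ω(W₂ᵢ, W₁ⱼ')`. -/
def omega21' {P₂ P₁ : RealPolarization T} (B₂ : PolarizationBasis P₂) (B₁ : PolarizationBasis P₁) :
    Matrix (Fin (codimInter P₂ P₁)) (Fin (codimInter P₂ P₁)) ℝ :=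
  Matrix.of fun i j => T.ω (B₂.W (head P₂ P₁ i)) (B₁.W' (head P₂ P₁ j))

/-- The `h × h` matrix `ω(2',1)ᵢⱼ = ω(W₂ᵢ', W₁ⱼ)`. -/
def omega2'1 {P₂ P₁ : RealPolarization T} (B₂ : PolarizationBasis P₂) (B₁ : PolarizationBasis P₁) :
    Matrix (Fin (codimInter P₂ P₁)) (Fin (codimInter P₂ P₁)) ℝ :=
  Matrix.of fun i j => T.ω (B₂.W' (head P₂ P₁ i)) (B₁.W (head P₂ P₁ j))

/-- The subgroup `A ℤʰ` of `ℤʰ`, for a matrix `A` (with integer entries). -/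
def imageLattice {h : ℕ} (A : Matrix (Fin h) (Fin h) ℝ) : AddSubgroup (Fin h → ℤ) where
  carrier := {m | ∃ n : Fin h → ℤ, (fun i => (m i : ℝ)) = A.mulVec fun j => (n j : ℝ)}
  add_mem' := by
    rintro a b ⟨m, hm⟩ ⟨n, hn⟩
    refine ⟨m + n, ?_⟩
    have e : (fun j => (((m + n) j : ℤ) : ℝ)) = (fun j => (m j : ℝ)) + fun j => (n j : ℝ) := by
      ext j; simp
    rw [e, Matrix.mulVec_add, ← hm, ← hn]
    ext j; simp
  zero_mem' := ⟨0, by ext i; simp [Matrix.mulVec, dotProduct]⟩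
  neg_mem' := by
    rintro a ⟨m, hm⟩
    refine ⟨-m, ?_⟩
    have e : (fun j => (((-m) j : ℤ) : ℝ)) = -fun j => (m j : ℝ) := by
      ext j; simp
    rw [e, Matrix.mulVec_neg, ← hm]
    ext j; simp

/-- The phase `A(2,1)` as a function of `l ∈ ℤʰ` and of integer vectors representing `q₂`, `q₁`. -/
def phaseA (k : ℕ) {P₂ P₁ : RealPolarization T} (B₂ : PolarizationBasis P₂)
    (B₁ : PolarizationBasis P₁) (l : Fin (codimInter P₂ P₁) → ℤ) (q₂ q₁ : Fin g → ℤ) : ℝ :=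
  let a : Fin (codimInter P₂ P₁) → ℝ := fun i => (q₁ (head P₂ P₁ i) : ℝ)
  let b : Fin (codimInter P₂ P₁) → ℝ := fun i => (q₂ (head P₂ P₁ i) : ℝ) + (k : ℝ) * (l i : ℝ)
  a ⬝ᵥ ((omega21 B₂ B₁)⁻¹ * omega21' B₂ B₁).mulVec a
    - 2 * (a ⬝ᵥ ((omega21 B₂ B₁)⁻¹).mulVec b)
    - b ⬝ᵥ (omega2'1 B₂ B₁ * (omega21 B₂ B₁)⁻¹).mulVec b

/-- The matrix entry `M(2,1)` at integer vectors representing `q₂, q₁ ∈ (ℤ/k)^g`; `r` chooses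
representatives of the elements of `ℤʰ / ω(2,1) ℤʰ`. -/
def bksMatrix (k : ℕ) {P₂ P₁ : RealPolarization T} (B₂ : PolarizationBasis P₂)
    (B₁ : PolarizationBasis P₁)
    (r : ((Fin (codimInter P₂ P₁) → ℤ) ⧸ imageLattice (omega21 B₂ B₁)) →
      (Fin (codimInter P₂ P₁) → ℤ)) (q₂ q₁ : Fin g → ℤ) : ℂ :=
  ((|(k : ℝ) ^ codimInter P₂ P₁ * (omega21 B₂ B₁).det| ^ (-(1 / 2) : ℝ) : ℝ) : ℂ) *
    (∏ i : Fin g, if codimInter P₂ P₁ ≤ (i : ℕ) ∧ (q₂ i : ZMod k) ≠ (q₁ i : ZMod k) then 0 else 1) *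
    ∑ᶠ c : (Fin (codimInter P₂ P₁) → ℤ) ⧸ imageLattice (omega21 B₂ B₁),
      Complex.exp ((Real.pi : ℂ) * Complex.I / (k : ℂ) * (phaseA k B₂ B₁ (r c) q₂ q₁ : ℂ))

end Quantization

end

-- A symplectic lattice basis `B` of a polarization turns everything into coordinates. The
-- Bohr–Sommerfeld leaves are the sets where k ω(Wᵢ, X) is congruent to qᵢ mod k, one for each q in
-- (ℤ/k)^g. Parallel transport and lattice translation determine a parallel section from one value,
-- and half-densities form a line, so each `S_Λ` has dimension at most one. The section exp(-2πikK)δ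
-- is parallel because θ_P vanishes along the leaves, and it is lattice equivariant because k is
-- even. Hence the quantum space is ℂ^(k^g) with its standard hermitian form in the basis `sigma`
-- (`apply_orbitEquiv`, `quantumInner_eq`). The operator F is then forced: its matrix is that of the
-- pairings of basis vectors, `orbitPairing`.
--
-- These pairings are computed in compatible bases, which exist because L₁ ∩ L₂ is again rational,
-- saturated sublattices are direct summands, and self-duality keeps symplectic dual bases inside
-- the lattice (`exists_compatible_bases`). Two leaves whose last labels differ are disjoint.
-- Otherwise the components of their intersection correspond to ℤʰ/ω(2,1)ℤʰ. On a component the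
-- integrand is constant: the half-densities contribute |kʰ det ω(2,1)|^(-1/2), whatever the frame,
-- and the sections contribute exp(2πik(K₂ - K₁)). The symplectic relations between the bases
-- rewrite this phase as exp(πiA/k) (`potentialK_sub`, `orbitPairing_eq_bksMatrix`).
--
-- Unitarity is orthogonality of characters (`sum_orbitPairing_mul_conj`). In a product of an entry
-- of one row with the conjugate of an entry of another, the part of A quadratic in q₁ cancels, so
-- each pair of components contributes a constant times a character of q₁. Put N = |det ω(2,1)|.
-- These characters have period Nk, so the sum is taken over a box of side Nk, where only equal rows
-- and equal components survive. The number of components is N, which is exactly what the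
-- normalization compensates. The matrix is square, so orthonormal rows suffice.

noncomputable section

-- Characters of the real line and integral bases

/-- The character `x ↦ exp (2πix)` of `ℝ`. -/
def expi (x : ℝ) : ℂ := Complex.exp (2 * (Real.pi : ℂ) * Complex.I * (x : ℂ))

lemma expi_zero : expi 0 = 1 := by simp [expi]

lemma expi_add (x y : ℝ) : expi (x + y) = expi x * expi y := by
  rw [expi, expi, expi, ← Complex.exp_add]
  push_cast
  ring_nf

lemma expi_ne_zero (x : ℝ) : expi x ≠ 0 := Complex.exp_ne_zero _

lemma expi_eq_one_iff (x : ℝ) : expi x = 1 ↔ ∃ n : ℤ, x = n := by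
  rw [expi, Complex.exp_eq_one_iff]
  refine exists_congr fun n => ?_
  have h : (2 * (Real.pi : ℂ) * Complex.I) ≠ 0 := Complex.two_pi_I_ne_zero
  constructor
  · intro h'
    have : (x : ℂ) = (n : ℂ) := by
      apply mul_left_cancel₀ h
      rw [h']; ring
    exact_mod_cast this
  · rintro rfl
    push_cast
    ring

lemma expi_intCast (n : ℤ) : expi n = 1 := (expi_eq_one_iff _).2 ⟨n, rfl⟩

lemma expi_neg (x : ℝ) : expi (-x) = (expi x)⁻¹ := by
  refine eq_inv_of_mul_eq_one_left ?_
  rw [← expi_add, neg_add_cancel, expi_zero]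

lemma conj_expi (x : ℝ) : (starRingEnd ℂ) (expi x) = expi (-x) := by
  rw [expi, expi, ← Complex.exp_conj]
  simp [map_ofNat]

lemma conj_expi_mul_self (x : ℝ) : (starRingEnd ℂ) (expi x) * expi x = 1 := by
  rw [conj_expi, ← expi_add]
  simp [expi_zero]

lemma expi_eq_of_sub_int {x y : ℝ} (n : ℤ) (h : x = y + n) : expi x = expi y := by
  rw [h, expi_add, expi_intCast, mul_one]

section

variable {V : Type*} [AddCommGroup V] [Module ℝ V]

lemma mem_closure_range_iff {ι : Type*} [Fintype ι] (w : ι → V) (X : V) :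
    X ∈ AddSubgroup.closure (Set.range w) ↔ ∃ n : ι → ℤ, X = ∑ i, (n i : ℝ) • w i := by
  rw [← Submodule.span_int_eq_addSubgroupClosure, Submodule.mem_toAddSubgroup,
    Submodule.mem_span_range_iff_exists_fun]
  refine exists_congr fun n => ?_
  simp only [Int.cast_smul_eq_zsmul]
  exact eq_comm

/-- Two finite families generating the same group differ by a matrix of determinant `±1`. -/
lemma abs_det_eq_one_of_closure_eq {ι : Type*} [Fintype ι] [DecidableEq ι]
    (u w : ι → V) (f : ι → V →ₗ[ℝ] ℝ) (hf : ∀ i j, f i (u j) = if i = j then 1 else 0)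
    (h : AddSubgroup.closure (Set.range u) = AddSubgroup.closure (Set.range w)) :
    |(Matrix.of fun i j => f i (w j)).det| = 1 := by
  have h1 : ∀ j, ∃ n : ι → ℤ, w j = ∑ i, (n i : ℝ) • u i := fun j => by
    rw [← mem_closure_range_iff, h]
    exact AddSubgroup.subset_closure ⟨j, rfl⟩
  have h2 : ∀ j, ∃ n : ι → ℤ, u j = ∑ i, (n i : ℝ) • w i := fun j => by
    rw [← mem_closure_range_iff, ← h]
    exact AddSubgroup.subset_closure ⟨j, rfl⟩
  choose n hn using h1
  choose m hm using h2
  have hA : (Matrix.of fun i j => f i (w j)) =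
      (Matrix.of fun i j => n j i : Matrix ι ι ℤ).map (Int.castRingHom ℝ) := by
    ext i j
    simp [hn, hf]
  have hprod : (Matrix.of fun i j => f i (w j)) *
      (Matrix.of fun i j => m j i : Matrix ι ι ℤ).map (Int.castRingHom ℝ) = 1 := by
    ext i j
    have := hf i j
    rw [hm j] at this
    simp only [map_sum, map_smul, smul_eq_mul] at this
    rw [Matrix.mul_apply, Matrix.one_apply, ← this]
    refine Finset.sum_congr rfl fun l _ => ?_
    simp [mul_comm]
  have hd := congrArg Matrix.det hprod
  rw [Matrix.det_mul, Matrix.det_one, hA, ← RingHom.mapMatrix_apply, ← RingHom.mapMatrix_apply,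
    ← RingHom.map_det, ← RingHom.map_det, ← map_mul] at hd
  have hd' : (Matrix.of fun i j => n j i : Matrix ι ι ℤ).det *
      (Matrix.of fun i j => m j i : Matrix ι ι ℤ).det = 1 := by
    have : ((_ : ℤ) : ℝ) = ((1 : ℤ) : ℝ) := hd.trans (by simp)
    exact_mod_cast this
  have hu : IsUnit (Matrix.of fun i j => n j i : Matrix ι ι ℤ).det :=
    IsUnit.of_mul_eq_one _ hd'
  rw [hA, ← RingHom.mapMatrix_apply, ← RingHom.map_det]
  rcases Int.isUnit_iff.1 hu with h' | h' <;> simp [h']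

end

-- Coordinates of a polarization basis, half-densities, parallel transport

section Quantization

variable {g : ℕ} {V : Type*} [AddCommGroup V] [Module ℝ V] {T : SymplecticTorus g V}

namespace PolarizationBasis

variable {P : RealPolarization T} (B : PolarizationBasis P)

lemma W_mem (i : Fin g) : (B.W i : V) ∈ T.Z := by
  rw [← B.lattice_eq]
  exact AddSubgroup.subset_closure (Or.inl ⟨i, rfl⟩)

lemma W'_mem (i : Fin g) : B.W' i ∈ T.Z := by
  rw [← B.lattice_eq]
  exact AddSubgroup.subset_closure (Or.inr ⟨i, rfl⟩)

lemma omega_W_W (i j : Fin g) : T.ω (B.W i) (B.W j) = 0 :=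
  P.isotropic _ (B.W i).2 _ (B.W j).2

lemma mem_L_iff (X : V) : X ∈ P.L ↔ ∀ i, T.ω (B.W i) X = 0 := by
  constructor
  · exact fun h i => P.isotropic _ (B.W i).2 _ h
  · intro h
    rw [B.expand X]
    refine sum_mem fun i _ => ?_
    rw [h i, zero_smul, add_zero]
    exact P.L.smul_mem _ (B.W i).2

lemma _root_.SymplecticTorus.omega_int (T : SymplecticTorus g V) {X Y : V} (hX : X ∈ T.Z)
    (hY : Y ∈ T.Z) : ∃ n : ℤ, T.ω X Y = n := (T.selfDual X).1 hX Y hY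

lemma omega_comb_W (i : Fin g) (c : Fin g → ℝ) : T.ω (B.W i) (∑ j, c j • B.W' j) = c i := by
  simp [map_sum, B.pairing]

lemma omega_comb_W' (i : Fin g) (c : Fin g → ℝ) : T.ω (∑ j, c j • B.W' j) (B.W' i) = 0 := by
  simp [map_sum, B.isotropic']

/-- Subtracting the integer combination of the W' with the same pairings leaves a vector orthogonal
to all W, hence one in L. This makes membership in a leaf a matter of g residues. -/
lemma mem_leafGroup_iff (X : V) : X ∈ leafGroup T P.L ↔ ∀ i, ∃ n : ℤ, T.ω (B.W i) X = n := by
  rw [leafGroup, AddSubgroup.mem_sup]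
  constructor
  · rintro ⟨Y, hY, W, hW, rfl⟩ i
    rw [map_add, (B.mem_L_iff Y).1 hY i, zero_add]
    exact T.omega_int (B.W_mem i) hW
  · intro h
    choose n hn using h
    refine ⟨X - ∑ j, (n j : ℝ) • B.W' j, ?_, ∑ j, (n j : ℝ) • B.W' j, ?_, by simp⟩
    · change _ ∈ P.L
      rw [B.mem_L_iff]
      intro i
      rw [map_sub, B.omega_comb_W, hn, sub_self]
    · exact sum_mem fun i _ => by
        rw [Int.cast_smul_eq_zsmul]
        exact zsmul_mem (B.W'_mem i) _

lemma coe_eq_sum (X : P.L) : (X : V) = ∑ i, T.ω (X : V) (B.W' i) • (B.W i : V) := by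
  conv_lhs => rw [B.expand (X : V)]
  refine Finset.sum_congr rfl fun i _ => ?_
  rw [(B.mem_L_iff _).1 X.2 i, zero_smul, add_zero]

lemma eq_sum (X : P.L) : X = ∑ i, T.ω (X : V) (B.W' i) • B.W i := by
  apply Subtype.ext
  rw [B.coe_eq_sum X]
  simp [map_sum, B.pairing]

lemma linearIndependent_W : LinearIndependent ℝ B.W := by
  rw [Fintype.linearIndependent_iff]
  intro c hc i
  have h := congrArg (fun X : P.L => T.ω (X : V) (B.W' i)) hc
  simpa [map_sum, B.pairing] using h

lemma isLatticeBasis_W : IsLatticeBasis T P.L B.W := by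
  refine ⟨B.linearIndependent_W, le_antisymm ?_ ?_⟩
  · rw [AddSubgroup.closure_le]
    rintro _ ⟨i, rfl⟩
    exact ⟨B.W_mem i, (B.W i).2⟩
  · rintro X ⟨hZ, hL⟩
    rw [mem_closure_range_iff]
    choose n hn using fun i => T.omega_int hZ (B.W'_mem i)
    refine ⟨n, ?_⟩
    refine (B.coe_eq_sum ⟨X, hL⟩).trans ?_
    simp [hn]

/-- The matrix whose columns are the coordinates of the vectors `w j` of `L`. -/
def coordMatrix {ι : Type*} (w : ι → P.L) : Matrix (Fin g) ι ℝ :=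
  Matrix.of fun i j => T.ω (w j : V) (B.W' i)

lemma coordMatrix_W : B.coordMatrix B.W = 1 := by
  ext i j
  simp [coordMatrix, B.pairing, Matrix.one_apply, eq_comm]

lemma coordMatrix_comb (v : Fin g → P.L) (A : Matrix (Fin g) (Fin g) ℝ) :
    B.coordMatrix (fun j => ∑ i, A i j • v i) = B.coordMatrix v * A := by
  ext i j
  simp [coordMatrix, Matrix.mul_apply, map_sum, mul_comm]

lemma eq_comb (w : Fin g → P.L) : w = fun j => ∑ i, B.coordMatrix w i j • B.W i := by
  ext1 j
  exact B.eq_sum (w j)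

lemma abs_det_coordMatrix {w : Fin g → P.L} (h : IsLatticeBasis T P.L w) :
    |(B.coordMatrix w).det| = 1 := by
  refine abs_det_eq_one_of_closure_eq (fun i => (B.W i : V)) (fun i => (w i : V))
    (fun i => T.ω.flip (B.W' i)) (fun i j => ?_) ?_
  · simp [B.pairing, eq_comm]
  · rw [B.isLatticeBasis_W.2, h.2]

/-- The half-density on `L` with value `1` on the basis `W`. -/
def halfDensity (w : Fin g → P.L) : ℂ := ((|(B.coordMatrix w).det| ^ (1 / 2 : ℝ) : ℝ) : ℂ)

lemma halfDensity_mem : B.halfDensity ∈ halfDensities P := by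
  intro v A _
  rw [halfDensity, coordMatrix_comb, Matrix.det_mul, abs_mul,
    Real.mul_rpow (abs_nonneg _) (abs_nonneg _), mul_comm, halfDensity]
  push_cast
  rfl

lemma halfDensity_W : B.halfDensity B.W = 1 := by
  simp [halfDensity, coordMatrix_W]

lemma halfDensity_of_isLatticeBasis {w : Fin g → P.L} (h : IsLatticeBasis T P.L w) :
    B.halfDensity w = 1 := by
  simp [halfDensity, B.abs_det_coordMatrix h]

/-- Half-densities form a line: independent frames are a single GL-orbit, so only the vanishing on
dependent tuples has to be derived from the transformation law. -/
lemma halfDensities_eq (ν : (Fin g → P.L) → ℂ) (hν : ν ∈ halfDensities P) :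
    ν = ν B.W • B.halfDensity := by
  ext w
  by_cases hd : (B.coordMatrix w).det = 0
  · have h0 : B.halfDensity w = 0 := by
      simp [halfDensity, hd]
    rw [Pi.smul_apply, h0, smul_zero]
    obtain ⟨c, hc, hc0⟩ := Matrix.exists_mulVec_eq_zero_iff.2 hd
    obtain ⟨i₀, hi₀⟩ : ∃ i, c i ≠ 0 := by
      by_contra! h
      exact hc (funext h)
    have hsum : ∑ j, c j • w j = 0 := by
      rw [B.eq_sum (∑ j, c j • w j)]
      refine Finset.sum_eq_zero fun i _ => ?_
      have := congrFun hc0 i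
      simp only [Matrix.mulVec, dotProduct, coordMatrix, Matrix.of_apply, Pi.zero_apply] at this
      have e : T.ω ((∑ j, c j • w j : P.L) : V) (B.W' i) = 0 := by
        rw [← this]
        simp [map_sum, mul_comm]
      rw [e, zero_smul]
    -- The matrix A = 1 + c dᵀ with dᵀc = 1 has determinant 2 and fixes w, because Σ cᵢ wᵢ = 0. The
    -- transformation law then reads ν w = √2 ν w, so ν w = 0.
    let d : Fin g → ℝ := Pi.single i₀ (c i₀)⁻¹
    have hdc : d ⬝ᵥ c = 1 := by simp [d, hi₀]
    let A : Matrix (Fin g) (Fin g) ℝ := 1 + Matrix.vecMulVec c d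
    have hA : A.det = 2 := by
      rw [show A = 1 + Matrix.replicateCol Unit c * Matrix.replicateRow Unit d by
        simp [A, Matrix.vecMulVec_eq Unit]]
      rw [Matrix.det_one_add_replicateCol_mul_replicateRow, hdc]
      norm_num
    have hw : (fun j => ∑ i, A i j • w i) = w := by
      ext1 j
      simp only [A, Matrix.add_apply, add_smul, Finset.sum_add_distrib, Matrix.vecMulVec_apply]
      have : ∑ i, (c i * d j) • w i = 0 := by
        rw [show ∑ i, (c i * d j) • w i = d j • ∑ i, c i • w i by
          rw [Finset.smul_sum]
          refine Finset.sum_congr rfl fun i _ => ?_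
          rw [smul_smul, mul_comm]]
        rw [hsum, smul_zero]
      rw [this, add_zero]
      simp [Matrix.one_apply]
    have key := hν w A (by rw [hA]; norm_num)
    rw [hw, hA] at key
    have h2 : ((|(2 : ℝ)| ^ (1 / 2 : ℝ) : ℝ) : ℂ) ≠ 1 := by
      intro h
      have h' : (|(2 : ℝ)| ^ (1 / 2 : ℝ) : ℝ) = 1 := by exact_mod_cast h
      rw [abs_of_pos (by norm_num), ← Real.sqrt_eq_rpow] at h'
      have := Real.sqrt_eq_one.1 h'
      norm_num at this
    by_contra hne
    exact h2 (mul_right_cancel₀ hne (by rw [one_mul]; exact key.symm))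
  · have := hν B.W (B.coordMatrix w) hd
    rw [← B.eq_comb w] at this
    rw [this, Pi.smul_apply, smul_eq_mul, mul_comm]
    rfl

end PolarizationBasis

-- `leafIntegral` depends on a chosen lattice basis. Every integrand to be evaluated is constant
-- along the leaf, with the same value for all lattice bases, so the choice drops out and the unit
-- cube contributes volume 1.
open Classical in
lemma leafIntegral_eq_of_const (U : Submodule ℝ V) (d : ℕ) (ρ : V → (Fin d → U) → ℂ) (X : V)
    (C : ℂ) (hw : ∃ w : Fin d → U, IsLatticeBasis T U w)
    (h : ∀ w : Fin d → U, IsLatticeBasis T U w → ∀ Y ∈ U, ρ (X + Y) w = C) :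
    leafIntegral T U d ρ X = C := by
  rw [leafIntegral, dif_pos hw]
  have : ∀ t : Fin d → ℝ, ρ (X + ∑ j, t j • (hw.choose j : V)) hw.choose = C := fun t =>
    h _ hw.choose_spec _ (sum_mem fun j _ => U.smul_mem _ (hw.choose j).2)
  simp only [this]
  rw [MeasureTheory.setIntegral_const, MeasureTheory.Measure.real,
    Real.volume_Icc_pi_toReal (by intro i; simp)]
  simp

/-- Parallel sections along a line are exponentials. -/
lemma isParallelAlong_iff (k : ℕ) (P : RealPolarization T) (X Y : V)
    (u : ℝ → (Fin g → P.L) → ℂ) :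
    IsParallelAlong k P X Y u ↔ ∀ t, u t = expi (k / 2 * T.ω X Y * t) • u 0 := by
  have hθ : ∀ t : ℝ, thetaZero T (X + t • Y) Y = 1 / 2 * T.ω X Y := fun t => by
    simp [thetaZero, T.alt.self_eq_zero Y]
  set c : ℂ := 2 * (Real.pi : ℂ) * Complex.I * (k / 2 * T.ω X Y : ℝ) with hc
  have hc' : ∀ t : ℝ, 2 * (Real.pi : ℂ) * Complex.I * (k : ℂ) *
      (thetaZero T (X + t • Y) Y : ℂ) = c := fun t => by
    rw [hθ, hc]; push_cast; ring
  have he : ∀ t : ℝ, expi (k / 2 * T.ω X Y * t) = Complex.exp (c * t) := fun t => by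
    rw [expi, hc]; push_cast; ring_nf
  have hder : ∀ (a : ℂ) (t : ℝ), HasDerivAt (fun τ : ℝ => Complex.exp (a * τ))
      (a * Complex.exp (a * t)) t := fun a t => by
    have h1 : HasDerivAt (fun τ : ℝ => a * (τ : ℂ)) a t := by
      simpa using (Complex.ofRealCLM.hasDerivAt (x := t)).const_mul a
    simpa [mul_comm] using h1.cexp
  simp only [IsParallelAlong, hc', he]
  constructor
  · intro h t
    ext w
    let f : ℝ → ℂ := fun τ => Complex.exp (-c * τ) * u τ w
    have hf : ∀ τ, HasDerivAt f 0 τ := fun τ =>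
      ((hder (-c) τ).mul (h w τ)).congr_deriv (by ring)
    have hconst := is_const_of_deriv_eq_zero (fun τ => (hf τ).differentiableAt)
      (fun τ => (hf τ).deriv) t 0
    simp only [f, Complex.ofReal_zero, mul_zero, Complex.exp_zero, one_mul] at hconst
    rw [Pi.smul_apply, smul_eq_mul, ← hconst, ← mul_assoc, ← Complex.exp_add]
    simp
  · intro h w t
    have e : (fun τ => u τ w) = fun τ : ℝ => Complex.exp (c * τ) * u 0 w := by
      ext τ
      rw [h τ]
      rfl
    rw [e, show u t w = Complex.exp (c * t) * u 0 w by rw [h t]; rfl]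
    exact ((hder c t).mul_const _).congr_deriv (by ring)

lemma multiplier_eq (k : ℕ) (W X : V) : multiplier T k W X = expi (k / 2 * T.ω W X) := by
  rw [multiplier, expi]
  push_cast
  ring_nf

lemma onLeaf_mk_iff {U : Submodule ℝ V} (X Y : V) :
    OnLeaf (QuotientAddGroup.mk Y : Leaf T U) X ↔ Y - X ∈ leafGroup T U := by
  rw [OnLeaf, QuotientAddGroup.eq, neg_add_eq_sub]

end Quantization

end

-- Bohr–Sommerfeld leaves and the orthonormal basis of the quantum space

noncomputable section

section Quantization

variable {g : ℕ} {V : Type*} [AddCommGroup V] [Module ℝ V] {T : SymplecticTorus g V}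

/-- Any two points over a leaf differ by a vector of L, handled by parallel transport, and a lattice
vector, handled by the multiplier. Both act on values by scalars, so one zero spreads over the leaf.
-/
lemma eq_zero_of_mem_parallelSections {k : ℕ} {P : RealPolarization T} {Λ : Leaf T P.L}
    {ψ : V → (Fin g → P.L) → ℂ} (hψ : ψ ∈ parallelSections k P Λ) {X₀ : V} (h₀ : OnLeaf Λ X₀)
    (hz : ψ X₀ = 0) : ψ = 0 := by
  obtain ⟨-, h1, h2, h3⟩ := hψ
  ext1 X
  by_cases hX : OnLeaf Λ X
  · have hmem : X - X₀ ∈ leafGroup T P.L := by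
      rw [← onLeaf_mk_iff]
      exact h₀.trans hX.symm
    rw [leafGroup, AddSubgroup.mem_sup] at hmem
    obtain ⟨Y, hY, W, hW, hsum⟩ := hmem
    have e : X = (X₀ + (1 : ℝ) • Y) + W := by
      rw [one_smul, add_assoc, hsum]; abel
    have := (isParallelAlong_iff k P X₀ Y _).1 (h3 X₀ h₀ Y hY) 1
    rw [e, h2 W hW, this]
    simp [hz]
  · exact h1 X hX

namespace PolarizationBasis

variable {k : ℕ} {P : RealPolarization T} (B : PolarizationBasis P)

lemma overOrbit_of_sub_mem {q : Fin g → ZMod k} {X Y : V} (hX : OverOrbit B q X)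
    (h : Y - X ∈ leafGroup T P.L) : OverOrbit B q Y := by
  intro i
  obtain ⟨n, hn, hx⟩ := hX i
  obtain ⟨m, hm⟩ := (B.mem_leafGroup_iff _).1 h i
  refine ⟨n + k * m, by simp [hn], ?_⟩
  rw [map_sub, sub_eq_iff_eq_add] at hm
  rw [hm, mul_add, hx]
  push_cast
  ring

lemma sub_mem_of_overOrbit [NeZero k] {q : Fin g → ZMod k} {X Y : V} (hX : OverOrbit B q X)
    (hY : OverOrbit B q Y) : Y - X ∈ leafGroup T P.L := by
  rw [B.mem_leafGroup_iff]
  intro i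
  obtain ⟨n, hn, hx⟩ := hX i
  obtain ⟨m, hm, hy⟩ := hY i
  have : ((n : ℤ) : ZMod k) = (m : ℤ) := hn.trans hm.symm
  rw [ZMod.intCast_eq_intCast_iff_dvd_sub] at this
  obtain ⟨l, hl⟩ := this
  refine ⟨l, ?_⟩
  have hk : (k : ℝ) ≠ 0 := NeZero.ne _
  apply mul_left_cancel₀ hk
  rw [map_sub, mul_sub, hx, hy]
  exact_mod_cast hl

lemma overOrbit_unique {q q' : Fin g → ZMod k} {X : V} (h : OverOrbit B q X)
    (h' : OverOrbit B q' X) : q = q' := by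
  ext1 i
  obtain ⟨n, hn, hx⟩ := h i
  obtain ⟨m, hm, hy⟩ := h' i
  have : n = m := by exact_mod_cast hx.symm.trans hy
  rw [← hn, ← hm, this]

/-- A point over the leaf `Λ_q`. -/
def basePoint (q : Fin g → ZMod k) : V := ∑ j, (((q j).val : ℝ) / k) • B.W' j

lemma overOrbit_basePoint [NeZero k] (q : Fin g → ZMod k) : OverOrbit B q (B.basePoint q) := by
  intro i
  refine ⟨(q i).val, by simp, ?_⟩
  rw [basePoint, B.omega_comb_W]
  have hk : (k : ℝ) ≠ 0 := NeZero.ne _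
  field_simp
  simp

/-- The leaf `Λ_q`. -/
def orbitLeaf (q : Fin g → ZMod k) : Leaf T P.L := QuotientAddGroup.mk (B.basePoint q)

lemma onLeaf_orbitLeaf_iff [NeZero k] (q : Fin g → ZMod k) (X : V) :
    OnLeaf (B.orbitLeaf q) X ↔ OverOrbit B q X := by
  rw [orbitLeaf, onLeaf_mk_iff]
  constructor
  · intro h
    refine B.overOrbit_of_sub_mem (B.overOrbit_basePoint q) ?_
    rw [← neg_sub]
    exact neg_mem h
  · exact fun h => B.sub_mem_of_overOrbit h (B.overOrbit_basePoint q)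

/-- Transport along W for unit time is exp(πik ω(X, W)), to be compared with the multiplier exp(πik
ω(W, X)). They agree exactly when k ω(W, X) is an integer, and the Wᵢ generate L ∩ Z. A nonzero
half-density is needed to detect the holonomy. -/
lemma isBohrSommerfeld_iff (Λ : Leaf T P.L) :
    IsBohrSommerfeld k P Λ ↔ ∀ X, OnLeaf Λ X → ∀ i, ∃ n : ℤ, (k : ℝ) * T.ω (B.W i) X = n := by
  have key : ∀ X W : V, expi (k / 2 * T.ω X W * 1) = multiplier T k W X ↔
      ∃ n : ℤ, (k : ℝ) * T.ω W X = n := fun X W => by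
    rw [multiplier_eq, ← expi_eq_one_iff, ← T.alt.neg_eq W X, mul_one, mul_neg, expi_neg,
      eq_comm, ← mul_right_inj' (expi_ne_zero (k / 2 * T.ω W X)),
      mul_inv_cancel₀ (expi_ne_zero _), ← expi_add]
    ring_nf
  constructor
  · intro h X hX i
    rw [← key]
    have h0 := h X hX (B.W i) (B.W_mem i) (B.W i).2
      (fun t => expi (k / 2 * T.ω X (B.W i) * t) • B.halfDensity)
      (fun t => Submodule.smul_mem _ _ B.halfDensity_mem)
      ((isParallelAlong_iff k P _ _ _).2 fun t => by simp [expi_zero])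
    have := congrFun h0 B.W
    simpa [expi_zero, halfDensity_W] using this
  · intro h X hX W hWZ hWL u _ hu
    rw [(isParallelAlong_iff k P X W u).1 hu 1]
    congr 1
    rw [key]
    choose n hn using h X hX
    choose m hm using fun i => T.omega_int hWZ (B.W'_mem i)
    refine ⟨∑ i, m i * n i, ?_⟩
    have e := B.coe_eq_sum ⟨W, hWL⟩
    simp only at e
    rw [e]
    simp only [map_sum, map_smul, LinearMap.sum_apply, LinearMap.smul_apply, smul_eq_mul, hm,
      Finset.mul_sum]
    push_cast
    refine Finset.sum_congr rfl fun i _ => ?_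
    rw [← hn]
    ring

lemma isBohrSommerfeld_orbitLeaf [NeZero k] (q : Fin g → ZMod k) :
    IsBohrSommerfeld k P (B.orbitLeaf q) := by
  rw [B.isBohrSommerfeld_iff]
  intro X hX i
  obtain ⟨n, -, hn⟩ := (B.onLeaf_orbitLeaf_iff q X).1 hX i
  exact ⟨n, hn⟩

variable (k) in
lemma orbitLeaf_bijective [NeZero k] : Function.Bijective
    (fun q => ⟨B.orbitLeaf q, B.isBohrSommerfeld_orbitLeaf q⟩ :
      (Fin g → ZMod k) → {Λ : Leaf T P.L // IsBohrSommerfeld k P Λ}) := by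
  constructor
  · intro q q' h
    have h' : B.orbitLeaf q = B.orbitLeaf q' := congrArg Subtype.val h
    refine B.overOrbit_unique (B.overOrbit_basePoint q) ?_
    rw [← B.onLeaf_orbitLeaf_iff, ← h', B.onLeaf_orbitLeaf_iff]
    exact B.overOrbit_basePoint q
  · rintro ⟨Λ, hΛ⟩
    obtain ⟨X, hX⟩ := QuotientAddGroup.mk_surjective Λ
    choose n hn using (B.isBohrSommerfeld_iff Λ).1 hΛ X hX
    refine ⟨fun i => (n i : ZMod k), Subtype.ext ?_⟩
    have h : OverOrbit B (fun i => (n i : ZMod k)) X := fun i => ⟨n i, rfl, hn i⟩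
    exact ((B.onLeaf_orbitLeaf_iff _ X).2 h).symm.trans hX

variable (k) in
/-- The Bohr–Sommerfeld leaves are the leaves `Λ_q`. -/
def orbitEquiv [NeZero k] :
    (Fin g → ZMod k) ≃ {Λ : Leaf T P.L // IsBohrSommerfeld k P Λ} :=
  Equiv.ofBijective _ (B.orbitLeaf_bijective k)

/-- Integrated form of dK = -θ₀ along L, where θ_P vanishes; this is what makes exp(-2πikK) parallel
on leaves. -/
lemma potentialK_add_of_mem (X : V) {Y : V} (hY : Y ∈ P.L) :
    potentialK B (X + Y) = potentialK B X - 1 / 2 * T.ω X Y := by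
  have h := (B.mem_L_iff Y).1 hY
  have e := B.coe_eq_sum ⟨Y, hY⟩
  simp only at e
  have hω : T.ω X Y = - ∑ i, T.ω Y (B.W' i) * T.ω (B.W i) X := by
    rw [← T.alt.neg_eq Y X]
    conv_lhs => rw [e]
    simp
  rw [hω]
  simp only [potentialK, map_add, LinearMap.add_apply, h, add_zero, add_mul,
    Finset.sum_add_distrib]
  ring

lemma omega_eq_sum (X Y : V) :
    T.ω X Y = ∑ i, (T.ω X (B.W' i) * T.ω (B.W i) Y - T.ω (B.W i) X * T.ω Y (B.W' i)) := by
  conv_lhs => rw [B.expand X]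
  simp only [map_sum, map_add, map_smul, LinearMap.sum_apply, LinearMap.add_apply,
    LinearMap.smul_apply, smul_eq_mul]
  refine Finset.sum_congr rfl fun i _ => ?_
  rw [← T.alt.neg_eq Y (B.W' i)]
  ring

/-- Evenness of k enters here. With m and l the coordinates of W and n the integers k ω(Wᵢ, X), the
two exponents differ by Σ mᵢnᵢ + (k/2) Σ mᵢlᵢ, which is an integer over a Bohr–Sommerfeld leaf when
k/2 is. -/
lemma expi_potentialK_add (hk2 : Even k) {q : Fin g → ZMod k} {X : V} (hX : OverOrbit B q X)
    {W : V} (hW : W ∈ T.Z) : expi (-(k * potentialK B (X + W))) =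
      expi (k / 2 * T.ω W X) * expi (-(k * potentialK B X)) := by
  choose n hn hx using hX
  choose m hm using fun i => T.omega_int hW (B.W'_mem i)
  choose l hl using fun i => T.omega_int (B.W_mem i) hW
  obtain ⟨k', hk'⟩ := hk2
  rw [← expi_add]
  refine expi_eq_of_sub_int (- ∑ i, (m i * n i + k' * (m i * l i))) ?_
  rw [B.omega_eq_sum W X]
  have h : ∀ i, (k : ℝ) * (T.ω (X + W) (B.W' i) * T.ω (B.W i) (X + W)) =
      k * (T.ω X (B.W' i) * T.ω (B.W i) X) + k * (T.ω X (B.W' i) * l i) + m i * n i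
        + k * (m i * l i) := fun i => by
    rw [← hx]
    simp only [map_add, LinearMap.add_apply, hm, hl]
    ring
  have h2 : ∀ i, (k : ℝ) * (T.ω W (B.W' i) * T.ω (B.W i) X - T.ω (B.W i) W * T.ω X (B.W' i)) =
      m i * n i - k * (T.ω X (B.W' i) * l i) := fun i => by
    rw [← hx, hm, hl]
    ring
  have e1 : (k : ℝ) * potentialK B (X + W) = 1 / 2 * ∑ i, (k : ℝ) *
      (T.ω (X + W) (B.W' i) * T.ω (B.W i) (X + W)) := by
    rw [potentialK, ← Finset.mul_sum]; ring
  have e2 : (k : ℝ) * potentialK B X = 1 / 2 * ∑ i, (k : ℝ) *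
      (T.ω X (B.W' i) * T.ω (B.W i) X) := by
    rw [potentialK, ← Finset.mul_sum]; ring
  have e3 : (k : ℝ) / 2 * ∑ i, (T.ω W (B.W' i) * T.ω (B.W i) X - T.ω (B.W i) W * T.ω X (B.W' i)) =
      1 / 2 * ∑ i, (k : ℝ) *
        (T.ω W (B.W' i) * T.ω (B.W i) X - T.ω (B.W i) W * T.ω X (B.W' i)) := by
    rw [← Finset.mul_sum]; ring
  have hk : (k : ℝ) = k' + k' := by exact_mod_cast hk'
  rw [e1, e2, e3]
  simp only [h, h2]
  push_cast
  simp only [Finset.sum_add_distrib, Finset.sum_sub_distrib, ← Finset.mul_sum]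
  rw [hk]
  ring

open Classical in
/-- The section `s_q ⊗ δ`. -/
def orbitSection (q : Fin g → ZMod k) (X : V) : (Fin g → P.L) → ℂ :=
  if OverOrbit B q X then expi (-(k * potentialK B X)) • B.halfDensity else 0

lemma orbitSection_of_overOrbit {q : Fin g → ZMod k} {X : V} (h : OverOrbit B q X) :
    B.orbitSection q X = expi (-(k * potentialK B X)) • B.halfDensity := if_pos h

lemma orbitSection_of_not_overOrbit {q : Fin g → ZMod k} {X : V} (h : ¬ OverOrbit B q X) :
    B.orbitSection q X = 0 := if_neg h

lemma orbitSection_mem [NeZero k] (hk2 : Even k) (q : Fin g → ZMod k) :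
    B.orbitSection q ∈ parallelSections k P (B.orbitLeaf q) := by
  refine ⟨fun X => ?_, fun X hX => ?_, fun W hW X => ?_, fun X hX Y hY => ?_⟩
  · by_cases h : OverOrbit B q X
    · rw [B.orbitSection_of_overOrbit h]
      exact Submodule.smul_mem _ _ B.halfDensity_mem
    · rw [B.orbitSection_of_not_overOrbit h]
      exact zero_mem _
  · rw [B.onLeaf_orbitLeaf_iff] at hX
    exact B.orbitSection_of_not_overOrbit hX
  · have hW' : W ∈ leafGroup T P.L := AddSubgroup.mem_sup_right hW
    by_cases h : OverOrbit B q X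
    · have h' : OverOrbit B q (X + W) := B.overOrbit_of_sub_mem h (by simpa using hW')
      rw [B.orbitSection_of_overOrbit h, B.orbitSection_of_overOrbit h', multiplier_eq,
        B.expi_potentialK_add hk2 h hW, mul_smul]
    · have h' : ¬ OverOrbit B q (X + W) := fun h' =>
        h (B.overOrbit_of_sub_mem h' (by simpa using neg_mem hW'))
      rw [B.orbitSection_of_not_overOrbit h, B.orbitSection_of_not_overOrbit h', smul_zero]
  · rw [B.onLeaf_orbitLeaf_iff] at hX
    rw [isParallelAlong_iff]
    intro t
    have htY : t • Y ∈ P.L := P.L.smul_mem t hY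
    have h' : OverOrbit B q (X + t • Y) := B.overOrbit_of_sub_mem hX
      (AddSubgroup.mem_sup_left (by simpa using htY))
    simp only [zero_smul, add_zero]
    rw [B.orbitSection_of_overOrbit hX, B.orbitSection_of_overOrbit h', smul_smul, ← expi_add,
      B.potentialK_add_of_mem X htY, map_smul, smul_eq_mul]
    ring_nf

lemma conj_orbitSection_mul {q : Fin g → ZMod k} {X : V} (h : OverOrbit B q X)
    {w : Fin g → P.L} (hw : IsLatticeBasis T P.L w) :
    (starRingEnd ℂ) (B.orbitSection q X w) * B.orbitSection q X w = 1 := by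
  rw [B.orbitSection_of_overOrbit h]
  simp [B.halfDensity_of_isLatticeBasis hw, conj_expi_mul_self]

variable [NeZero k]

open Classical in
/-- The element `σ_q` of the quantum space. -/
def sigma (hk2 : Even k) (q : Fin g → ZMod k) : QuantumSpace k P :=
  DirectSum.of (fun Λ : {Λ : Leaf T P.L // IsBohrSommerfeld k P Λ} => parallelSections k P Λ.1)
    (B.orbitEquiv k q) ⟨B.orbitSection q, B.orbitSection_mem hk2 q⟩

lemma sigma_apply_same (hk2 : Even k) (q : Fin g → ZMod k) :
    (B.sigma hk2 q (B.orbitEquiv k q)).1 = B.orbitSection q := by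
  classical
  rw [sigma, DirectSum.of_eq_same]

lemma sigma_apply_of_ne (hk2 : Even k) {q q' : Fin g → ZMod k} (h : q ≠ q') :
    B.sigma hk2 q (B.orbitEquiv k q') = 0 := by
  classical
  rw [sigma, DirectSum.of_eq_of_ne]
  exact fun h' => h ((B.orbitEquiv k).injective h').symm

/-- The coefficient of `σ_q`. -/
def coeff (q : Fin g → ZMod k) : QuantumSpace k P →ₗ[ℂ] ℂ where
  toFun ψ := expi (k * potentialK B (B.basePoint q)) *
    (ψ (B.orbitEquiv k q)).1 (B.basePoint q) B.W
  map_add' ψ φ := by simp [mul_add]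
  map_smul' c ψ := by
    simp only [DirectSum.smul_apply, Submodule.coe_smul, Pi.smul_apply, smul_eq_mul,
      RingHom.id_apply]
    ring

/-- Both sides are parallel sections over the same leaf and agree at the base point, since
half-densities form a line. -/
lemma apply_orbitEquiv (hk2 : Even k) (ψ : QuantumSpace k P) (q : Fin g → ZMod k) :
    (ψ (B.orbitEquiv k q)).1 = B.coeff q ψ • B.orbitSection q := by
  have hmem := sub_mem (ψ (B.orbitEquiv k q)).2
    (Submodule.smul_mem _ (B.coeff q ψ) (B.orbitSection_mem hk2 q))
  have hX := (B.onLeaf_orbitLeaf_iff q _).2 (B.overOrbit_basePoint q)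
  rw [← sub_eq_zero]
  refine eq_zero_of_mem_parallelSections hmem hX ?_
  rw [Pi.sub_apply, sub_eq_zero, Pi.smul_apply,
    B.orbitSection_of_overOrbit (B.overOrbit_basePoint q), smul_smul]
  have h := B.halfDensities_eq _ ((ψ (B.orbitEquiv k q)).2.1 (B.basePoint q))
  rw [coeff]
  simp only [LinearMap.coe_mk, AddHom.coe_mk]
  rw [mul_right_comm, ← expi_add, add_neg_cancel, expi_zero, one_mul]
  exact h

lemma coeff_sigma (hk2 : Even k) (q q' : Fin g → ZMod k) :
    B.coeff q (B.sigma hk2 q') = if q = q' then 1 else 0 := by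
  simp only [coeff, LinearMap.coe_mk, AddHom.coe_mk]
  split_ifs with h
  · subst h
    rw [B.sigma_apply_same, B.orbitSection_of_overOrbit (B.overOrbit_basePoint q), Pi.smul_apply,
      B.halfDensity_W, smul_eq_mul, mul_one, ← expi_add, add_neg_cancel, expi_zero]
  · rw [B.sigma_apply_of_ne hk2 (Ne.symm h)]
    simp

lemma eq_sum_coeff (hk2 : Even k) (ψ : QuantumSpace k P) : ψ = ∑ q, B.coeff q ψ • B.sigma hk2 q := by
  refine DFinsupp.ext fun Λ => ?_
  obtain ⟨q, rfl⟩ := (B.orbitEquiv k).surjective Λ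
  have hs : ∀ Λ, (∑ q, B.coeff q ψ • B.sigma hk2 q) Λ = ∑ q, B.coeff q ψ • B.sigma hk2 q Λ := by
    intro Λ
    rw [DFinsupp.finsetSum_apply]
    rfl
  rw [hs, Finset.sum_eq_single q]
  · apply Subtype.ext
    rw [B.apply_orbitEquiv hk2, Submodule.coe_smul, B.sigma_apply_same]
  · intro q' _ h
    rw [B.sigma_apply_of_ne hk2 h, smul_zero]
  · simp

/-- The basis `σ_q` of the quantum space. -/
def sigmaBasis (hk2 : Even k) : Module.Basis (Fin g → ZMod k) ℂ (QuantumSpace k P) :=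
  Module.Basis.ofEquivFun
    { toFun := fun ψ q => B.coeff q ψ
      map_add' := fun ψ φ => by ext q; simp
      map_smul' := fun c ψ => by ext q; simp
      invFun := fun c => ∑ q, c q • B.sigma hk2 q
      left_inv := fun ψ => (B.eq_sum_coeff hk2 ψ).symm
      right_inv := fun c => by
        ext q
        simp [map_sum, B.coeff_sigma] }

lemma sigmaBasis_repr (hk2 : Even k) (ψ : QuantumSpace k P) (q : Fin g → ZMod k) :
    (B.sigmaBasis hk2).repr ψ q = B.coeff q ψ := rfl

lemma sigmaBasis_apply (hk2 : Even k) (q : Fin g → ZMod k) : B.sigmaBasis hk2 q = B.sigma hk2 q := by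
  classical
  simp [sigmaBasis, Module.Basis.coe_ofEquivFun, Pi.single_apply]

lemma isStandardFamily_sigmaBasis (hk2 : Even k) : IsStandardFamily B (B.sigmaBasis hk2) := by
  intro q Λ X
  obtain ⟨q', rfl⟩ := (B.orbitEquiv k).surjective Λ
  have hon : OnLeaf (B.orbitEquiv k q').1 X ↔ OverOrbit B q' X := B.onLeaf_orbitLeaf_iff q' X
  rw [B.sigmaBasis_apply]
  by_cases h : q = q'
  · subst h
    rw [B.sigma_apply_same]
    by_cases hX : OverOrbit B q X
    · rw [if_pos ⟨hon.2 hX, hX⟩, B.orbitSection_of_overOrbit hX, Pi.smul_apply, B.halfDensity_W,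
        smul_eq_mul, mul_one, expi]
      push_cast
      ring_nf
    · rw [if_neg fun h => hX h.2, B.orbitSection_of_not_overOrbit hX]
      rfl
  · rw [B.sigma_apply_of_ne hk2 h, if_neg]
    · rfl
    · rintro ⟨h1, h2⟩
      exact h (B.overOrbit_unique h2 (hon.1 h1))

/-- On each leaf the standard section has modulus one and its half-density is 1 on every lattice
basis, so the integrand is the constant product of the coefficients. -/
lemma quantumInner_eq (hk2 : Even k) (ψ φ : QuantumSpace k P) :
    quantumInner ψ φ = ∑ q, (starRingEnd ℂ) (B.coeff q ψ) * B.coeff q φ := by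
  rw [quantumInner, ← finsum_eq_sum_of_fintype]
  refine (finsum_eq_of_bijective _ (B.orbitEquiv k).bijective fun q => ?_).symm
  refine (leafIntegral_eq_of_const _ _ _ _ _ ⟨B.W, B.isLatticeBasis_W⟩ fun w hw Y hY => ?_).symm
  rw [B.apply_orbitEquiv hk2 ψ, B.apply_orbitEquiv hk2 φ]
  have hX : OverOrbit B q (Quotient.out (B.orbitEquiv k q).1 + Y) := by
    rw [← B.onLeaf_orbitLeaf_iff]
    have h0 : OnLeaf (B.orbitLeaf q) (Quotient.out (B.orbitEquiv k q).1) :=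
      Quotient.out_eq (B.orbitEquiv k q).1
    rw [B.onLeaf_orbitLeaf_iff] at h0 ⊢
    exact B.overOrbit_of_sub_mem h0 (AddSubgroup.mem_sup_left (by simpa using hY))
  have := B.conj_orbitSection_mul hX hw
  simp only [Pi.smul_apply, smul_eq_mul, map_mul]
  linear_combination (starRingEnd ℂ) (B.coeff q ψ) * B.coeff q φ * this

lemma quantumInner_sigma_left (hk2 : Even k) (q : Fin g → ZMod k) (φ : QuantumSpace k P) :
    quantumInner (B.sigma hk2 q) φ = B.coeff q φ := by
  rw [B.quantumInner_eq hk2]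
  simp [B.coeff_sigma]

lemma exists_innerCore (B : PolarizationBasis P) (hk2 : Even k) :
    ∃ c : InnerProductSpace.Core ℂ (QuantumSpace k P), ∀ ψ φ, c.inner ψ φ = quantumInner ψ φ := by
  refine ⟨{ inner := fun ψ φ => quantumInner ψ φ
            conj_inner_symm := fun ψ φ => ?_
            re_inner_nonneg := fun ψ => ?_
            add_left := fun ψ φ χ => ?_
            smul_left := fun ψ φ c => ?_
            definite := fun ψ h => ?_ }, fun _ _ => rfl⟩
  · simp only [B.quantumInner_eq hk2, map_sum, map_mul, Complex.conj_conj]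
    exact Finset.sum_congr rfl fun q _ => mul_comm _ _
  · simp only [B.quantumInner_eq hk2, map_sum, ← Complex.normSq_eq_conj_mul_self]
    exact Finset.sum_nonneg fun q _ => by simpa using Complex.normSq_nonneg _
  · simp only [B.quantumInner_eq hk2, map_add, add_mul, Finset.sum_add_distrib]
  · simp only [B.quantumInner_eq hk2, map_smul, smul_eq_mul, map_mul, Finset.mul_sum, mul_assoc]
  · simp only [B.quantumInner_eq hk2, ← Complex.normSq_eq_conj_mul_self] at h
    rw [B.eq_sum_coeff hk2 ψ]
    refine Finset.sum_eq_zero fun q _ => ?_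
    have h' : ∑ q, Complex.normSq (B.coeff q ψ) = 0 := by exact_mod_cast h
    rw [Finset.sum_eq_zero_iff_of_nonneg fun _ _ => Complex.normSq_nonneg _] at h'
    rw [Complex.normSq_eq_zero.1 (h' q (Finset.mem_univ _)), zero_smul]

end PolarizationBasis

end Quantization

end

-- Sublattices, duality and existence of compatible bases

noncomputable section

lemma mem_of_span_range_eq {R V ι : Type*} [Ring R] [AddCommGroup V] [Module R V] {m : ι → V}
    {M : Submodule R V} (h : Submodule.span R (Set.range m) = M) (i : ι) : m i ∈ M :=
  h ▸ Submodule.subset_span (Set.mem_range_self i)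

/-- A basis of a saturated submodule of a finitely generated `ℤ`-module extends to a basis of the
module. -/
lemma exists_extend_intBasis {V : Type*} [AddCommGroup V] {N M : Submodule ℤ V} (hNM : N ≤ M)
    [Module.Finite ℤ M] (hsat : ∀ (n : ℤ), ∀ x ∈ M, n ≠ 0 → n • x ∈ N → x ∈ N) {ι : Type*}
    (m : ι → V) (hm : LinearIndependent ℤ m) (hspan : Submodule.span ℤ (Set.range m) = N) :
    ∃ (b : ℕ) (v : Fin b → V), LinearIndependent ℤ (Sum.elim m v) ∧
      Submodule.span ℤ (Set.range (Sum.elim m v)) = M := by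
  let N' : Submodule ℤ M := N.comap M.subtype
  have hmN : ∀ i, m i ∈ N := fun i => mem_of_span_range_eq hspan i
  let m' : ι → N' := fun i => ⟨⟨m i, hNM (hmN i)⟩, hmN i⟩
  have hcomp : (M.subtype ∘ₗ N'.subtype) ∘ m' = m := rfl
  have hm' : LinearIndependent ℤ m' :=
    LinearIndependent.of_comp (M.subtype ∘ₗ N'.subtype) (hcomp ▸ hm)
  have hspan' : ⊤ ≤ Submodule.span ℤ (Set.range m') := by
    rintro ⟨⟨x, hxM⟩, hxN⟩ -
    have hinj : Function.Injective (M.subtype ∘ₗ N'.subtype) :=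
      M.injective_subtype.comp N'.injective_subtype
    have hx : x ∈ (Submodule.span ℤ (Set.range m')).map (M.subtype ∘ₗ N'.subtype) := by
      rw [Submodule.map_span, ← Set.range_comp, hcomp, hspan]
      exact hxN
    obtain ⟨y, hy, hyx⟩ := hx
    rwa [hinj (a₁ := y) (a₂ := ⟨⟨x, hxM⟩, hxN⟩) hyx] at hy
  -- Saturation says exactly that the quotient is torsion-free. Being finitely generated over ℤ it
  -- is free, so the extension splits and lifts of a basis of the quotient complete m.
  have : Module.IsTorsionFree ℤ (M ⧸ N') := by
    refine ⟨fun n hn => ?_⟩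
    have hn0 : n ≠ 0 := hn.ne_zero
    refine isSMulRegular_iff_right_eq_zero_of_smul.2 fun x hx => ?_
    induction x using Submodule.Quotient.induction_on with
    | H x =>
      rw [← Submodule.Quotient.mk_smul, Submodule.Quotient.mk_eq_zero] at hx
      rw [Submodule.Quotient.mk_eq_zero]
      exact hsat n x x.2 hn0 hx
  have : Module.Free ℤ (M ⧸ N') := Module.free_of_finite_type_torsion_free'
  let bQ := Module.finBasis ℤ (M ⧸ N')
  let B := Module.Basis.sumQuot (Module.Basis.mk hm' hspan') bQ
  have hB : M.subtype ∘ B = Sum.elim m (fun j => (B (Sum.inr j) : V)) := by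
    ext (i | j)
    · simp [B, m']
    · rfl
  refine ⟨_, fun j => (B (Sum.inr j) : V), ?_, ?_⟩
  · rw [← hB]
    exact B.linearIndependent.map' M.subtype M.ker_subtype
  · rw [← hB, Set.range_comp, ← Submodule.map_span, B.span_eq, Submodule.map_top,
      Submodule.range_subtype]

section Quantization

variable {g : ℕ} {V : Type*} [AddCommGroup V] [Module ℝ V] {T : SymplecticTorus g V}

namespace SymplecticTorus

/-- The lattice `Z ∩ U`. -/
def lat (T : SymplecticTorus g V) (U : Submodule ℝ V) : Submodule ℤ V :=
  AddSubgroup.toIntSubmodule (T.Z ⊓ U.toAddSubgroup)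

lemma mem_lat {U : Submodule ℝ V} {X : V} : X ∈ T.lat U ↔ X ∈ T.Z ∧ X ∈ U := Iff.rfl

lemma span_lattice (T : SymplecticTorus g V) : Submodule.span ℝ (T.Z : Set V) = ⊤ := by
  obtain ⟨b, hb⟩ := T.lattice
  rw [eq_top_iff, ← b.span_eq]
  refine Submodule.span_mono ?_
  rw [← hb]
  exact AddSubgroup.subset_closure

lemma finite (T : SymplecticTorus g V) : Module.Finite ℝ V := by
  obtain ⟨b, -⟩ := T.lattice
  exact Module.Finite.of_basis b

lemma finrank_eq (T : SymplecticTorus g V) : Module.finrank ℝ V = 2 * g := by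
  obtain ⟨b, -⟩ := T.lattice
  rw [Module.finrank_eq_card_basis b, Fintype.card_fin]

lemma finite_lat (T : SymplecticTorus g V) (U : Submodule ℝ V) : Module.Finite ℤ (T.lat U) := by
  obtain ⟨b, hb⟩ := T.lattice
  have h : AddSubgroup.toIntSubmodule T.Z = Submodule.span ℤ (Set.range b) := by
    rw [← hb, ← Submodule.span_int_eq_addSubgroupClosure, Submodule.toAddSubgroup_toIntSubmodule]
  have : Module.Finite ℤ (AddSubgroup.toIntSubmodule T.Z) := by
    rw [h]
    exact Module.Finite.span_of_finite ℤ (Set.finite_range b)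
  have hle : T.lat U ≤ AddSubgroup.toIntSubmodule T.Z := fun X hX => hX.1
  have := isNoetherian_of_le hle
  exact Module.IsNoetherian.finite ℤ _

lemma finrank_intLattice (T : SymplecticTorus g V) : Module.finrank ℤ (T.lat ⊤) = 2 * g := by
  obtain ⟨b, hb⟩ := T.lattice
  have h : T.lat ⊤ = Submodule.span ℤ (Set.range b) := by
    rw [lat, ← hb, ← Submodule.span_int_eq_addSubgroupClosure]
    ext X
    simp
  rw [h, Module.finrank_eq_card_basis (b.restrictScalars ℤ), Fintype.card_fin]

lemma lat_saturated (T : SymplecticTorus g V) {U U' : Submodule ℝ V} (n : ℤ) (X : V)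
    (hX : X ∈ T.lat U') (hn : n ≠ 0) (h : n • X ∈ T.lat U) : X ∈ T.lat U := by
  refine ⟨hX.1, ?_⟩
  have h2 : (n : ℝ) • X ∈ U := by
    rw [Int.cast_smul_eq_zsmul]
    exact h.2
  exact (U.smul_mem_iff (by exact_mod_cast hn)).1 h2

lemma exists_extend_lat (T : SymplecticTorus g V) {U U' : Submodule ℝ V} (hU : U ≤ U')
    {ι : Type*} (m : ι → V) (hm : LinearIndependent ℤ m)
    (hspan : Submodule.span ℤ (Set.range m) = T.lat U) :
    ∃ (b : ℕ) (v : Fin b → V), LinearIndependent ℤ (Sum.elim m v) ∧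
      Submodule.span ℤ (Set.range (Sum.elim m v)) = T.lat U' := by
  have := T.finite_lat U'
  exact exists_extend_intBasis (N := T.lat U) (M := T.lat U') (fun X hX => ⟨hX.1, hU hX.2⟩)
    (fun n X hX hn h => T.lat_saturated n X hX hn h) m hm hspan

lemma exists_intBasis_lat (T : SymplecticTorus g V) (U : Submodule ℝ V) :
    ∃ (b : ℕ) (v : Fin b → V), LinearIndependent ℤ v ∧
      Submodule.span ℤ (Set.range v) = T.lat U := by
  have hbot : Submodule.span ℤ (Set.range (Fin.elim0 : Fin 0 → V)) = T.lat ⊥ := by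
    ext X
    rw [mem_lat]
    simp only [Set.range_eq_empty, Submodule.span_empty, Submodule.mem_bot]
    exact ⟨fun h => ⟨h ▸ zero_mem _, h⟩, fun h => h.2⟩
  obtain ⟨b, v, hv, hs⟩ := T.exists_extend_lat (bot_le (a := U)) (Fin.elim0 : Fin 0 → V)
    linearIndependent_empty_type hbot
  refine ⟨b, v, hv.comp Sum.inr Sum.inr_injective, ?_⟩
  rw [← hs]
  congr 1
  rw [Set.Sum.elim_range, Set.range_eq_empty (Fin.elim0 : Fin 0 → V), Set.empty_union]

/-- A basis of the whole lattice is a real basis. -/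
lemma exists_basis_of_intBasis (T : SymplecticTorus g V) {ι : Type*} [Finite ι] (v : ι → V)
    (hv : LinearIndependent ℤ v) (hs : Submodule.span ℤ (Set.range v) = T.lat ⊤) :
    ∃ b : Module.Basis ι ℝ V, ⇑b = v := by
  have := Fintype.ofFinite ι
  have hcard : Fintype.card ι = Module.finrank ℝ V := by
    rw [T.finrank_eq, ← T.finrank_intLattice, ← hs, finrank_span_eq_card hv]
  have htop : ⊤ ≤ Submodule.span ℝ (Set.range v) := by
    rw [← T.span_lattice, Submodule.span_le]
    intro X hX
    have : X ∈ Submodule.span ℤ (Set.range v) := by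
      rw [hs]
      exact ⟨hX, Submodule.mem_top (R := ℝ)⟩
    exact Submodule.span_subset_span ℤ ℝ _ this
  exact ⟨basisOfTopLeSpanOfCardEqFinrank v htop hcard, by simp⟩

lemma exists_extend_basis (T : SymplecticTorus g V) {U : Submodule ℝ V} {ι : Type*} [Finite ι]
    (m : ι → V) (hm : LinearIndependent ℤ m)
    (hspan : Submodule.span ℤ (Set.range m) = T.lat U) :
    ∃ (n : ℕ) (b : Module.Basis (ι ⊕ Fin n) ℝ V), (∀ i, b (Sum.inl i) = m i) ∧
      Submodule.span ℤ (Set.range b) = T.lat ⊤ := by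
  obtain ⟨n, v, hv, hs⟩ := T.exists_extend_lat (le_top (a := U)) m hm hspan
  obtain ⟨b, hb⟩ := T.exists_basis_of_intBasis _ hv hs
  exact ⟨n, b, fun i => by simp [hb], by rw [hb, hs]⟩

lemma linearIndependent_of_intBasis (T : SymplecticTorus g V) {U : Submodule ℝ V} {ι : Type*}
    [Finite ι] (m : ι → V) (hm : LinearIndependent ℤ m)
    (hspan : Submodule.span ℤ (Set.range m) = T.lat U) : LinearIndependent ℝ m := by
  obtain ⟨n, b, hb, -⟩ := T.exists_extend_basis m hm hspan
  have := b.linearIndependent.comp Sum.inl Sum.inl_injective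
  rwa [show ⇑b ∘ Sum.inl = m from funext hb] at this

lemma span_real_of_span_int (T : SymplecticTorus g V) {U : Submodule ℝ V}
    (hU : Submodule.span ℝ ((U : Set V) ∩ (T.Z : Set V)) = U) {ι : Type*} (m : ι → V)
    (hspan : Submodule.span ℤ (Set.range m) = T.lat U) :
    Submodule.span ℝ (Set.range m) = U := by
  apply le_antisymm
  · rw [Submodule.span_le]
    rintro _ ⟨i, rfl⟩
    have : m i ∈ T.lat U := mem_of_span_range_eq hspan i
    exact this.2
  · conv_lhs => rw [← hU]
    rw [Submodule.span_le]
    intro X hX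
    have : X ∈ Submodule.span ℤ (Set.range m) := by
      rw [hspan]
      exact ⟨hX.2, hX.1⟩
    exact Submodule.span_subset_span ℤ ℝ _ this

lemma finrank_eq_of_intBasis (T : SymplecticTorus g V) {U : Submodule ℝ V}
    (hU : Submodule.span ℝ ((U : Set V) ∩ (T.Z : Set V)) = U) {ι : Type*} [Fintype ι] (m : ι → V)
    (hm : LinearIndependent ℤ m) (hspan : Submodule.span ℤ (Set.range m) = T.lat U) :
    Module.finrank ℝ U = Fintype.card ι := by
  rw [← finrank_span_eq_card (T.linearIndependent_of_intBasis m hm hspan),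
    T.span_real_of_span_int hU m hspan]

/-- The symplectic dual of a basis of the lattice. -/
lemma exists_dual (T : SymplecticTorus g V) {ι : Type*} [Finite ι] [DecidableEq ι]
    (b : Module.Basis ι ℝ V) (hs : Submodule.span ℤ (Set.range b) = T.lat ⊤) :
    ∃ d : Module.Basis ι ℝ V, (∀ i, d i ∈ T.Z) ∧
      ∀ i j, T.ω (b i) (d j) = if i = j then 1 else 0 := by
  let d := T.ω.dualBasis T.nondegenerate b
  have hd : ∀ i j, T.ω (d j) (b i) = if i = j then 1 else 0 := fun i j =>
    LinearMap.BilinForm.apply_dualBasis_left T.nondegenerate b j i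
  have := Fintype.ofFinite ι
  -- The dual basis has the b in the second slot of ω; the sign moves them to the first. Each dual
  -- vector pairs integrally with the lattice, so self-duality puts it into Z.
  refine ⟨d.map (LinearEquiv.neg ℝ), fun j => ?_, fun i j => ?_⟩
  · have : d j ∈ T.Z := by
      rw [T.selfDual]
      intro W hW
      have hW' : W ∈ Submodule.span ℤ (Set.range b) := by
        rw [hs]
        exact ⟨hW, Submodule.mem_top (R := ℝ)⟩
      rw [Submodule.mem_span_range_iff_exists_fun] at hW'
      obtain ⟨n, rfl⟩ := hW'
      refine ⟨n j, ?_⟩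
      simp [map_sum, hd]
    simpa using this
  · rw [← hd i j]
    simp [T.alt.neg_eq]

end SymplecticTorus

/-- An isotropic subspace lies in its orthogonal, and here both have dimension g. -/
lemma RealPolarization.mem_L_of_orthogonal (P : RealPolarization T) {X : V}
    (h : ∀ Y ∈ P.L, T.ω Y X = 0) : X ∈ P.L := by
  have := T.finite
  have hle : P.L ≤ T.ω.orthogonal P.L := fun X hX => by
    rw [LinearMap.BilinForm.mem_orthogonal_iff]
    exact fun Y hY => P.isotropic _ hY _ hX
  have heq : P.L = T.ω.orthogonal P.L := by
    refine Submodule.eq_of_le_of_finrank_eq hle ?_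
    rw [LinearMap.BilinForm.finrank_orthogonal T.nondegenerate, T.finrank_eq, P.finrank_eq]
    omega
  rw [heq, LinearMap.BilinForm.mem_orthogonal_iff]
  exact h

/-- The intersection of two rational Lagrangian subspaces is rational. -/
lemma interL_rational (P₂ P₁ : RealPolarization T) :
    Submodule.span ℝ ((interL P₂ P₁ : Set V) ∩ (T.Z : Set V)) = interL P₂ P₁ := by
  classical
  apply le_antisymm
  · rw [Submodule.span_le]
    exact fun X hX => hX.1
  -- L₁ ∩ L₂ is the symplectic orthogonal of L₁ + L₂, and a sum of rational subspaces is visibly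
  -- rational. Extend a lattice basis of the sum to the whole lattice: the duals of the added
  -- vectors are lattice vectors spanning the orthogonal.
  have hU : Submodule.span ℝ (((P₁.L ⊔ P₂.L : Submodule ℝ V) : Set V) ∩ (T.Z : Set V)) =
      P₁.L ⊔ P₂.L := by
    apply le_antisymm
    · rw [Submodule.span_le]
      exact fun X hX => hX.1
    · refine sup_le ?_ ?_
      · conv_lhs => rw [← P₁.rational]
        exact Submodule.span_mono
          (Set.inter_subset_inter_left _ (SetLike.coe_subset_coe.2 le_sup_left))
      · conv_lhs => rw [← P₂.rational]
        exact Submodule.span_mono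
          (Set.inter_subset_inter_left _ (SetLike.coe_subset_coe.2 le_sup_right))
  obtain ⟨a, m, hm, hs⟩ := T.exists_intBasis_lat (P₁.L ⊔ P₂.L)
  obtain ⟨n, b, hb, hbs⟩ := T.exists_extend_basis m hm hs
  obtain ⟨d, hdZ, hd⟩ := T.exists_dual b hbs
  have hd' : ∀ j, d (Sum.inr j) ∈ interL P₂ P₁ := by
    intro j
    have horth : ∀ Y ∈ P₁.L ⊔ P₂.L, T.ω Y (d (Sum.inr j)) = 0 := by
      intro Y hY
      rw [← T.span_real_of_span_int hU m hs, Submodule.mem_span_range_iff_exists_fun] at hY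
      obtain ⟨c, rfl⟩ := hY
      simp [← hb, hd]
    exact ⟨P₁.mem_L_of_orthogonal fun Y hY => horth Y (le_sup_left (α := Submodule ℝ V) hY),
      P₂.mem_L_of_orthogonal fun Y hY => horth Y (le_sup_right (α := Submodule ℝ V) hY)⟩
  intro X hX
  rw [← d.sum_repr X]
  refine sum_mem fun i _ => ?_
  have hrepr : d.repr X i = T.ω (b i) X := by
    conv_rhs => rw [← d.sum_repr X]
    simp only [map_sum, map_smul, hd, smul_eq_mul, mul_ite, mul_one, mul_zero, Finset.sum_ite_eq,
      Finset.mem_univ, if_true]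
  rcases i with i | j
  · have hmem : m i ∈ T.lat (P₁.L ⊔ P₂.L) := mem_of_span_range_eq hs i
    obtain ⟨Y₁, h1, Y₂, h2, h12⟩ := Submodule.mem_sup.1 hmem.2
    rw [hrepr, hb, ← h12, map_add, LinearMap.add_apply, P₁.isotropic _ h1 _ hX.1,
      P₂.isotropic _ h2 _ hX.2, add_zero, zero_smul]
    exact zero_mem _
  · exact Submodule.smul_mem _ _ (Submodule.subset_span ⟨hd' j, hdZ _⟩)

lemma finrank_interL_le (P₂ P₁ : RealPolarization T) :
    Module.finrank ℝ (interL P₂ P₁) ≤ g := by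
  have := T.finite
  exact (Submodule.finrank_mono inf_le_left).trans P₁.finrank_eq.le

/-- The splitting of the indices into the first `h` and the remaining ones. -/
def splitEquiv (P₂ P₁ : RealPolarization T) :
    Fin (codimInter P₂ P₁) ⊕ Fin (Module.finrank ℝ (interL P₂ P₁)) ≃ Fin g :=
  finSumFinEquiv.trans (finCongr (Nat.sub_add_cancel (finrank_interL_le P₂ P₁)))

lemma splitEquiv_inl (P₂ P₁ : RealPolarization T) (i : Fin (codimInter P₂ P₁)) :
    splitEquiv P₂ P₁ (Sum.inl i) = head P₂ P₁ i := by
  ext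
  simp only [splitEquiv, Equiv.trans_apply, finSumFinEquiv_apply_left]
  rfl

lemma splitEquiv_inr_val (P₂ P₁ : RealPolarization T)
    (j : Fin (Module.finrank ℝ (interL P₂ P₁))) :
    (splitEquiv P₂ P₁ (Sum.inr j) : ℕ) = codimInter P₂ P₁ + j := by
  simp only [splitEquiv, Equiv.trans_apply, finSumFinEquiv_apply_right]
  rfl

lemma head_lt (P₂ P₁ : RealPolarization T) (i : Fin (codimInter P₂ P₁)) :
    (head P₂ P₁ i : ℕ) < codimInter P₂ P₁ := i.2

/-- Vectors of the lattice that are dual to a basis of `L ∩ Z`. -/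
lemma RealPolarization.exists_dual_family (P : RealPolarization T) (W : Fin g → V)
    (hs : Submodule.span ℤ (Set.range W) = T.lat P.L) :
    ∃ D : Fin g → V, (∀ i, D i ∈ T.Z) ∧ ∀ i j, T.ω (W i) (D j) = if i = j then 1 else 0 := by
  have hspan := T.span_real_of_span_int P.rational W hs
  have hli : LinearIndependent ℝ W := by
    rw [linearIndependent_iff_card_eq_finrank_span, Set.finrank, hspan, P.finrank_eq,
      Fintype.card_fin]
  have hZ : LinearIndependent ℤ W := hli.restrict_scalars fun a b h => by simpa using h
  obtain ⟨n, b, hb, hbs⟩ := T.exists_extend_basis W hZ hs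
  obtain ⟨d, hdZ, hd⟩ := T.exists_dual b hbs
  exact ⟨fun j => d (Sum.inl j), fun j => hdZ _, fun i j => by simp [← hb, hd]⟩

/-- A dual family can be made isotropic without changing the last members, if these are already
mutually orthogonal. -/
lemma RealPolarization.exists_basis_of_dual (P : RealPolarization T) (W : Fin g → P.L)
    (hs : Submodule.span ℤ (Set.range fun i => (W i : V)) = T.lat P.L) (D : Fin g → V)
    (hDZ : ∀ i, D i ∈ T.Z) (hD : ∀ i j, T.ω (W i) (D j) = if i = j then 1 else 0) (h : ℕ)
    (hiso : ∀ i j : Fin g, h ≤ i → h ≤ j → T.ω (D i) (D j) = 0) :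
    ∃ B : PolarizationBasis P, B.W = W ∧ ∀ i : Fin g, h ≤ i → B.W' i = D i := by
  have hWZ : ∀ i, (W i : V) ∈ T.Z := fun i => by
    have : (W i : V) ∈ T.lat P.L := mem_of_span_range_eq hs i
    exact this.1
  have hspan := T.span_real_of_span_int P.rational _ hs
  have hWW : ∀ i j, T.ω (W i) (W j) = 0 := fun i j => P.isotropic _ (W i).2 _ (W j).2
  -- Only larger indices i > j are used in the correction, so each pairing ω(Dᵢ, Dⱼ) is cancelled
  -- once. No factor 1/2 appears, and W' stays in the lattice.
  let W' : Fin g → V := fun j => D j + ∑ i, (if j < i then T.ω (D i) (D j) else 0) • (W i : V)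
  have hW'Z : ∀ j, W' j ∈ T.Z := fun j => by
    refine add_mem (hDZ j) (sum_mem fun i _ => ?_)
    split_ifs
    · obtain ⟨n, hn⟩ := T.omega_int (hDZ i) (hDZ j)
      rw [hn, Int.cast_smul_eq_zsmul]
      exact zsmul_mem (hWZ i) n
    · simp
  have hpair : ∀ i j, T.ω (W i) (W' j) = if i = j then 1 else 0 := fun i j => by
    simp only [W', map_add, map_sum, map_smul, hD, hWW, smul_zero, Finset.sum_const_zero,
      add_zero]
  have hDW : ∀ i j, T.ω (D i) (W j) = if j = i then -1 else 0 := fun i j => by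
    rw [← T.alt.neg_eq, hD]
    split_ifs <;> simp
  have hiso' : ∀ i j, T.ω (W' i) (W' j) = 0 := fun i j => by
    have e : T.ω (W' i) (W' j) = T.ω (D i) (D j) - (if j < i then T.ω (D i) (D j) else 0)
        + (if i < j then T.ω (D j) (D i) else 0) := by
      simp only [W', map_add, LinearMap.add_apply, map_sum, map_smul, LinearMap.sum_apply,
        LinearMap.smul_apply, hD, hDW, hWW, smul_eq_mul, mul_ite, mul_one, mul_zero, mul_neg,
        Finset.sum_ite_eq', Finset.mem_univ, if_true, Finset.sum_const_zero, add_zero]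
      ring
    rw [e]
    rcases lt_trichotomy i j with hij | hij | hij
    · rw [if_neg hij.not_gt, if_pos hij, ← T.alt.neg_eq (D i) (D j)]
      ring
    · subst hij
      simp [T.alt.self_eq_zero]
    · rw [if_pos hij, if_neg hij.not_gt]
      ring
  have hlat : AddSubgroup.closure ((Set.range fun i => (W i : V)) ∪ Set.range W') = T.Z := by
    apply le_antisymm
    · rw [AddSubgroup.closure_le]
      rintro _ (⟨i, rfl⟩ | ⟨i, rfl⟩)
      · exact hWZ i
      · exact hW'Z i
    · intro X hX
      set S := AddSubgroup.closure ((Set.range fun i => (W i : V)) ∪ Set.range W')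
      -- E is the symplectic expansion of X. The difference X - E is orthogonal to W, hence in L,
      -- and orthogonal to W', hence zero; the coefficients of E are integers by integrality of ω on
      -- Z.
      let E : V := ∑ i, (T.ω X (W' i) • (W i : V) + T.ω (W i) X • W' i)
      have hWE : ∀ i, T.ω (W i) E = T.ω (W i) X := fun i => by
        simp [E, hWW, hpair]
      have hEW' : ∀ i, T.ω E (W' i) = T.ω X (W' i) := fun i => by
        simp [E, hiso', hpair]
      have hXE : X - E ∈ P.L := by
        refine P.mem_L_of_orthogonal fun Y hY => ?_
        rw [← hspan, Submodule.mem_span_range_iff_exists_fun] at hY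
        obtain ⟨c, rfl⟩ := hY
        simp [hWE]
      have hXE0 : X - E = 0 := by
        have hXE' := hXE
        rw [← hspan, Submodule.mem_span_range_iff_exists_fun] at hXE'
        obtain ⟨c, hc⟩ := hXE'
        have : ∀ j, c j = 0 := fun j => by
          have h1 : T.ω (X - E) (W' j) = 0 := by simp [hEW']
          rw [← hc] at h1
          simpa [hpair] using h1
        rw [← hc]
        simp [this]
      rw [sub_eq_zero.1 hXE0]
      refine sum_mem fun i _ => add_mem ?_ ?_
      · obtain ⟨n, hn⟩ := T.omega_int hX (hW'Z i)
        have hmem : (W i : V) ∈ S := AddSubgroup.subset_closure (Or.inl ⟨i, rfl⟩)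
        rw [hn, Int.cast_smul_eq_zsmul]
        exact zsmul_mem hmem n
      · obtain ⟨n, hn⟩ := T.omega_int (hWZ i) hX
        have hmem : W' i ∈ S := AddSubgroup.subset_closure (Or.inr ⟨i, rfl⟩)
        rw [hn, Int.cast_smul_eq_zsmul]
        exact zsmul_mem hmem n
  refine ⟨⟨W, W', hspan, hlat, hpair, hiso'⟩, rfl, fun j hj => ?_⟩
  change D j + _ = D j
  rw [add_eq_left]
  refine Finset.sum_eq_zero fun i _ => ?_
  split_ifs with hij
  · rw [hiso i j (hj.trans (Fin.le_def.1 hij.le)) hj, zero_smul]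
  · rw [zero_smul]

/-- Compatible symplectic lattice bases exist. -/
theorem exists_compatible_bases (P₂ P₁ : RealPolarization T) :
    ∃ (B₁ : PolarizationBasis P₁) (B₂ : PolarizationBasis P₂), AreCompatible B₂ B₁ := by
  classical
  obtain ⟨d, w, hw, hws⟩ := T.exists_intBasis_lat (interL P₂ P₁)
  have hd : Module.finrank ℝ (interL P₂ P₁) = d := by
    rw [T.finrank_eq_of_intBasis (interL_rational P₂ P₁) w hw hws, Fintype.card_fin]
  subst hd
  have key : ∀ P : RealPolarization T, interL P₂ P₁ ≤ P.L →
      ∃ v : Fin (codimInter P₂ P₁) → V,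
        Submodule.span ℤ (Set.range (Sum.elim v w ∘ (splitEquiv P₂ P₁).symm)) = T.lat P.L := by
    intro P hP
    obtain ⟨b, v, hv, hs⟩ := T.exists_extend_lat hP w hw hws
    have hb : b = codimInter P₂ P₁ := by
      have := T.finrank_eq_of_intBasis P.rational _ hv hs
      rw [P.finrank_eq, Fintype.card_sum, Fintype.card_fin, Fintype.card_fin] at this
      rw [codimInter]
      omega
    subst hb
    refine ⟨v, ?_⟩
    rw [(splitEquiv P₂ P₁).symm.surjective.range_comp, ← hs, Set.Sum.elim_range,
      Set.Sum.elim_range, Set.union_comm]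
  obtain ⟨v₁, hs₁⟩ := key P₁ inf_le_left
  obtain ⟨v₂, hs₂⟩ := key P₂ inf_le_right
  have he : ∀ i : Fin g, codimInter P₂ P₁ ≤ i → ∃ j, i = splitEquiv P₂ P₁ (Sum.inr j) := by
    intro i hi
    obtain ⟨(a | j), rfl⟩ := (splitEquiv P₂ P₁).surjective i
    · rw [splitEquiv_inl] at hi
      exact absurd (head_lt P₂ P₁ a) (not_lt.2 hi)
    · exact ⟨j, rfl⟩
  have he' : ∀ j, codimInter P₂ P₁ ≤ (splitEquiv P₂ P₁ (Sum.inr j) : ℕ) := fun j => by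
    rw [splitEquiv_inr_val]
    omega
  have mem_of : ∀ (P : RealPolarization T) (v : Fin (codimInter P₂ P₁) → V),
      Submodule.span ℤ (Set.range (Sum.elim v w ∘ (splitEquiv P₂ P₁).symm)) = T.lat P.L →
      ∀ i, (Sum.elim v w ∘ (splitEquiv P₂ P₁).symm) i ∈ T.lat P.L := fun P v hs i =>
    mem_of_span_range_eq hs i
  obtain ⟨D₁, hD₁Z, hD₁⟩ := P₁.exists_dual_family _ hs₁
  -- With threshold g the isotropy hypothesis is vacuous: B₁ is built freely and B₂ is then adapted
  -- to it.
  obtain ⟨B₁, hB₁W, -⟩ := P₁.exists_basis_of_dual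
    (fun i => ⟨(Sum.elim v₁ w ∘ (splitEquiv P₂ P₁).symm) i, (mem_of P₁ v₁ hs₁ i).2⟩) hs₁ D₁ hD₁Z hD₁ g
    (fun i _ hi => absurd i.2 (not_lt.2 hi))
  have hB₁ : ∀ j, (B₁.W (splitEquiv P₂ P₁ (Sum.inr j)) : V) = w j := fun j => by
    rw [hB₁W]
    simp
  -- correct the basis of `L₂ ∩ Z` to be orthogonal to the last vectors dual to that of `L₁ ∩ Z`
  let u : Fin (codimInter P₂ P₁) → V := fun i =>
    v₂ i - ∑ j, T.ω (v₂ i) (B₁.W' (splitEquiv P₂ P₁ (Sum.inr j))) • w j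
  have hv₂ : ∀ i, v₂ i ∈ T.lat P₂.L := fun i => by
    simpa using mem_of P₂ v₂ hs₂ (splitEquiv P₂ P₁ (Sum.inl i))
  have hw₂ : ∀ j, w j ∈ T.lat P₂.L := fun j => by
    simpa using mem_of P₂ v₂ hs₂ (splitEquiv P₂ P₁ (Sum.inr j))
  have hcorr : ∀ i, ∑ j, T.ω (v₂ i) (B₁.W' (splitEquiv P₂ P₁ (Sum.inr j))) • w j ∈
      Submodule.span ℤ (Set.range w) := fun i => by
    refine sum_mem fun j _ => ?_
    obtain ⟨n, hn⟩ := T.omega_int (hv₂ i).1 (B₁.W'_mem (splitEquiv P₂ P₁ (Sum.inr j)))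
    rw [hn, Int.cast_smul_eq_zsmul]
    exact Submodule.smul_mem _ _ (Submodule.subset_span ⟨j, rfl⟩)
  have hws₂ : Submodule.span ℤ (Set.range w) ≤ T.lat P₂.L := by
    rw [Submodule.span_le]
    rintro _ ⟨j, rfl⟩
    exact hw₂ j
  have hu₂ : ∀ i, u i ∈ T.lat P₂.L := fun i => sub_mem (hv₂ i) (hws₂ (hcorr i))
  have hsu : Submodule.span ℤ (Set.range (Sum.elim u w ∘ (splitEquiv P₂ P₁).symm)) = T.lat P₂.L := by
    rw [(splitEquiv P₂ P₁).symm.surjective.range_comp, Set.Sum.elim_range]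
    rw [(splitEquiv P₂ P₁).symm.surjective.range_comp, Set.Sum.elim_range] at hs₂
    apply le_antisymm
    · rw [Submodule.span_le]
      rintro _ (⟨i, rfl⟩ | ⟨j, rfl⟩)
      · exact hu₂ i
      · exact hw₂ j
    · rw [← hs₂, Submodule.span_le]
      rintro _ (⟨i, rfl⟩ | ⟨j, rfl⟩)
      · rw [show v₂ i = u i + ∑ j, T.ω (v₂ i) (B₁.W' (splitEquiv P₂ P₁ (Sum.inr j))) • w j by simp [u]]
        exact add_mem (Submodule.subset_span (Or.inl ⟨i, rfl⟩))
          (Submodule.span_mono Set.subset_union_right (hcorr i))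
      · exact Submodule.subset_span (Or.inr ⟨j, rfl⟩)
  obtain ⟨D, hDZ, hD⟩ := P₂.exists_dual_family _ hsu
  -- The last dual vectors are copied from B₁. They are dual to (u, w) thanks to the correction of
  -- v₂, and mutually orthogonal, so making the family isotropic leaves them unchanged.
  let D₂ : Fin g → V := fun i => if codimInter P₂ P₁ ≤ (i : ℕ) then B₁.W' i else D i
  have hwW' : ∀ j i, T.ω (w j) (B₁.W' i) = if splitEquiv P₂ P₁ (Sum.inr j) = i then 1 else 0 := fun j i => by
    rw [← hB₁, B₁.pairing]
  have hD₂ : ∀ i j, T.ω ((Sum.elim u w ∘ (splitEquiv P₂ P₁).symm) i) (D₂ j) = if i = j then 1 else 0 := by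
    intro i j
    by_cases hj : codimInter P₂ P₁ ≤ (j : ℕ)
    · simp only [D₂, if_pos hj]
      obtain ⟨j', rfl⟩ := he j hj
      obtain ⟨(i' | i'), rfl⟩ := (splitEquiv P₂ P₁).surjective i
      · simp [u, hwW']
      · simp [hwW']
    · simp only [D₂, if_neg hj]
      exact hD i j
  obtain ⟨B₂, hB₂W, hB₂W'⟩ := P₂.exists_basis_of_dual
    (fun i => ⟨(Sum.elim u w ∘ (splitEquiv P₂ P₁).symm) i, (mem_of P₂ u hsu i).2⟩) hsu D₂
    (fun i => by
      simp only [D₂]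
      split_ifs
      · exact B₁.W'_mem i
      · exact hDZ i) hD₂ (codimInter P₂ P₁)
    (fun i j hi hj => by
      simp only [D₂, if_pos hi, if_pos hj]
      exact B₁.isotropic' i j)
  refine ⟨B₁, B₂, fun i hi => ⟨?_, ?_⟩, ?_⟩
  · obtain ⟨j, rfl⟩ := he i hi
    rw [hB₁, hB₂W]
    simp
  · rw [hB₂W' i hi]
    simp [D₂, if_pos (show codimInter P₂ P₁ ≤ (i : ℕ) from hi)]
  · rw [← T.span_real_of_span_int (interL_rational P₂ P₁) w hws]
    congr 1
    ext X
    constructor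
    · rintro ⟨i, hi, rfl⟩
      obtain ⟨j, rfl⟩ := he i hi
      exact ⟨j, (hB₁ j).symm⟩
    · rintro ⟨j, rfl⟩
      exact ⟨_, he' j, hB₁ j⟩

end Quantization

end

-- Linear algebra of two compatible bases and the phase

noncomputable section

open scoped Matrix

section Quantization

variable {g : ℕ} {V : Type*} [AddCommGroup V] [Module ℝ V] {T : SymplecticTorus g V}
variable {P₂ P₁ : RealPolarization T} {B₂ : PolarizationBasis P₂} {B₁ : PolarizationBasis P₁}

/-- The index `h + j`. -/
def tail (P₂ P₁ : RealPolarization T) (j : Fin (Module.finrank ℝ (interL P₂ P₁))) : Fin g :=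
  splitEquiv P₂ P₁ (Sum.inr j)

lemma le_tail (j : Fin (Module.finrank ℝ (interL P₂ P₁))) :
    codimInter P₂ P₁ ≤ (tail P₂ P₁ j : ℕ) := by
  rw [tail, splitEquiv_inr_val]
  exact Nat.le_add_right _ _

lemma head_ne_tail (i : Fin (codimInter P₂ P₁)) (j : Fin (Module.finrank ℝ (interL P₂ P₁))) :
    head P₂ P₁ i ≠ tail P₂ P₁ j := by
  rw [← splitEquiv_inl, tail]
  simp

lemma head_inj {i j : Fin (codimInter P₂ P₁)} : head P₂ P₁ i = head P₂ P₁ j ↔ i = j := by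
  rw [← splitEquiv_inl, ← splitEquiv_inl]
  simp

lemma tail_inj {i j : Fin (Module.finrank ℝ (interL P₂ P₁))} :
    tail P₂ P₁ i = tail P₂ P₁ j ↔ i = j := by
  simp [tail]

lemma head_or_tail (P₂ P₁ : RealPolarization T) (i : Fin g) :
    (∃ a, i = head P₂ P₁ a) ∨ ∃ j, i = tail P₂ P₁ j := by
  obtain ⟨(a | j), rfl⟩ := (splitEquiv P₂ P₁).surjective i
  · exact Or.inl ⟨a, splitEquiv_inl _ _ a⟩
  · exact Or.inr ⟨j, rfl⟩

lemma exists_head_of_lt {i : Fin g} (hi : (i : ℕ) < codimInter P₂ P₁) :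
    ∃ a, i = head P₂ P₁ a := ⟨⟨i, hi⟩, rfl⟩

lemma exists_tail_of_le {i : Fin g} (hi : codimInter P₂ P₁ ≤ (i : ℕ)) :
    ∃ j, i = tail P₂ P₁ j := by
  rcases head_or_tail P₂ P₁ i with ⟨a, rfl⟩ | h
  · exact absurd (head_lt P₂ P₁ a) (not_lt.2 hi)
  · exact h

lemma sum_head_add_tail (P₂ P₁ : RealPolarization T) {M : Type*} [AddCommMonoid M]
    (f : Fin g → M) :
    ∑ i, f i = ∑ a, f (head P₂ P₁ a) + ∑ j, f (tail P₂ P₁ j) := by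
  rw [← (splitEquiv P₂ P₁).sum_comp, Fintype.sum_sum_type]
  simp only [splitEquiv_inl]
  rfl

namespace AreCompatible

lemma W_tail (hc : AreCompatible B₂ B₁) (j : Fin (Module.finrank ℝ (interL P₂ P₁))) :
    (B₁.W (tail P₂ P₁ j) : V) = B₂.W (tail P₂ P₁ j) := (hc.1 _ (le_tail j)).1

lemma W'_tail (hc : AreCompatible B₂ B₁) (j : Fin (Module.finrank ℝ (interL P₂ P₁))) :
    B₁.W' (tail P₂ P₁ j) = B₂.W' (tail P₂ P₁ j) := (hc.1 _ (le_tail j)).2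

lemma W_tail_mem (hc : AreCompatible B₂ B₁) (j : Fin (Module.finrank ℝ (interL P₂ P₁))) :
    (B₁.W (tail P₂ P₁ j) : V) ∈ interL P₂ P₁ :=
  ⟨(B₁.W _).2, hc.W_tail j ▸ (B₂.W _).2⟩

lemma exists_eq_sum_tail (hc : AreCompatible B₂ B₁) {X : V} (hX : X ∈ interL P₂ P₁) :
    ∃ c : Fin (Module.finrank ℝ (interL P₂ P₁)) → ℝ, X = ∑ j, c j • (B₁.W (tail P₂ P₁ j) : V) := by
  have himg : (fun i => (B₁.W i : V)) '' {i : Fin g | codimInter P₂ P₁ ≤ (i : ℕ)} =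
      Set.range fun j => (B₁.W (tail P₂ P₁ j) : V) := by
    ext Y
    constructor
    · rintro ⟨i, hi, rfl⟩
      obtain ⟨j, rfl⟩ := exists_tail_of_le hi
      exact ⟨j, rfl⟩
    · rintro ⟨j, rfl⟩
      exact ⟨_, le_tail j, rfl⟩
  rw [← hc.2, himg, Submodule.mem_span_range_iff_exists_fun] at hX
  obtain ⟨c, rfl⟩ := hX
  exact ⟨c, rfl⟩

lemma omega_W'_head₁ (hc : AreCompatible B₂ B₁) {X : V} (hX : X ∈ interL P₂ P₁)
    (i : Fin (codimInter P₂ P₁)) : T.ω X (B₁.W' (head P₂ P₁ i)) = 0 := by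
  obtain ⟨c, rfl⟩ := hc.exists_eq_sum_tail hX
  simp [B₁.pairing, (head_ne_tail _ _).symm]

lemma omega_W'_head₂ (hc : AreCompatible B₂ B₁) {X : V} (hX : X ∈ interL P₂ P₁)
    (i : Fin (codimInter P₂ P₁)) : T.ω X (B₂.W' (head P₂ P₁ i)) = 0 := by
  obtain ⟨c, rfl⟩ := hc.exists_eq_sum_tail hX
  simp [hc.W_tail, B₂.pairing, (head_ne_tail _ _).symm]

lemma isLatticeBasis_tail (hc : AreCompatible B₂ B₁) :
    IsLatticeBasis T (interL P₂ P₁)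
      (fun j => ⟨B₁.W (tail P₂ P₁ j), hc.W_tail_mem j⟩) := by
  refine ⟨?_, le_antisymm ?_ ?_⟩
  · rw [Fintype.linearIndependent_iff]
    intro c h i
    have h' := congrArg (fun X : interL P₂ P₁ => T.ω (X : V) (B₁.W' (tail P₂ P₁ i))) h
    simpa [map_sum, B₁.pairing, tail_inj] using h'
  · rw [AddSubgroup.closure_le]
    rintro _ ⟨j, rfl⟩
    exact ⟨B₁.W_mem _, hc.W_tail_mem j⟩
  · rintro X ⟨hZ, hL⟩
    rw [mem_closure_range_iff]
    choose n hn using fun j => T.omega_int hZ (B₁.W'_mem (tail P₂ P₁ j))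
    refine ⟨n, ?_⟩
    have e := B₁.coe_eq_sum ⟨X, hL.1⟩
    simp only [sum_head_add_tail P₂ P₁, hc.omega_W'_head₁ hL, zero_smul, Finset.sum_const_zero,
      zero_add, hn] at e
    exact e

lemma omega_W₂_W₁_tail (hc : AreCompatible B₂ B₁) (i : Fin g)
    (j : Fin (Module.finrank ℝ (interL P₂ P₁))) : T.ω (B₂.W i) (B₁.W (tail P₂ P₁ j)) = 0 := by
  rw [hc.W_tail, B₂.omega_W_W]

lemma omega_W₂_W'₁_tail (hc : AreCompatible B₂ B₁) (i : Fin (codimInter P₂ P₁))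
    (j : Fin (Module.finrank ℝ (interL P₂ P₁))) :
    T.ω (B₂.W (head P₂ P₁ i)) (B₁.W' (tail P₂ P₁ j)) = 0 := by
  rw [hc.W'_tail, B₂.pairing, if_neg (head_ne_tail i j)]

lemma omega_W'₂_W₁_tail (hc : AreCompatible B₂ B₁) (i : Fin (codimInter P₂ P₁))
    (j : Fin (Module.finrank ℝ (interL P₂ P₁))) :
    T.ω (B₂.W' (head P₂ P₁ i)) (B₁.W (tail P₂ P₁ j)) = 0 := by
  rw [hc.W_tail, ← T.alt.neg_eq, B₂.pairing, if_neg (head_ne_tail i j).symm, neg_zero]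

lemma omega_W'₂_W'₁_tail (hc : AreCompatible B₂ B₁) (i : Fin g)
    (j : Fin (Module.finrank ℝ (interL P₂ P₁))) :
    T.ω (B₂.W' i) (B₁.W' (tail P₂ P₁ j)) = 0 := by
  rw [hc.W'_tail, B₂.isotropic']

lemma omega_W₂_tail_W₁ (hc : AreCompatible B₂ B₁) (i : Fin g)
    (j : Fin (Module.finrank ℝ (interL P₂ P₁))) : T.ω (B₂.W (tail P₂ P₁ j)) (B₁.W i) = 0 := by
  rw [← hc.W_tail, B₁.omega_W_W]

lemma mem_interL (hc : AreCompatible B₂ B₁) {X : V} (h1 : ∀ i, T.ω (B₁.W i) X = 0)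
    (h2 : ∀ i, T.ω (B₂.W (head P₂ P₁ i)) X = 0) : X ∈ interL P₂ P₁ := by
  refine ⟨(B₁.mem_L_iff X).2 h1, (B₂.mem_L_iff X).2 fun i => ?_⟩
  rcases head_or_tail P₂ P₁ i with ⟨a, rfl⟩ | ⟨j, rfl⟩
  · exact h2 a
  · rw [← hc.W_tail]
    exact h1 _

/-- A kernel vector gives a combination of the first h vectors W₁ that also lies in L₂, hence in L₁
∩ L₂. That space is spanned by the remaining W₁, so the combination is trivial. -/
lemma det_omega21_ne_zero (hc : AreCompatible B₂ B₁) : (omega21 B₂ B₁).det ≠ 0 := by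
  intro h
  obtain ⟨c, hc0, hcz⟩ := Matrix.exists_mulVec_eq_zero_iff.2 h
  apply hc0
  have hmem : ∑ j, c j • (B₁.W (head P₂ P₁ j) : V) ∈ interL P₂ P₁ := by
    refine hc.mem_interL (fun i => by simp [B₁.omega_W_W]) fun i => ?_
    have := congrFun hcz i
    simpa [Matrix.mulVec, dotProduct, omega21, mul_comm] using this
  ext i
  have := hc.omega_W'_head₁ hmem i
  simpa [B₁.pairing, head_inj] using this

/-- The matrix `ω(2',1')`. -/
def _root_.omega2'1' (B₂ : PolarizationBasis P₂) (B₁ : PolarizationBasis P₁) :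
    Matrix (Fin (codimInter P₂ P₁)) (Fin (codimInter P₂ P₁)) ℝ :=
  Matrix.of fun i j => T.ω (B₂.W' (head P₂ P₁ i)) (B₁.W' (head P₂ P₁ j))

/-- Expand X in B₁ and pair with W₂; the tail terms vanish by compatibility. Since ω(2,1) is
invertible, this recovers the first h coordinates of X along W₁ from its pairings with W₁ and W₂. -/
lemma omega21_mulVec (hc : AreCompatible B₂ B₁) (X : V) :
    omega21 B₂ B₁ *ᵥ (fun j => T.ω X (B₁.W' (head P₂ P₁ j))) =
      (fun i => T.ω (B₂.W (head P₂ P₁ i)) X) -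
        omega21' B₂ B₁ *ᵥ (fun j => T.ω (B₁.W (head P₂ P₁ j)) X) := by
  ext i
  rw [Pi.sub_apply, eq_sub_iff_add_eq]
  conv_rhs => rw [B₁.expand X, map_sum, sum_head_add_tail P₂ P₁]
  simp [Matrix.mulVec, dotProduct, omega21, omega21', hc.omega_W₂_W₁_tail,
    hc.omega_W₂_W'₁_tail, Finset.sum_add_distrib, mul_comm]

lemma omega_W'₂_head (hc : AreCompatible B₂ B₁) (X : V) :
    (fun i => T.ω X (B₂.W' (head P₂ P₁ i))) =
      - (omega2'1 B₂ B₁ *ᵥ (fun j => T.ω X (B₁.W' (head P₂ P₁ j)))) -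
        omega2'1' B₂ B₁ *ᵥ (fun j => T.ω (B₁.W (head P₂ P₁ j)) X) := by
  ext i
  rw [Pi.sub_apply, Pi.neg_apply, ← T.alt.neg_eq, ← neg_add', neg_inj]
  conv_lhs => rw [B₁.expand X, map_sum, sum_head_add_tail P₂ P₁]
  simp [Matrix.mulVec, dotProduct, omega2'1, omega2'1', hc.omega_W'₂_W₁_tail,
    hc.omega_W'₂_W'₁_tail, Finset.sum_add_distrib, mul_comm]

/-- This is ω(W₂ᵢ, W₂ⱼ) = 0 expanded in B₁. The companion relation below comes from ω(W₂ᵢ, W₂ⱼ') =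
δᵢⱼ. -/
lemma omega21_mul_transpose_omega21' (hc : AreCompatible B₂ B₁) :
    omega21 B₂ B₁ * (omega21' B₂ B₁)ᵀ = omega21' B₂ B₁ * (omega21 B₂ B₁)ᵀ := by
  ext i j
  have h := B₁.omega_eq_sum (B₂.W (head P₂ P₁ i)) (B₂.W (head P₂ P₁ j))
  rw [B₂.omega_W_W, sum_head_add_tail P₂ P₁] at h
  simp only [hc.omega_W₂_W'₁_tail, zero_mul, mul_zero, sub_zero, Finset.sum_const_zero,
    add_zero] at h
  simp only [Matrix.mul_apply, Matrix.transpose_apply, omega21, omega21', Matrix.of_apply]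
  rw [← sub_eq_zero, h, ← Finset.sum_sub_distrib]
  refine Finset.sum_congr rfl fun l _ => ?_
  rw [← T.alt.neg_eq (B₁.W (head P₂ P₁ l)) (B₂.W (head P₂ P₁ j)),
    ← T.alt.neg_eq (B₁.W (head P₂ P₁ l)) (B₂.W (head P₂ P₁ i))]
  ring

lemma omega21_mul_transpose_omega2'1' (hc : AreCompatible B₂ B₁) :
    omega21 B₂ B₁ * (omega2'1' B₂ B₁)ᵀ = 1 + omega21' B₂ B₁ * (omega2'1 B₂ B₁)ᵀ := by
  ext i j
  have h := B₁.omega_eq_sum (B₂.W (head P₂ P₁ i)) (B₂.W' (head P₂ P₁ j))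
  rw [B₂.pairing, sum_head_add_tail P₂ P₁] at h
  simp only [hc.omega_W₂_W'₁_tail, hc.omega_W'₂_W'₁_tail, zero_mul, mul_zero, sub_zero,
    Finset.sum_const_zero, add_zero, head_inj] at h
  simp only [Matrix.mul_apply, Matrix.transpose_apply, omega21, omega21', omega2'1, omega2'1',
    Matrix.of_apply, Matrix.add_apply, Matrix.one_apply]
  rw [← sub_eq_iff_eq_add, h, ← Finset.sum_sub_distrib]
  refine Finset.sum_congr rfl fun l _ => ?_
  rw [← T.alt.neg_eq (B₁.W (head P₂ P₁ l)) (B₂.W' (head P₂ P₁ j)),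
    ← T.alt.neg_eq (B₁.W (head P₂ P₁ l)) (B₂.W (head P₂ P₁ i))]
  ring

/-- Eliminates ω(2',1'), which does not occur in the phase A. The first symplectic relation makes
ω(2,1)⁻¹ω(2,1') symmetric, and the second one is then solved for ω(2',1'). -/
lemma omega2'1'_eq (hc : AreCompatible B₂ B₁) :
    omega2'1' B₂ B₁ =
      ((omega21 B₂ B₁)⁻¹)ᵀ + omega2'1 B₂ B₁ * ((omega21 B₂ B₁)⁻¹ * omega21' B₂ B₁) := by
  have hu : IsUnit (omega21 B₂ B₁).det := hc.det_omega21_ne_zero.isUnit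
  have huT : IsUnit (omega21 B₂ B₁)ᵀ.det := by rwa [Matrix.det_transpose]
  have hsymm : ((omega21 B₂ B₁)⁻¹ * omega21' B₂ B₁)ᵀ = (omega21 B₂ B₁)⁻¹ * omega21' B₂ B₁ := by
    have h := congrArg (fun M => (omega21 B₂ B₁)⁻¹ * M * ((omega21 B₂ B₁)ᵀ)⁻¹)
      hc.omega21_mul_transpose_omega21'
    rw [← Matrix.mul_assoc, Matrix.nonsing_inv_mul _ hu, Matrix.one_mul, Matrix.mul_assoc,
      Matrix.mul_assoc, Matrix.mul_nonsing_inv _ huT, Matrix.mul_one] at h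
    rw [Matrix.transpose_mul, Matrix.transpose_nonsing_inv, h]
  rw [← hsymm, ← Matrix.transpose_inj, Matrix.transpose_add, Matrix.transpose_mul,
    Matrix.transpose_transpose, Matrix.transpose_transpose]
  have h := congrArg (fun M => (omega21 B₂ B₁)⁻¹ * M) hc.omega21_mul_transpose_omega2'1'
  rw [← Matrix.mul_assoc, Matrix.nonsing_inv_mul _ hu, Matrix.one_mul, Matrix.mul_add,
    Matrix.mul_one, ← Matrix.mul_assoc] at h
  exact h

/-- The difference of the potentials at `X` in terms of the components of `X` transverse to the two
polarizations. -/
lemma potentialK_sub (hc : AreCompatible B₂ B₁) {X : V} {a b : Fin (codimInter P₂ P₁) → ℝ}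
    (ha : ∀ i, T.ω (B₁.W (head P₂ P₁ i)) X = a i)
    (hb : ∀ i, T.ω (B₂.W (head P₂ P₁ i)) X = b i) :
    potentialK B₂ X - potentialK B₁ X = 1 / 2 *
      (a ⬝ᵥ ((omega21 B₂ B₁)⁻¹ * omega21' B₂ B₁).mulVec a
        - 2 * (a ⬝ᵥ ((omega21 B₂ B₁)⁻¹).mulVec b)
        - b ⬝ᵥ (omega2'1 B₂ B₁ * (omega21 B₂ B₁)⁻¹).mulVec b) := by
  have hu : IsUnit (omega21 B₂ B₁).det := hc.det_omega21_ne_zero.isUnit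
  have h1 := hc.omega21_mulVec X
  have h2 := hc.omega_W'₂_head X
  simp only [ha, hb] at h1 h2
  set y₁ := fun j => T.ω X (B₁.W' (head P₂ P₁ j)) with hy₁
  have h1' : y₁ = (omega21 B₂ B₁)⁻¹ *ᵥ (b - omega21' B₂ B₁ *ᵥ a) := by
    have : b - omega21' B₂ B₁ *ᵥ a = omega21 B₂ B₁ *ᵥ y₁ := h1.symm
    rw [this, Matrix.mulVec_mulVec, Matrix.nonsing_inv_mul _ hu, Matrix.one_mulVec]
  set y₂ := fun j => T.ω X (B₂.W' (head P₂ P₁ j)) with hy₂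
  -- The bases agree on the last indices, so the tail sums of the two potentials are the same and
  -- cancel.
  have e1 : potentialK B₁ X = 1 / 2 * (a ⬝ᵥ y₁ + ∑ j, T.ω X (B₁.W' (tail P₂ P₁ j)) *
      T.ω (B₁.W (tail P₂ P₁ j)) X) := by
    rw [potentialK, sum_head_add_tail P₂ P₁]
    simp [ha, dotProduct, hy₁, mul_comm]
  have e2 : potentialK B₂ X = 1 / 2 * (b ⬝ᵥ y₂ + ∑ j, T.ω X (B₁.W' (tail P₂ P₁ j)) *
      T.ω (B₁.W (tail P₂ P₁ j)) X) := by
    rw [potentialK, sum_head_add_tail P₂ P₁]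
    simp [hb, dotProduct, hy₂, mul_comm, hc.W_tail, hc.W'_tail]
  have h2' : y₂ = - (omega2'1 B₂ B₁ *ᵥ y₁) - omega2'1' B₂ B₁ *ᵥ a := h2
  have h2'' : y₂ = - ((omega2'1 B₂ B₁ * (omega21 B₂ B₁)⁻¹) *ᵥ b) - ((omega21 B₂ B₁)⁻¹)ᵀ *ᵥ a := by
    rw [h2', h1', hc.omega2'1'_eq, Matrix.mulVec_sub, Matrix.mulVec_sub, Matrix.add_mulVec,
      ← Matrix.mulVec_mulVec, ← Matrix.mulVec_mulVec, ← Matrix.mulVec_mulVec]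
    abel
  have hT : b ⬝ᵥ ((omega21 B₂ B₁)⁻¹)ᵀ *ᵥ a = a ⬝ᵥ (omega21 B₂ B₁)⁻¹ *ᵥ b := by
    rw [Matrix.mulVec_transpose, dotProduct_comm, Matrix.dotProduct_mulVec]
  rw [e1, e2, h2'', h1', Matrix.mulVec_sub, dotProduct_sub, dotProduct_sub, dotProduct_neg, hT,
    Matrix.mulVec_mulVec]
  ring

lemma expi_potentialK_sub_eq_phaseA (hc : AreCompatible B₂ B₁) {k : ℕ} (hk : 0 < k) {X : V}
    {q₂ q₁ : Fin g → ℤ} {l : Fin (codimInter P₂ P₁) → ℤ}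
    (ha : ∀ i, T.ω (B₁.W (head P₂ P₁ i)) X = q₁ (head P₂ P₁ i) / k)
    (hb : ∀ i, T.ω (B₂.W (head P₂ P₁ i)) X = q₂ (head P₂ P₁ i) / k + l i) :
    expi (k * (potentialK B₂ X - potentialK B₁ X)) =
      Complex.exp ((Real.pi : ℂ) * Complex.I / (k : ℂ) * (phaseA k B₂ B₁ l q₂ q₁ : ℂ)) := by
  have hk' : (k : ℝ) ≠ 0 := by exact_mod_cast hk.ne'
  have hkC : (k : ℂ) ≠ 0 := by exact_mod_cast hk.ne'
  let a : Fin (codimInter P₂ P₁) → ℝ := fun i => (q₁ (head P₂ P₁ i) : ℝ)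
  let b : Fin (codimInter P₂ P₁) → ℝ := fun i => (q₂ (head P₂ P₁ i) : ℝ) + (k : ℝ) * (l i : ℝ)
  have h := hc.potentialK_sub (X := X) (a := (k : ℝ)⁻¹ • a) (b := (k : ℝ)⁻¹ • b)
    (fun i => by rw [ha]; simp only [a, Pi.smul_apply, smul_eq_mul]; ring)
    (fun i => by rw [hb]; simp only [b, Pi.smul_apply, smul_eq_mul]; field_simp)
  -- The pairings of X are a/k and b/k and the phase is quadratic, so K₂ - K₁ = A/(2k²); multiplied
  -- by 2πik this is πiA/k.
  have hp : potentialK B₂ X - potentialK B₁ X = 1 / 2 * ((k : ℝ)⁻¹ * ((k : ℝ)⁻¹ *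
      phaseA k B₂ B₁ l q₂ q₁)) := by
    rw [h]
    simp only [Matrix.mulVec_smul, smul_dotProduct, dotProduct_smul, smul_eq_mul, phaseA]
    simp only [a, b]
    ring
  rw [hp, expi]
  congr 1
  push_cast
  field_simp

end AreCompatible

end Quantization

end

-- Pairing frames and the half-density factor

noncomputable section

open scoped Matrix

section Quantization

variable {g : ℕ} {V : Type*} [AddCommGroup V] [Module ℝ V] {T : SymplecticTorus g V}

lemma PolarizationBasis.linearIndependent_of_det {P : RealPolarization T} (B : PolarizationBasis P)
    {U : Fin g → P.L} (h : (B.coordMatrix U).det ≠ 0) : LinearIndependent ℝ U := by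
  rw [Fintype.linearIndependent_iff]
  intro c hc
  by_contra! hne
  obtain ⟨i, hi⟩ := hne
  refine h (Matrix.exists_mulVec_eq_zero_iff.1 ⟨c, fun h0 => hi (congrFun h0 i), ?_⟩)
  ext j
  have := congrArg (fun X : P.L => T.ω (X : V) (B.W' j)) hc
  simpa [Matrix.mulVec, dotProduct, PolarizationBasis.coordMatrix, mul_comm] using this

variable {P₂ P₁ : RealPolarization T} {B₂ : PolarizationBasis P₂} {B₁ : PolarizationBasis P₁}

/-- The upper left block of the coordinate matrix of a frame. -/
def headMatrix (P₂ P₁ : RealPolarization T) {P : RealPolarization T} (B : PolarizationBasis P)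
    (U : Fin g → P.L) : Matrix (Fin (codimInter P₂ P₁)) (Fin (codimInter P₂ P₁)) ℝ :=
  Matrix.of fun i j => T.ω (U (head P₂ P₁ j) : V) (B.W' (head P₂ P₁ i))

/-- The coordinate matrix of a frame of `L₁ ∩ L₂`. -/
def tailMatrix (P₂ P₁ : RealPolarization T) {P : RealPolarization T} (B : PolarizationBasis P)
    (w : Fin (Module.finrank ℝ (interL P₂ P₁)) → interL P₂ P₁) :
    Matrix (Fin (Module.finrank ℝ (interL P₂ P₁))) (Fin (Module.finrank ℝ (interL P₂ P₁))) ℝ :=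
  Matrix.of fun i j => T.ω (w j : V) (B.W' (tail P₂ P₁ i))

/-- Vectors of L₁ ∩ L₂ have no coordinates along the first h basis vectors, so the coordinate matrix
is block triangular. -/
lemma det_coordMatrix_eq {P : RealPolarization T} (B : PolarizationBasis P)
    (hB : ∀ X ∈ interL P₂ P₁, ∀ i, T.ω X (B.W' (head P₂ P₁ i)) = 0)
    {w : Fin (Module.finrank ℝ (interL P₂ P₁)) → interL P₂ P₁} {U : Fin g → P.L}
    (hU : ∀ j, (U (tail P₂ P₁ j) : V) = w j) :
    (B.coordMatrix U).det = (headMatrix P₂ P₁ B U).det * (tailMatrix P₂ P₁ B w).det := by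
  rw [← Matrix.det_submatrix_equiv_self (splitEquiv P₂ P₁),
    ← Matrix.det_fromBlocks_zero₁₂ (headMatrix P₂ P₁ B U)
      (Matrix.of fun i j => T.ω (U (head P₂ P₁ j) : V) (B.W' (tail P₂ P₁ i)))]
  congr 1
  ext (i | i) (j | j)
  · simp [PolarizationBasis.coordMatrix, headMatrix, splitEquiv_inl]
  · have : T.ω (U (tail P₂ P₁ j) : V) (B.W' (head P₂ P₁ i)) = 0 := by
      rw [hU]
      exact hB _ (w j).2 i
    simpa [PolarizationBasis.coordMatrix, splitEquiv_inl, tail] using this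
  · simp [PolarizationBasis.coordMatrix, splitEquiv_inl, tail]
  · have := hU j
    simp only [tail] at this
    simp [PolarizationBasis.coordMatrix, tailMatrix, tail, this]

namespace AreCompatible

lemma abs_det_tailMatrix (hc : AreCompatible B₂ B₁)
    {w : Fin (Module.finrank ℝ (interL P₂ P₁)) → interL P₂ P₁}
    (hw : IsLatticeBasis T (interL P₂ P₁) w) : |(tailMatrix P₂ P₁ B₁ w).det| = 1 := by
  refine abs_det_eq_one_of_closure_eq (fun j => (B₁.W (tail P₂ P₁ j) : V)) (fun j => (w j : V))
    (fun i => T.ω.flip (B₁.W' (tail P₂ P₁ i))) (fun i j => ?_) ?_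
  · simp [B₁.pairing, tail_inj, eq_comm]
  · rw [hw.2, ← hc.isLatticeBasis_tail.2]

lemma tailMatrix_eq (hc : AreCompatible B₂ B₁)
    (w : Fin (Module.finrank ℝ (interL P₂ P₁)) → interL P₂ P₁) :
    tailMatrix P₂ P₁ B₂ w = tailMatrix P₂ P₁ B₁ w := by
  ext i j
  simp [tailMatrix, hc.W'_tail]

lemma omega_frames (hc : AreCompatible B₂ B₁) (U₂ : Fin g → P₂.L) (U₁ : Fin g → P₁.L) :
    (Matrix.of fun i j => T.ω (U₂ (head P₂ P₁ i) : V) (U₁ (head P₂ P₁ j) : V)) =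
      (headMatrix P₂ P₁ B₂ U₂)ᵀ * omega21 B₂ B₁ * headMatrix P₂ P₁ B₁ U₁ := by
  ext i j
  have key : ∀ c₂ c₁ : Fin g → ℝ,
      T.ω (∑ l, c₂ l • (B₂.W l : V)) (∑ m, c₁ m • (B₁.W m : V)) =
        ∑ m, (∑ l, c₂ (head P₂ P₁ l) * T.ω (B₂.W (head P₂ P₁ l)) (B₁.W (head P₂ P₁ m))) *
          c₁ (head P₂ P₁ m) := by
    intro c₂ c₁
    simp only [map_sum, map_smul, LinearMap.sum_apply, LinearMap.smul_apply, smul_eq_mul]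
    rw [sum_head_add_tail P₂ P₁]
    simp only [hc.omega_W₂_W₁_tail, mul_zero, Finset.sum_const_zero, add_zero]
    refine Finset.sum_congr rfl fun m _ => ?_
    rw [sum_head_add_tail P₂ P₁, mul_comm]
    simp only [hc.omega_W₂_tail_W₁, mul_zero, Finset.sum_const_zero, add_zero]
  rw [Matrix.of_apply, B₁.coe_eq_sum (U₁ (head P₂ P₁ j)), B₂.coe_eq_sum (U₂ (head P₂ P₁ i)), key]
  simp only [Matrix.mul_apply, Matrix.transpose_apply, headMatrix, omega21, Matrix.of_apply]

/-- The frame condition reads k H₂ᵀ ω(2,1) H₁ = 1 for the head blocks, which fixes |det H₂ det H₁|.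
The tail blocks have determinant ±1 because w is a lattice basis. Hence the value does not depend on
the frame chosen in `pairingDensity`. -/
lemma halfDensity_mul_of_isPairingFrame (hc : AreCompatible B₂ B₁) {k : ℕ}
    {w : Fin (Module.finrank ℝ (interL P₂ P₁)) → interL P₂ P₁}
    (hw : IsLatticeBasis T (interL P₂ P₁) w) {U₂ : Fin g → P₂.L} {U₁ : Fin g → P₁.L}
    (hU : IsPairingFrame k P₂ P₁ w U₂ U₁) :
    B₂.halfDensity U₂ * B₁.halfDensity U₁ =
      ((|(k : ℝ) ^ codimInter P₂ P₁ * (omega21 B₂ B₁).det| ^ (-(1 / 2) : ℝ) : ℝ) : ℂ) := by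
  obtain ⟨-, -, -, htail, hhead, -⟩ := hU
  have hval : ∀ j, (tail P₂ P₁ j : ℕ) = codimInter P₂ P₁ + j := fun j => splitEquiv_inr_val _ _ j
  have d₁ := det_coordMatrix_eq B₁ (fun X hX => hc.omega_W'_head₁ hX) (w := w) (U := U₁)
    fun j => (htail _ j (hval j)).1
  have d₂ := det_coordMatrix_eq B₂ (fun X hX => hc.omega_W'_head₂ hX) (w := w) (U := U₂)
    fun j => (htail _ j (hval j)).2
  have hdet : |(k : ℝ) ^ codimInter P₂ P₁ * (omega21 B₂ B₁).det| *
      (|(headMatrix P₂ P₁ B₂ U₂).det| * |(headMatrix P₂ P₁ B₁ U₁).det|) = 1 := by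
    have h1 : (k : ℝ) • ((headMatrix P₂ P₁ B₂ U₂)ᵀ * omega21 B₂ B₁ * headMatrix P₂ P₁ B₁ U₁) =
        1 := by
      rw [← hc.omega_frames]
      ext i j
      rw [Matrix.smul_apply, Matrix.of_apply, smul_eq_mul,
        hhead _ _ (head_lt _ _ i) (head_lt _ _ j), Matrix.one_apply]
      simp only [head_inj]
    have h2 := congrArg Matrix.det h1
    rw [Matrix.det_smul, Matrix.det_mul, Matrix.det_mul, Matrix.det_transpose, Matrix.det_one,
      Fintype.card_fin] at h2
    rw [← abs_mul, ← abs_mul, ← abs_one (α := ℝ), ← h2]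
    congr 1
    ring
  rw [PolarizationBasis.halfDensity, PolarizationBasis.halfDensity, d₁, d₂, hc.tailMatrix_eq,
    abs_mul, abs_mul, hc.abs_det_tailMatrix hw, mul_one, mul_one, ← Complex.ofReal_mul,
    ← Real.mul_rpow (abs_nonneg _) (abs_nonneg _)]
  congr 1
  rw [eq_inv_of_mul_eq_one_right hdet, Real.rpow_neg (abs_nonneg _),
    Real.inv_rpow (abs_nonneg _)]

/-- Without a frame `pairingDensity` would take its default value 0. -/
lemma exists_isPairingFrame (hc : AreCompatible B₂ B₁) {k : ℕ} (hk : 0 < k)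
    {w : Fin (Module.finrank ℝ (interL P₂ P₁)) → interL P₂ P₁}
    (hw : IsLatticeBasis T (interL P₂ P₁) w) :
    ∃ U : (Fin g → P₂.L) × (Fin g → P₁.L), IsPairingFrame k P₂ P₁ w U.1 U.2 := by
  have hk' : (k : ℝ) ≠ 0 := by exact_mod_cast hk.ne'
  have hC := hc.det_omega21_ne_zero
  -- The heads of B₁ are kept and those of B₂ are transformed by N, which normalizes k ω(U₂, U₁) to
  -- the identity.
  let N := ((k : ℝ) • omega21 B₂ B₁)⁻¹
  have hdet : ((k : ℝ) • omega21 B₂ B₁).det ≠ 0 := by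
    rw [Matrix.det_smul]
    exact mul_ne_zero (pow_ne_zero _ hk') hC
  have hN : N * ((k : ℝ) • omega21 B₂ B₁) = 1 := Matrix.nonsing_inv_mul _ hdet.isUnit
  have hNdet : N.det ≠ 0 := by
    intro h
    have := congrArg Matrix.det hN
    rw [Matrix.det_mul, h, zero_mul, Matrix.det_one] at this
    exact zero_ne_one this
  have hG : (tailMatrix P₂ P₁ B₁ w).det ≠ 0 := by
    intro h
    have := hc.abs_det_tailMatrix hw
    rw [h, abs_zero] at this
    exact zero_ne_one this
  let U₁ : Fin g → P₁.L := fun i => Sum.elim (fun a => B₁.W (head P₂ P₁ a))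
    (fun j => ⟨w j, (w j).2.1⟩) ((splitEquiv P₂ P₁).symm i)
  let U₂ : Fin g → P₂.L := fun i => Sum.elim (fun a => ∑ l, N a l • B₂.W (head P₂ P₁ l))
    (fun j => ⟨w j, (w j).2.2⟩) ((splitEquiv P₂ P₁).symm i)
  have hU₁h : ∀ a, U₁ (head P₂ P₁ a) = B₁.W (head P₂ P₁ a) := fun a => by
    simp [U₁, ← splitEquiv_inl]
  have hU₂h : ∀ a, U₂ (head P₂ P₁ a) = ∑ l, N a l • B₂.W (head P₂ P₁ l) := fun a => by
    simp only [U₂]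
    rw [← splitEquiv_inl, Equiv.symm_apply_apply, Sum.elim_inl]
  have hU₁t : ∀ j, (U₁ (tail P₂ P₁ j) : V) = w j := fun a => by
    simp [U₁, tail]
  have hU₂t : ∀ j, (U₂ (tail P₂ P₁ j) : V) = w j := fun a => by
    simp [U₂, tail]
  have hH₁ : headMatrix P₂ P₁ B₁ U₁ = 1 := by
    ext i j
    simp [headMatrix, hU₁h, B₁.pairing, head_inj, Matrix.one_apply, eq_comm]
  have hH₂ : headMatrix P₂ P₁ B₂ U₂ = Nᵀ := by
    ext i j
    simp [headMatrix, hU₂h, B₂.pairing, head_inj]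
  have d₁ := det_coordMatrix_eq B₁ (fun X hX => hc.omega_W'_head₁ hX) hU₁t
  have d₂ := det_coordMatrix_eq B₂ (fun X hX => hc.omega_W'_head₂ hX) hU₂t
  -- The vectors t are the last W₁', divided by k and changed by H, because w need not be the tail
  -- of B₁.
  let H := (tailMatrix P₂ P₁ B₁ w)⁻¹
  have hH : H * tailMatrix P₂ P₁ B₁ w = 1 := Matrix.nonsing_inv_mul _ hG.isUnit
  have htail_of : ∀ (i : Fin g) (j : Fin (Module.finrank ℝ (interL P₂ P₁))),
      (i : ℕ) = codimInter P₂ P₁ + j → i = tail P₂ P₁ j := fun i j h => by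
    ext
    rw [h, tail, splitEquiv_inr_val]
  refine ⟨(U₂, U₁), hw.1, B₁.linearIndependent_of_det ?_, B₂.linearIndependent_of_det ?_,
    fun i j h => ?_, fun i j hi hj => ?_,
    fun j => (k : ℝ)⁻¹ • ∑ m, H j m • B₁.W' (tail P₂ P₁ m), fun i j => ?_, fun i j hi => ?_⟩
  · rw [d₁, hH₁, Matrix.det_one, one_mul]
    exact hG
  · rw [d₂, hH₂, Matrix.det_transpose, hc.tailMatrix_eq]
    exact mul_ne_zero hNdet hG
  · obtain rfl := htail_of i j h
    exact ⟨hU₁t j, hU₂t j⟩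
  · obtain ⟨a, rfl⟩ := exists_head_of_lt hi
    obtain ⟨b, rfl⟩ := exists_head_of_lt hj
    have h1 := congrFun (congrFun (hc.omega_frames U₂ U₁) a) b
    rw [hH₁, hH₂, Matrix.transpose_transpose, Matrix.mul_one, Matrix.of_apply] at h1
    have h2 := congrFun (congrFun hN a) b
    rw [Matrix.mul_smul, Matrix.smul_apply, smul_eq_mul] at h2
    rw [h1, h2, Matrix.one_apply]
    simp only [head_inj]
  · have h2 := congrFun (congrFun hH j) i
    rw [Matrix.mul_apply] at h2
    rw [map_smul, smul_eq_mul, mul_inv_cancel_left₀ hk', map_sum]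
    simp only [map_smul, smul_eq_mul]
    rw [Matrix.one_apply] at h2
    simpa only [tailMatrix, Matrix.of_apply, eq_comm] using h2
  · obtain ⟨a, rfl⟩ := exists_head_of_lt hi
    simp only [hU₁h, hU₂h]
    simp [B₁.pairing, head_ne_tail, hc.omega_W₂_W'₁_tail]

lemma pairingDensity_orbitSection (hc : AreCompatible B₂ B₁) {k : ℕ} (hk : 0 < k)
    {w : Fin (Module.finrank ℝ (interL P₂ P₁)) → interL P₂ P₁}
    (hw : IsLatticeBasis T (interL P₂ P₁) w) {q₂ q₁ : Fin g → ZMod k} {X : V}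
    (h₂ : OverOrbit B₂ q₂ X) (h₁ : OverOrbit B₁ q₁ X) :
    pairingDensity k (B₂.orbitSection q₂ X) (B₁.orbitSection q₁ X) w =
      ((|(k : ℝ) ^ codimInter P₂ P₁ * (omega21 B₂ B₁).det| ^ (-(1 / 2) : ℝ) : ℝ) : ℂ) *
        expi (k * (potentialK B₂ X - potentialK B₁ X)) := by
  have hex := hc.exists_isPairingFrame hk hw
  rw [pairingDensity, dif_pos hex, ← hc.halfDensity_mul_of_isPairingFrame hw hex.choose_spec,
    B₂.orbitSection_of_overOrbit h₂, B₁.orbitSection_of_overOrbit h₁]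
  simp only [Pi.smul_apply, smul_eq_mul, map_mul, conj_expi, neg_neg]
  rw [mul_sub, sub_eq_add_neg, expi_add]
  have : (starRingEnd ℂ) (B₂.halfDensity hex.choose.1) = B₂.halfDensity hex.choose.1 :=
    Complex.conj_ofReal _
  rw [this]
  ring

end AreCompatible

end Quantization

end

-- Intersections of leaves and the matrix entries of the pairing

noncomputable section

open scoped Matrix

section Quantization

variable {g : ℕ} {V : Type*} [AddCommGroup V] [Module ℝ V] {T : SymplecticTorus g V}
variable {P₂ P₁ : RealPolarization T} {B₂ : PolarizationBasis P₂} {B₁ : PolarizationBasis P₁}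

lemma leafIntegral_const_mul (U : Submodule ℝ V) (d : ℕ) (ρ : V → (Fin d → U) → ℂ) (X : V)
    (c : ℂ) : leafIntegral T U d (fun Y w => c * ρ Y w) X = c * leafIntegral T U d ρ X := by
  rw [leafIntegral, leafIntegral]
  split_ifs
  · exact MeasureTheory.integral_const_mul c _
  · rw [mul_zero]

lemma pairingDensity_smul_smul (k : ℕ) (ν₂ : (Fin g → P₂.L) → ℂ) (ν₁ : (Fin g → P₁.L) → ℂ)
    (a b : ℂ) (w : Fin (Module.finrank ℝ (interL P₂ P₁)) → interL P₂ P₁) :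
    pairingDensity k (a • ν₂) (b • ν₁) w =
      (starRingEnd ℂ) a * b * pairingDensity k ν₂ ν₁ w := by
  rw [pairingDensity, pairingDensity]
  split_ifs
  · simp only [Pi.smul_apply, smul_eq_mul, map_mul]
    ring
  · rw [mul_zero]

/-- The pairing of `s_q₂ ⊗ δ₂` and `s_q₁ ⊗ δ₁`: the sum of the integrals over the components of
`Λ_q₂ ∩ Λ_q₁`. -/
def orbitPairing (k : ℕ) (B₂ : PolarizationBasis P₂) (B₁ : PolarizationBasis P₁)
    (q₂ q₁ : Fin g → ZMod k) : ℂ :=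
  ∑ᶠ c : interComponents (B₂.orbitLeaf q₂) (B₁.orbitLeaf q₁),
    leafIntegral T (interL P₂ P₁) (Module.finrank ℝ (interL P₂ P₁))
      (fun X w => pairingDensity k (B₂.orbitSection q₂ X) (B₁.orbitSection q₁ X) w)
      (Quotient.out c.1)

lemma bksPairing_eq {k : ℕ} [NeZero k] (hk2 : Even k) (B₂ : PolarizationBasis P₂)
    (B₁ : PolarizationBasis P₁) (ψ₂ : QuantumSpace k P₂) (ψ₁ : QuantumSpace k P₁) :
    bksPairing ψ₂ ψ₁ = ∑ q₂, ∑ q₁,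
      (starRingEnd ℂ) (B₂.coeff q₂ ψ₂) * B₁.coeff q₁ ψ₁ * orbitPairing k B₂ B₁ q₂ q₁ := by
  rw [bksPairing, ← finsum_eq_sum_of_fintype]
  refine (finsum_eq_of_bijective _ (B₂.orbitEquiv k).bijective fun q₂ => ?_).symm
  rw [← finsum_eq_sum_of_fintype]
  refine finsum_eq_of_bijective _ (B₁.orbitEquiv k).bijective fun q₁ => ?_
  rw [orbitPairing, ← smul_eq_mul, smul_finsum]
  refine finsum_congr fun c => ?_
  rw [smul_eq_mul, ← leafIntegral_const_mul]
  congr 1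
  ext X w
  rw [B₂.apply_orbitEquiv hk2, B₁.apply_orbitEquiv hk2, Pi.smul_apply, Pi.smul_apply,
    pairingDensity_smul_smul]

lemma bksPairing_sigma {k : ℕ} [NeZero k] (hk2 : Even k) (B₂ : PolarizationBasis P₂)
    (B₁ : PolarizationBasis P₁) (q₂ q₁ : Fin g → ZMod k) :
    bksPairing (B₂.sigma hk2 q₂) (B₁.sigma hk2 q₁) = orbitPairing k B₂ B₁ q₂ q₁ := by
  rw [bksPairing_eq hk2 B₂ B₁]
  simp [PolarizationBasis.coeff_sigma]

/-- The point with `ω(W₁ᵢ, X) = aᵢ` for all `i` and `ω(W₂ᵢ, X) = bᵢ` for the first `h` indices. -/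
def transversePoint (B₂ : PolarizationBasis P₂) (B₁ : PolarizationBasis P₁) (a : Fin g → ℝ)
    (b : Fin (codimInter P₂ P₁) → ℝ) : V :=
  ∑ j, ((omega21 B₂ B₁)⁻¹ *ᵥ (b - omega21' B₂ B₁ *ᵥ (fun i => a (head P₂ P₁ i)))) j •
    (B₁.W (head P₂ P₁ j) : V) + ∑ i, a i • B₁.W' i

lemma omega_W₁_transversePoint (a : Fin g → ℝ) (b : Fin (codimInter P₂ P₁) → ℝ) (i : Fin g) :
    T.ω (B₁.W i) (transversePoint B₂ B₁ a b) = a i := by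
  rw [transversePoint, map_add, B₁.omega_comb_W]
  simp [B₁.omega_W_W]

namespace AreCompatible

lemma omega_W₂_transversePoint (hc : AreCompatible B₂ B₁) (a : Fin g → ℝ)
    (b : Fin (codimInter P₂ P₁) → ℝ) (i : Fin (codimInter P₂ P₁)) :
    T.ω (B₂.W (head P₂ P₁ i)) (transversePoint B₂ B₁ a b) = b i := by
  have hu : IsUnit (omega21 B₂ B₁).det := hc.det_omega21_ne_zero.isUnit
  have h := hc.omega21_mulVec (transversePoint B₂ B₁ a b)
  have hy : (fun j => T.ω (transversePoint B₂ B₁ a b) (B₁.W' (head P₂ P₁ j))) =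
      (omega21 B₂ B₁)⁻¹ *ᵥ (b - omega21' B₂ B₁ *ᵥ (fun i => a (head P₂ P₁ i))) := by
    ext j
    rw [transversePoint, map_add, LinearMap.add_apply, B₁.omega_comb_W']
    simp [B₁.pairing, head_inj]
  rw [hy, Matrix.mulVec_mulVec, Matrix.mul_nonsing_inv _ hu, Matrix.one_mulVec] at h
  simp only [omega_W₁_transversePoint] at h
  exact (congrFun (sub_left_injective h) i).symm

lemma omega21_int (B₂ : PolarizationBasis P₂) (B₁ : PolarizationBasis P₁) :
    ∃ C : Matrix (Fin (codimInter P₂ P₁)) (Fin (codimInter P₂ P₁)) ℤ,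
      omega21 B₂ B₁ = C.map (Int.castRingHom ℝ) := by
  choose C hC using fun i j => T.omega_int (B₂.W_mem (head P₂ P₁ i)) (B₁.W_mem (head P₂ P₁ j))
  exact ⟨Matrix.of C, by ext i j; simp [omega21, hC]⟩

/-- Modulo L₁ ∩ L₂, a lattice vector of L₁ is an integer combination of the first h vectors W₁, and
its pairings with W₂ form ω(2,1)n. This is why components of an intersection are counted by
ℤʰ/ω(2,1)ℤʰ. -/
lemma mem_leafGroup_interL_iff (hc : AreCompatible B₂ B₁) {X : V}
    (h1 : ∀ i, T.ω (B₁.W i) X = 0) :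
    X ∈ leafGroup T (interL P₂ P₁) ↔ ∃ n : Fin (codimInter P₂ P₁) → ℤ,
      (fun i => T.ω (B₂.W (head P₂ P₁ i)) X) = omega21 B₂ B₁ *ᵥ (fun j => (n j : ℝ)) := by
  rw [leafGroup, AddSubgroup.mem_sup]
  constructor
  · rintro ⟨Y, hY, W, hW, rfl⟩
    have hY' : Y ∈ interL P₂ P₁ := hY
    have hWL : W ∈ P₁.L := by
      rw [B₁.mem_L_iff]
      intro i
      have := h1 i
      rwa [map_add, (B₁.mem_L_iff Y).1 hY'.1 i, zero_add] at this
    choose n hn using fun j => T.omega_int hW (B₁.W'_mem (head P₂ P₁ j))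
    refine ⟨n, ?_⟩
    have hz : (fun j => T.ω (B₁.W (head P₂ P₁ j)) W) = 0 :=
      funext fun j => (B₁.mem_L_iff W).1 hWL _
    have h := hc.omega21_mulVec W
    rw [hz, Matrix.mulVec_zero, sub_zero] at h
    simp only [hn] at h
    rw [h]
    ext i
    rw [map_add, (B₂.mem_L_iff Y).1 hY'.2, zero_add]
  · rintro ⟨n, hn⟩
    refine ⟨X - ∑ j, (n j : ℝ) • (B₁.W (head P₂ P₁ j) : V), ?_,
      ∑ j, (n j : ℝ) • (B₁.W (head P₂ P₁ j) : V), ?_, by simp⟩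
    · refine hc.mem_interL (fun i => by simp [h1, B₁.omega_W_W]) fun i => ?_
      have := congrFun hn i
      rw [map_sub, this, sub_eq_zero]
      simp [Matrix.mulVec, dotProduct, omega21, mul_comm]
    · refine sum_mem fun j _ => ?_
      rw [Int.cast_smul_eq_zsmul]
      exact zsmul_mem (B₁.W_mem _) _

variable {k : ℕ}

lemma overOrbit_transversePoint₁ (hk : 0 < k) (q₁ : Fin g → ℤ)
    (b : Fin (codimInter P₂ P₁) → ℝ) :
    OverOrbit B₁ (fun i => (q₁ i : ZMod k))
      (transversePoint B₂ B₁ (fun i => (q₁ i : ℝ) / k) b) := by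
  have hk' : (k : ℝ) ≠ 0 := by exact_mod_cast hk.ne'
  intro i
  refine ⟨q₁ i, rfl, ?_⟩
  rw [omega_W₁_transversePoint]
  field_simp

lemma overOrbit_transversePoint₂ (hc : AreCompatible B₂ B₁) (hk : 0 < k) {q₂ q₁ : Fin g → ℤ}
    (hq : ∀ j, (q₂ (tail P₂ P₁ j) : ZMod k) = q₁ (tail P₂ P₁ j))
    (l : Fin (codimInter P₂ P₁) → ℤ) :
    OverOrbit B₂ (fun i => (q₂ i : ZMod k)) (transversePoint B₂ B₁ (fun i => (q₁ i : ℝ) / k)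
      (fun i => (q₂ (head P₂ P₁ i) : ℝ) / k + l i)) := by
  have hk' : (k : ℝ) ≠ 0 := by exact_mod_cast hk.ne'
  intro i
  rcases head_or_tail P₂ P₁ i with ⟨a, rfl⟩ | ⟨j, rfl⟩
  · refine ⟨q₂ (head P₂ P₁ a) + k * l a, by simp, ?_⟩
    rw [hc.omega_W₂_transversePoint]
    push_cast
    field_simp
  · refine ⟨q₁ (tail P₂ P₁ j), (hq j).symm, ?_⟩
    rw [← hc.W_tail, omega_W₁_transversePoint]
    field_simp

/-- For a tail index W₁ and W₂ coincide, so a point over both leaves would have the same residue for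
both labels; the intersection is empty. -/
lemma orbitPairing_eq_zero (hc : AreCompatible B₂ B₁) [NeZero k] {q₂ q₁ : Fin g → ZMod k}
    {j : Fin (Module.finrank ℝ (interL P₂ P₁))}
    (hq : q₂ (tail P₂ P₁ j) ≠ q₁ (tail P₂ P₁ j)) : orbitPairing k B₂ B₁ q₂ q₁ = 0 := by
  have : IsEmpty (interComponents (B₂.orbitLeaf q₂) (B₁.orbitLeaf q₁)) := by
    refine ⟨fun c => hq ?_⟩
    obtain ⟨X, -, h2, h1⟩ := c.2
    rw [B₂.onLeaf_orbitLeaf_iff] at h2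
    rw [B₁.onLeaf_orbitLeaf_iff] at h1
    obtain ⟨n₂, hn₂, hx₂⟩ := h2 (tail P₂ P₁ j)
    obtain ⟨n₁, hn₁, hx₁⟩ := h1 (tail P₂ P₁ j)
    rw [hc.W_tail, hx₂] at hx₁
    rw [← hn₂, ← hn₁, Int.cast_injective hx₁]
  rw [orbitPairing, finsum_of_isEmpty]

/-- The integral over a component of the intersection of two leaves, through any of its points. -/
lemma leafIntegral_pairing (hc : AreCompatible B₂ B₁) (hk : 0 < k) (hk2 : Even k)
    {q₂ q₁ : Fin g → ZMod k} {X X' : V} (h₂ : OverOrbit B₂ q₂ X) (h₁ : OverOrbit B₁ q₁ X)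
    (hX : X' - X ∈ leafGroup T (interL P₂ P₁)) :
    leafIntegral T (interL P₂ P₁) (Module.finrank ℝ (interL P₂ P₁))
      (fun X w => pairingDensity k (B₂.orbitSection q₂ X) (B₁.orbitSection q₁ X) w) X' =
      ((|(k : ℝ) ^ codimInter P₂ P₁ * (omega21 B₂ B₁).det| ^ (-(1 / 2) : ℝ) : ℝ) : ℂ) *
        expi (k * (potentialK B₂ X - potentialK B₁ X)) := by
  refine leafIntegral_eq_of_const _ _ _ _ _ ⟨_, hc.isLatticeBasis_tail⟩ fun w hw Y hY => ?_
  rw [leafGroup, AddSubgroup.mem_sup] at hX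
  obtain ⟨Y', hY', W, hW, hsum⟩ := hX
  have hYL : Y' + Y ∈ interL P₂ P₁ := add_mem hY' hY
  have e : X' + Y = X + W + (Y' + Y) := by
    rw [eq_add_of_sub_eq hsum.symm]
    abel
  have hX₂ : OverOrbit B₂ q₂ (X + W) := B₂.overOrbit_of_sub_mem h₂
    (by rw [add_sub_cancel_left]; exact AddSubgroup.mem_sup_right hW)
  have hX₁ : OverOrbit B₁ q₁ (X + W) := B₁.overOrbit_of_sub_mem h₁
    (by rw [add_sub_cancel_left]; exact AddSubgroup.mem_sup_right hW)
  have hX₂' : OverOrbit B₂ q₂ (X' + Y) := B₂.overOrbit_of_sub_mem hX₂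
    (AddSubgroup.mem_sup_left (by rw [e, add_sub_cancel_left]; exact hYL.2))
  have hX₁' : OverOrbit B₁ q₁ (X' + Y) := B₁.overOrbit_of_sub_mem hX₁
    (AddSubgroup.mem_sup_left (by rw [e, add_sub_cancel_left]; exact hYL.1))
  rw [hc.pairingDensity_orbitSection hk hw hX₂' hX₁']
  congr 1
  -- Along L₁ ∩ L₂ both potentials change by the same amount, and the lattice translation W
  -- multiplies both exponentials by the same multiplier. The phase of the quotient is therefore
  -- constant on the component.
  rw [e, B₂.potentialK_add_of_mem _ hYL.2, B₁.potentialK_add_of_mem _ hYL.1]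
  have k₂ := B₂.expi_potentialK_add hk2 h₂ hW
  have k₁ := B₁.expi_potentialK_add hk2 h₁ hW
  have hs : ∀ x y : ℝ, expi (k * (x - y)) = expi (-(k * y)) / expi (-(k * x)) := fun x y => by
    rw [eq_div_iff (expi_ne_zero _), ← expi_add]
    ring_nf
  rw [sub_sub_sub_cancel_right, hs, k₂, k₁, hs, mul_div_mul_left _ _ (expi_ne_zero _)]

/-- The matrix entry of the pairing. -/
lemma orbitPairing_eq_bksMatrix (hc : AreCompatible B₂ B₁) [NeZero k] (hk2 : Even k)
    (r : ((Fin (codimInter P₂ P₁) → ℤ) ⧸ imageLattice (omega21 B₂ B₁)) →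
      (Fin (codimInter P₂ P₁) → ℤ)) (hr : ∀ c, QuotientAddGroup.mk (r c) = c)
    (q₂ q₁ : Fin g → ℤ) :
    orbitPairing k B₂ B₁ (fun i => (q₂ i : ZMod k)) (fun i => (q₁ i : ZMod k)) =
      bksMatrix k B₂ B₁ r q₂ q₁ := by
  have hk : 0 < k := Nat.pos_of_ne_zero (NeZero.ne k)
  have hk' : (k : ℝ) ≠ 0 := by exact_mod_cast hk.ne'
  by_cases hq : ∀ j, (q₂ (tail P₂ P₁ j) : ZMod k) = q₁ (tail P₂ P₁ j)
  swap
  · push Not at hq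
    obtain ⟨j, hj⟩ := hq
    rw [hc.orbitPairing_eq_zero (j := j) hj, bksMatrix]
    have hprod : (∏ i : Fin g, if codimInter P₂ P₁ ≤ (i : ℕ) ∧ (q₂ i : ZMod k) ≠ (q₁ i : ZMod k)
        then (0 : ℂ) else 1) = 0 :=
      Finset.prod_eq_zero (Finset.mem_univ (tail P₂ P₁ j)) (if_pos ⟨le_tail j, hj⟩)
    rw [hprod, mul_zero, zero_mul]
  have hprod : (∏ i : Fin g, if codimInter P₂ P₁ ≤ (i : ℕ) ∧ (q₂ i : ZMod k) ≠ (q₁ i : ZMod k)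
      then (0 : ℂ) else 1) = 1 := by
    refine Finset.prod_eq_one fun i _ => if_neg ?_
    rintro ⟨hi, hne⟩
    obtain ⟨j, rfl⟩ := exists_tail_of_le hi
    exact hne (hq j)
  rw [bksMatrix, hprod, mul_one, orbitPairing, ← smul_eq_mul, smul_finsum]
  -- The point p l lies over both leaves. Its pairings with W₁ are exactly q₁/k, so the class of l
  -- is the only freedom left.
  let p : (Fin (codimInter P₂ P₁) → ℤ) → V := fun l =>
    transversePoint B₂ B₁ (fun i => (q₁ i : ℝ) / k)
      (fun i => (q₂ (head P₂ P₁ i) : ℝ) / k + l i)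
  have hp₁ : ∀ l i, T.ω (B₁.W i) (p l) = q₁ i / k := fun l i => omega_W₁_transversePoint _ _ i
  have hp₂ : ∀ l i, T.ω (B₂.W (head P₂ P₁ i)) (p l) = q₂ (head P₂ P₁ i) / k + l i :=
    fun l i => hc.omega_W₂_transversePoint _ _ i
  have ho₁ : ∀ l, OverOrbit B₁ (fun i => (q₁ i : ZMod k)) (p l) := fun l =>
    overOrbit_transversePoint₁ hk q₁ _
  have ho₂ : ∀ l, OverOrbit B₂ (fun i => (q₂ i : ZMod k)) (p l) := fun l =>
    hc.overOrbit_transversePoint₂ hk hq l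
  have hmk : ∀ l l', (QuotientAddGroup.mk (p l) : Leaf T (interL P₂ P₁)) =
      QuotientAddGroup.mk (p l') ↔ (QuotientAddGroup.mk l :
        (Fin (codimInter P₂ P₁) → ℤ) ⧸ imageLattice (omega21 B₂ B₁)) = QuotientAddGroup.mk l' := by
    intro l l'
    rw [QuotientAddGroup.eq, QuotientAddGroup.eq, hc.mem_leafGroup_interL_iff
      (fun i => by rw [map_add, map_neg, hp₁, hp₁, neg_add_cancel])]
    have : (fun i => T.ω (B₂.W (head P₂ P₁ i)) (-p l + p l')) =
        fun i => (((-l + l') i : ℤ) : ℝ) := by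
      ext i
      rw [map_add, map_neg, hp₂, hp₂]
      simp only [Pi.add_apply, Pi.neg_apply]
      push_cast
      ring
    rw [this]
    rfl
  let f : ((Fin (codimInter P₂ P₁) → ℤ) ⧸ imageLattice (omega21 B₂ B₁)) →
      interComponents (B₂.orbitLeaf fun i => (q₂ i : ZMod k))
        (B₁.orbitLeaf fun i => (q₁ i : ZMod k)) := fun c =>
    ⟨QuotientAddGroup.mk (p (r c)), p (r c), rfl, (B₂.onLeaf_orbitLeaf_iff _ _).2 (ho₂ _),
      (B₁.onLeaf_orbitLeaf_iff _ _).2 (ho₁ _)⟩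
  have hf : Function.Bijective f := by
    constructor
    · intro c c' h
      have h' := (hmk _ _).1 (congrArg Subtype.val h)
      rwa [hr, hr] at h'
    · rintro ⟨c, X, hX, h2, h1⟩
      rw [B₂.onLeaf_orbitLeaf_iff] at h2
      -- Surjectivity: a lattice translation brings the pairings of X with W₁ to exactly q₁/k; its
      -- pairings with W₂ are then q₂/k + l for some integer l, so X lies on the component of p l.
      have h1' := B₁.sub_mem_of_overOrbit (ho₁ 0) ((B₁.onLeaf_orbitLeaf_iff _ _).1 h1)
      rw [B₁.mem_leafGroup_iff] at h1'
      choose n hn using h1'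
      simp only [map_sub, hp₁] at hn
      let W : V := ∑ i, (n i : ℝ) • B₁.W' i
      have hW : W ∈ T.Z := sum_mem fun i _ => by
        rw [Int.cast_smul_eq_zsmul]
        exact zsmul_mem (B₁.W'_mem i) _
      have hX₁ : ∀ i, T.ω (B₁.W i) (X - W) = q₁ i / k := fun i => by
        rw [map_sub, B₁.omega_comb_W, ← hn]
        ring
      have hWg : -W ∈ leafGroup T P₂.L := neg_mem (AddSubgroup.mem_sup_right hW)
      have h2' : OverOrbit B₂ (fun i => (q₂ i : ZMod k)) (X - W) :=
        B₂.overOrbit_of_sub_mem h2 (by simpa using hWg)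
      have hsub := (B₂.mem_leafGroup_iff _).1 (B₂.sub_mem_of_overOrbit (ho₂ 0) h2')
      choose l hl using fun i => hsub (head P₂ P₁ i)
      simp only [map_sub, hp₂, Pi.zero_apply, Int.cast_zero, add_zero] at hl
      have hXW : (QuotientAddGroup.mk (p l) : Leaf T (interL P₂ P₁)) = c := by
        refine Eq.trans ?_ hX
        rw [QuotientAddGroup.eq]
        have e : -p l + X = (-p l + (X - W)) + W := by abel
        rw [e]
        refine add_mem ?_ (AddSubgroup.mem_sup_right hW)
        refine AddSubgroup.mem_sup_left ?_
        refine hc.mem_interL (fun i => ?_) fun i => ?_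
        · rw [map_add, map_neg, hp₁, hX₁, neg_add_cancel]
        · rw [map_add, map_neg, hp₂, ← hl, map_sub]
          ring
      refine ⟨QuotientAddGroup.mk l, Subtype.ext ?_⟩
      exact ((hmk _ _).2 (hr _)).trans hXW
  refine (finsum_eq_of_bijective f hf fun c => ?_).symm
  have hout : Quotient.out (f c).1 - p (r c) ∈ leafGroup T (interL P₂ P₁) := by
    rw [← neg_add_eq_sub, ← QuotientAddGroup.eq]
    exact (Quotient.out_eq (f c).1).symm
  rw [hc.leafIntegral_pairing hk hk2 (ho₂ (r c)) (ho₁ (r c)) hout,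
    hc.expi_potentialK_sub_eq_phaseA hk (fun i => hp₁ _ _) (fun i => hp₂ _ _), smul_eq_mul]

end AreCompatible

end Quantization

end

-- Orthogonality of characters and orthonormality of the rows

noncomputable section

open scoped Matrix

lemma expi_nat_mul (n : ℕ) (t : ℝ) : expi (n * t) = expi t ^ n := by
  induction n with
  | zero => simp [expi_zero]
  | succ n ih => rw [pow_succ, ← ih, ← expi_add]; push_cast; ring_nf

lemma expi_sum {ι : Type*} (s : Finset ι) (f : ι → ℝ) :
    expi (∑ i ∈ s, f i) = ∏ i ∈ s, expi (f i) := by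
  classical
  induction s using Finset.induction_on with
  | empty => simp [expi_zero]
  | insert a s ha ih => rw [Finset.sum_insert ha, Finset.prod_insert ha, expi_add, ih]

open Classical in
lemma sum_expi_mul (K : ℕ) (t : ℝ) (h : ∃ m : ℤ, (K : ℝ) * t = m) :
    ∑ a : Fin K, expi (a * t) = if ∃ m : ℤ, t = m then (K : ℂ) else 0 := by
  simp only [expi_nat_mul]
  rw [Fin.sum_univ_eq_sum_range (fun a => expi t ^ a) K]
  split_ifs with ht
  · rw [(expi_eq_one_iff t).2 ht]
    simp
  · have h1 : expi t - 1 ≠ 0 := sub_ne_zero.2 fun h' => ht ((expi_eq_one_iff t).1 h')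
    have h2 := mul_geom_sum (expi t) K
    rw [← expi_nat_mul, (expi_eq_one_iff _).2 h, sub_self] at h2
    exact (mul_eq_zero.1 h2).resolve_left h1

open Classical in
/-- Orthogonality of characters on a box of side `N * k`. -/
lemma sum_expi_dotProduct {h : ℕ} (N k : ℕ) (t : Fin h → ℝ)
    (ht : ∀ i, ∃ m : ℤ, ((N * k : ℕ) : ℝ) * t i = m) :
    ∑ p : Fin h → Fin N × Fin k, expi (∑ i, (((p i).2 : ℝ) + k * ((p i).1 : ℝ)) * t i) =
      if ∀ i, ∃ m : ℤ, t i = m then ((N * k : ℕ) : ℂ) ^ h else 0 := by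
  have h1 : ∀ i, ∑ x : Fin N × Fin k, expi (((x.2 : ℝ) + k * (x.1 : ℝ)) * t i) =
      if ∃ m : ℤ, t i = m then ((N * k : ℕ) : ℂ) else 0 := fun i => by
    -- The numbers a + k n with a < k and n < N enumerate the range of length Nk, which turns the
    -- sum over pairs into a geometric sum.
    rw [← sum_expi_mul _ _ (ht i), ← finProdFinEquiv.sum_comp]
    simp [finProdFinEquiv]
  simp only [expi_sum]
  have h2 := Finset.prod_univ_sum (fun _ : Fin h => (Finset.univ : Finset (Fin N × Fin k)))
    (fun i x => expi (((x.2 : ℝ) + k * (x.1 : ℝ)) * t i))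
  rw [Fintype.piFinset_univ] at h2
  rw [← h2]
  simp only [h1]
  split_ifs with hall
  · rw [Finset.prod_congr rfl fun i _ => if_pos (hall i)]
    simp
  · push Not at hall
    obtain ⟨i, hi⟩ := hall
    refine Finset.prod_eq_zero (Finset.mem_univ i) (if_neg ?_)
    rintro ⟨m, hm⟩
    exact hi m hm

/-- The index of `A ℤʰ` in `ℤʰ`. -/
lemma index_imageLattice {h : ℕ} (C : Matrix (Fin h) (Fin h) ℤ) (hC : C.det ≠ 0) :
    (imageLattice (C.map (Int.castRingHom ℝ))).index = C.det.natAbs := by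
  have hmem : ∀ n : Fin h → ℤ, C *ᵥ n ∈ imageLattice (C.map (Int.castRingHom ℝ)) := fun n => by
    refine ⟨n, ?_⟩
    ext i
    simp [Matrix.mulVec, dotProduct]
  have hinj : Function.Injective fun n : Fin h → ℤ => C *ᵥ n := by
    intro m n hmn
    by_contra hne
    refine hC (Matrix.exists_mulVec_eq_zero_iff.1 ⟨m - n, sub_ne_zero.2 hne, ?_⟩)
    rw [Matrix.mulVec_sub, sub_eq_zero]
    exact hmn
  let φ : (Fin h → ℤ) →+ imageLattice (C.map (Int.castRingHom ℝ)) :=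
    { toFun := fun n => ⟨C *ᵥ n, hmem n⟩
      map_zero' := by ext; simp
      map_add' := fun m n => by ext; simp [Matrix.mulVec_add] }
  have hφ : Function.Bijective φ := by
    constructor
    · intro m n hmn
      exact hinj (congrArg Subtype.val hmn)
    · rintro ⟨m, n, hn⟩
      refine ⟨n, Subtype.ext ?_⟩
      ext i
      have := congrFun hn i
      simp only [Matrix.mulVec, dotProduct, Matrix.map_apply] at this
      have h' : ((m i : ℤ) : ℝ) = ((∑ j, C i j * n j : ℤ) : ℝ) := by
        rw [this]; push_cast; rfl
      exact (Int.cast_injective h').symm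
  let e : (Fin h → ℤ) ≃ₗ[ℤ] imageLattice (C.map (Int.castRingHom ℝ)) :=
    (AddEquiv.ofBijective φ hφ).toIntLinearEquiv
  rw [AddSubgroup.index_eq_natAbs_det (Pi.basisFun ℤ (Fin h)) _ ((Pi.basisFun ℤ (Fin h)).map e),
    ← Matrix.det_transpose C, Pi.basisFun_det]
  congr 2
  ext i j
  change (C *ᵥ (Pi.basisFun ℤ (Fin h) i)) j = _
  simp

section Quantization

variable {g : ℕ} {V : Type*} [AddCommGroup V] [Module ℝ V] {T : SymplecticTorus g V}
variable {P₂ P₁ : RealPolarization T} {B₂ : PolarizationBasis P₂} {B₁ : PolarizationBasis P₁}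

/-- The integer vector with the first entries `x` and the last entries those of `y`. -/
def glue (P₂ P₁ : RealPolarization T) (x : Fin (codimInter P₂ P₁) → ℤ) (y : Fin g → ℤ) :
    Fin g → ℤ := fun i =>
  Sum.elim x (fun j => y (tail P₂ P₁ j)) ((splitEquiv P₂ P₁).symm i)

lemma glue_head (x : Fin (codimInter P₂ P₁) → ℤ) (y : Fin g → ℤ) (i : Fin (codimInter P₂ P₁)) :
    glue P₂ P₁ x y (head P₂ P₁ i) = x i := by
  simp [glue, ← splitEquiv_inl]

lemma glue_tail (x : Fin (codimInter P₂ P₁) → ℤ) (y : Fin g → ℤ)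
    (j : Fin (Module.finrank ℝ (interL P₂ P₁))) :
    glue P₂ P₁ x y (tail P₂ P₁ j) = y (tail P₂ P₁ j) := by
  simp [glue, tail]

/-- The part quadratic in q is common to both phases and cancels. What remains is linear in q plus a
constant, so a product of an entry with a conjugate entry is a combination of characters of q. -/
lemma phaseA_sub (k : ℕ) (B₂ : PolarizationBasis P₂) (B₁ : PolarizationBasis P₁)
    (l l' : Fin (codimInter P₂ P₁) → ℤ) (y y' q : Fin g → ℤ) :
    let b : Fin (codimInter P₂ P₁) → ℝ := fun i => (y (head P₂ P₁ i) : ℝ) + (k : ℝ) * (l i : ℝ)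
    let b' : Fin (codimInter P₂ P₁) → ℝ :=
      fun i => (y' (head P₂ P₁ i) : ℝ) + (k : ℝ) * (l' i : ℝ)
    phaseA k B₂ B₁ l y q - phaseA k B₂ B₁ l' y' q =
      - 2 * ((fun i => (q (head P₂ P₁ i) : ℝ)) ⬝ᵥ ((omega21 B₂ B₁)⁻¹).mulVec (b - b')) -
      (b ⬝ᵥ (omega2'1 B₂ B₁ * (omega21 B₂ B₁)⁻¹).mulVec b -
        b' ⬝ᵥ (omega2'1 B₂ B₁ * (omega21 B₂ B₁)⁻¹).mulVec b') := by
  intro b b'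
  rw [Matrix.mulVec_sub, dotProduct_sub]
  simp only [phaseA]
  ring

namespace AreCompatible

variable {k : ℕ}

/-- The rows of the matrix of the pairing are orthonormal. -/
lemma sum_orbitPairing_mul_conj (hc : AreCompatible B₂ B₁) [NeZero k] (hk2 : Even k)
    (q q' : Fin g → ZMod k) :
    ∑ q₁, orbitPairing k B₂ B₁ q q₁ * (starRingEnd ℂ) (orbitPairing k B₂ B₁ q' q₁) =
      if q = q' then 1 else 0 := by
  classical
  have hk : 0 < k := Nat.pos_of_ne_zero (NeZero.ne k)
  have hkR : (k : ℝ) ≠ 0 := by exact_mod_cast hk.ne'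
  have hkC : (k : ℂ) ≠ 0 := by exact_mod_cast hk.ne'
  by_cases htail : ∀ j, q (tail P₂ P₁ j) = q' (tail P₂ P₁ j)
  swap
  · push Not at htail
    obtain ⟨j, hj⟩ := htail
    rw [if_neg fun h => hj (by rw [h])]
    refine Finset.sum_eq_zero fun q₁ _ => ?_
    by_cases h1 : q (tail P₂ P₁ j) = q₁ (tail P₂ P₁ j)
    · rw [hc.orbitPairing_eq_zero (j := j) (q₂ := q') (fun h => hj (h1.trans h.symm)), map_zero,
        mul_zero]
    · rw [hc.orbitPairing_eq_zero (j := j) h1, zero_mul]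
  obtain ⟨C, hC⟩ := omega21_int B₂ B₁
  have hdet : (omega21 B₂ B₁).det = (C.det : ℝ) := by
    rw [hC, ← RingHom.mapMatrix_apply, ← RingHom.map_det]
    rfl
  have hC0 : C.det ≠ 0 := fun h => hc.det_omega21_ne_zero (by rw [hdet, h, Int.cast_zero])
  set N := C.det.natAbs with hN
  have hN0 : N ≠ 0 := Int.natAbs_ne_zero.2 hC0
  have hindex : Nat.card ((Fin (codimInter P₂ P₁) → ℤ) ⧸ imageLattice (omega21 B₂ B₁)) = N := by
    rw [hC]
    exact index_imageLattice C hC0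
  have hfin : Finite ((Fin (codimInter P₂ P₁) → ℤ) ⧸ imageLattice (omega21 B₂ B₁)) :=
    Nat.finite_of_card_ne_zero (by rw [hindex]; exact hN0)
  have := Fintype.ofFinite ((Fin (codimInter P₂ P₁) → ℤ) ⧸ imageLattice (omega21 B₂ B₁))
  set r : ((Fin (codimInter P₂ P₁) → ℤ) ⧸ imageLattice (omega21 B₂ B₁)) →
    (Fin (codimInter P₂ P₁) → ℤ) := Quotient.out
  have hr : ∀ c, QuotientAddGroup.mk (r c) = c := fun c => Quotient.out_eq c
  have hu : IsUnit (omega21 B₂ B₁).det := hc.det_omega21_ne_zero.isUnit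
  -- integer representatives
  let y : Fin g → ℤ := fun i => (q i).val
  let y' : Fin g → ℤ := fun i => (q' i).val
  have hy : (fun i => (y i : ZMod k)) = q := by ext i; simp [y]
  have hy' : (fun i => (y' i : ZMod k)) = q' := by ext i; simp [y']
  let b : ((Fin (codimInter P₂ P₁) → ℤ) ⧸ imageLattice (omega21 B₂ B₁)) →
    Fin (codimInter P₂ P₁) → ℝ := fun c i => (y (head P₂ P₁ i) : ℝ) + (k : ℝ) * (r c i : ℝ)
  let b' : ((Fin (codimInter P₂ P₁) → ℤ) ⧸ imageLattice (omega21 B₂ B₁)) →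
    Fin (codimInter P₂ P₁) → ℝ := fun c i => (y' (head P₂ P₁ i) : ℝ) + (k : ℝ) * (r c i : ℝ)
  let R := omega2'1 B₂ B₁ * (omega21 B₂ B₁)⁻¹
  -- The term of the pair of components (c, c') is the constant phase γ times the character x ↦
  -- expi(x · t).
  let γ := fun c c' => expi (-(b c ⬝ᵥ R *ᵥ b c - b' c' ⬝ᵥ R *ᵥ b' c') / (2 * k))
  let t := fun c c' => fun i => -(((omega21 B₂ B₁)⁻¹ *ᵥ (b c - b' c')) i / k)
  let D : ℝ := |(k : ℝ) ^ codimInter P₂ P₁ * (omega21 B₂ B₁).det| ^ (-(1 / 2) : ℝ)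
  let Φ : (Fin g → ZMod k) → ℂ := fun q₁ =>
    orbitPairing k B₂ B₁ q q₁ * (starRingEnd ℂ) (orbitPairing k B₂ B₁ q' q₁)
  have hentry : ∀ (z : Fin g → ℤ) (x : Fin (codimInter P₂ P₁) → ℤ),
      (∀ j, (z (tail P₂ P₁ j) : ZMod k) = q (tail P₂ P₁ j)) →
      orbitPairing k B₂ B₁ (fun i => (z i : ZMod k)) (fun i => (glue P₂ P₁ x y i : ZMod k)) =
        D * ∑ c, expi (phaseA k B₂ B₁ (r c) z (glue P₂ P₁ x y) / (2 * k)) := by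
    intro z x hz
    rw [hc.orbitPairing_eq_bksMatrix hk2 r hr, bksMatrix, finsum_eq_sum_of_fintype]
    have hprod : (∏ i : Fin g, if codimInter P₂ P₁ ≤ (i : ℕ) ∧
        (z i : ZMod k) ≠ (glue P₂ P₁ x y i : ZMod k) then (0 : ℂ) else 1) = 1 := by
      refine Finset.prod_eq_one fun i _ => if_neg ?_
      rintro ⟨hi, hne⟩
      obtain ⟨j, rfl⟩ := exists_tail_of_le hi
      rw [glue_tail] at hne
      exact hne ((hz j).trans (congrFun hy _).symm)
    rw [hprod, mul_one]
    congr 1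
    refine Finset.sum_congr rfl fun c _ => ?_
    rw [expi]
    congr 1
    push_cast
    field_simp
  have hΦ : ∀ x : Fin (codimInter P₂ P₁) → ℤ, Φ (fun i => (glue P₂ P₁ x y i : ZMod k)) =
      D ^ 2 * ∑ c, ∑ c', γ c c' * expi (∑ i, (x i : ℝ) * t c c' i) := by
    intro x
    have e₁ := hentry y x fun j => congrFun hy _
    have e₂ := hentry y' x fun j => (congrFun hy' _).trans (htail j).symm
    rw [hy] at e₁
    rw [hy'] at e₂
    simp only [Φ]
    rw [e₁, e₂, map_mul, Complex.conj_ofReal, mul_mul_mul_comm, ← sq, map_sum,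
      Finset.sum_mul_sum]
    congr 1
    refine Finset.sum_congr rfl fun c _ => Finset.sum_congr rfl fun c' _ => ?_
    rw [conj_expi, ← expi_add, ← expi_add]
    congr 1
    have h := phaseA_sub k B₂ B₁ (r c) (r c') y y' (glue P₂ P₁ x y)
    simp only [glue_head] at h
    rw [← sub_eq_add_neg, ← sub_div, h]
    have h3 : ∑ i, (x i : ℝ) * t c c' i =
        -(((fun i => (x i : ℝ)) ⬝ᵥ (omega21 B₂ B₁)⁻¹ *ᵥ (b c - b' c')) / k) := by
      simp only [t, dotProduct, Finset.sum_div, ← Finset.sum_neg_distrib]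
      exact Finset.sum_congr rfl fun i _ => by ring
    rw [h3]
    simp only [b, b', R]
    field_simp
    ring
  -- the sum over `q₁` is a sum over a box in `ℤʰ`
  have hsum : ∑ q₁, Φ q₁ = ∑ x : Fin (codimInter P₂ P₁) → Fin k,
      Φ (fun i => (glue P₂ P₁ (fun i => ((x i : ℕ) : ℤ)) y i : ZMod k)) := by
    refine (Fintype.sum_of_injective
      (fun (x : Fin (codimInter P₂ P₁) → Fin k) (i : Fin g) =>
        (glue P₂ P₁ (fun i => ((x i : ℕ) : ℤ)) y i : ZMod k)) ?_ _ _ ?_ fun x => rfl).symm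
    · intro x x' h
      ext i
      have := congrFun h (head P₂ P₁ i)
      simp only [glue_head, Int.cast_natCast] at this
      rw [ZMod.natCast_eq_natCast_iff'] at this
      rwa [Nat.mod_eq_of_lt (x i).2, Nat.mod_eq_of_lt (x' i).2] at this
    · intro q₁ hq₁
      by_cases h : ∀ j, q (tail P₂ P₁ j) = q₁ (tail P₂ P₁ j)
      · refine absurd ⟨fun i => ⟨(q₁ (head P₂ P₁ i)).val, ZMod.val_lt _⟩, ?_⟩ hq₁
        ext i
        rcases head_or_tail P₂ P₁ i with ⟨a, rfl⟩ | ⟨j, rfl⟩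
        · simp [glue_head]
        · simp [glue_tail, y, h]
      · push Not at h
        obtain ⟨j, hj⟩ := h
        simp only [Φ]
        rw [hc.orbitPairing_eq_zero (j := j) hj, zero_mul]
  -- The summand Φ as a whole has period k in each head coordinate, but a single character t is only
  -- known to have period Nk. Repeating the sum Nʰ times lets orthogonality apply to each character
  -- separately.
  have hbox : (N : ℂ) ^ codimInter P₂ P₁ * ∑ q₁, Φ q₁ =
      ∑ p : Fin (codimInter P₂ P₁) → Fin N × Fin k,
        Φ (fun i => (glue P₂ P₁ (fun i => (((p i).2 : ℕ) : ℤ) + k * (((p i).1 : ℕ) : ℤ)) y i :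
          ZMod k)) := by
    have hper : ∀ p : Fin (codimInter P₂ P₁) → Fin N × Fin k,
        (fun i => (glue P₂ P₁ (fun i => (((p i).2 : ℕ) : ℤ) + k * (((p i).1 : ℕ) : ℤ)) y i :
          ZMod k)) = fun i => (glue P₂ P₁ (fun i => (((p i).2 : ℕ) : ℤ)) y i : ZMod k) := by
      intro p
      ext i
      rcases head_or_tail P₂ P₁ i with ⟨a, rfl⟩ | ⟨j, rfl⟩
      · simp [glue_head]
      · simp [glue_tail]
    simp only [hper]
    rw [hsum, ← (Equiv.arrowProdEquivProdArrow (Fin (codimInter P₂ P₁)) (fun _ => Fin N)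
      (fun _ => Fin k)).symm.sum_comp, Fintype.sum_prod_type]
    simp [Equiv.arrowProdEquivProdArrow]
  -- The adjugate is integral, so |det| times the inverse of an integer matrix is integral.
  have hadj : ∀ v : Fin (codimInter P₂ P₁) → ℤ, ∀ i, ∃ m : ℤ,
      (N : ℝ) * ((omega21 B₂ B₁)⁻¹ *ᵥ (fun j => (v j : ℝ))) i = m := by
    intro v i
    have h1 : (C.det : ℝ) * ((omega21 B₂ B₁)⁻¹ *ᵥ (fun j => (v j : ℝ))) i =
        ((C.adjugate *ᵥ v) i : ℤ) := by
      have h2 : (C.det : ℝ) • (omega21 B₂ B₁)⁻¹ = C.adjugate.map (Int.castRingHom ℝ) := by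
        rw [Matrix.inv_def, hdet, Ring.inverse_eq_inv', smul_smul,
          mul_inv_cancel₀ (by exact_mod_cast hC0), one_smul, hC, ← RingHom.mapMatrix_apply,
          ← RingHom.mapMatrix_apply, RingHom.map_adjugate]
      have h3 := congrFun (congrArg (fun M => M *ᵥ (fun j => (v j : ℝ))) h2) i
      simp only [Matrix.smul_mulVec, Pi.smul_apply, smul_eq_mul] at h3
      rw [h3]
      simp [Matrix.mulVec, dotProduct]
    rcases Int.natAbs_eq C.det with h | h
    · refine ⟨(C.adjugate *ᵥ v) i, ?_⟩
      rw [← h1, h, ← hN]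
      push_cast
      rfl
    · refine ⟨-(C.adjugate *ᵥ v) i, ?_⟩
      rw [Int.cast_neg, ← h1, h, ← hN]
      push_cast
      ring
  let v := fun c c' i => y (head P₂ P₁ i) + k * r c i - (y' (head P₂ P₁ i) + k * r c' i)
  have hv : ∀ c c', b c - b' c' = fun i => (v c c' i : ℝ) := fun c c' => by
    ext i
    simp only [b, b', v, Pi.sub_apply]
    push_cast
    ring
  have hchar : ∀ c c', ∑ p : Fin (codimInter P₂ P₁) → Fin N × Fin k,
      expi (∑ i, (((p i).2 : ℝ) + k * ((p i).1 : ℝ)) * t c c' i) =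
        if q = q' ∧ c = c' then ((N * k : ℕ) : ℂ) ^ codimInter P₂ P₁ else 0 := by
    intro c c'
    rw [sum_expi_dotProduct N k (t c c') fun i => ?_]
    swap
    · obtain ⟨m, hm⟩ := hadj (v c c') i
      refine ⟨-m, ?_⟩
      simp only [t]
      rw [hv, Int.cast_neg, ← hm]
      push_cast
      field_simp
    congr 1
    rw [eq_iff_iff]
    constructor
    · intro h
      choose m hm using h
      have hinv : (omega21 B₂ B₁)⁻¹ *ᵥ (b c - b' c') = fun i => -(k : ℝ) * (m i : ℝ) := by
        ext i
        have := hm i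
        simp only [t] at this
        rw [← this]
        field_simp
      have hb : b c - b' c' = omega21 B₂ B₁ *ᵥ fun i => -(k : ℝ) * (m i : ℝ) := by
        rw [← hinv, Matrix.mulVec_mulVec, Matrix.mul_nonsing_inv _ hu, Matrix.one_mulVec]
      -- The character is trivial when y - y' + k(r c - r c') lies in k C ℤʰ. Reduction mod k gives
      -- q = q', and division by k then gives c = c'.
      have hz : ∀ i, v c c' i = -(k : ℤ) * (C *ᵥ m) i := by
        intro i
        have := congrFun hb i
        rw [hv] at this
        have h' : ((v c c' i : ℤ) : ℝ) = ((-(k : ℤ) * (C *ᵥ m) i : ℤ) : ℝ) := by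
          refine this.trans ?_
          rw [hC]
          simp only [Matrix.mulVec, dotProduct, Matrix.map_apply, eq_intCast]
          push_cast
          rw [Finset.mul_sum]
          exact Finset.sum_congr rfl fun j _ => by ring
        exact_mod_cast h'
      have hqq : q = q' := by
        ext i
        rcases head_or_tail P₂ P₁ i with ⟨a, rfl⟩ | ⟨j, rfl⟩
        · have := congrArg (Int.cast : ℤ → ZMod k) (hz a)
          simp only [v] at this
          push_cast at this
          simp only [CharP.cast_eq_zero, zero_mul, add_zero, neg_zero] at this
          rw [← congrFun hy, ← congrFun hy']
          exact sub_eq_zero.1 this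
        · exact htail j
      refine ⟨hqq, ?_⟩
      rw [← hr c, ← hr c', QuotientAddGroup.eq]
      refine ⟨m, ?_⟩
      ext i
      have hzi := hz i
      have hyy : y = y' := by simp only [y, y', hqq]
      simp only [v, hyy] at hzi
      have h1 : (k : ℤ) * (-r c i + r c' i) = k * (C *ᵥ m) i := by linarith
      have h2 := mul_left_cancel₀ (by exact_mod_cast hk.ne') h1
      simp only [Pi.add_apply, Pi.neg_apply]
      rw [h2, hC]
      simp [Matrix.mulVec, dotProduct]
    · rintro ⟨rfl, rfl⟩ i
      refine ⟨0, ?_⟩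
      simp [t, b, b', y, y']
  -- The N diagonal terms contribute (Nk)ʰ each; after removing the Nʰ repetitions, N kʰ remains,
  -- which is the inverse of D².
  have hD : (D : ℂ) ^ 2 * ((k : ℂ) ^ codimInter P₂ P₁ * N) = 1 := by
    have habs : |(k : ℝ) ^ codimInter P₂ P₁ * (omega21 B₂ B₁).det| =
        (k : ℝ) ^ codimInter P₂ P₁ * N := by
      rw [abs_mul, abs_of_pos (by positivity), hdet, hN, Nat.cast_natAbs, Int.cast_abs]
    have hpos : 0 < (k : ℝ) ^ codimInter P₂ P₁ * N := by positivity
    have hDD : D ^ 2 * ((k : ℝ) ^ codimInter P₂ P₁ * N) = 1 := by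
      simp only [D]
      rw [habs, ← Real.rpow_natCast, ← Real.rpow_mul hpos.le,
        show (-(1 / 2) : ℝ) * ((2 : ℕ) : ℝ) = -1 by norm_num, Real.rpow_neg_one,
        inv_mul_cancel₀ hpos.ne']
    exact_mod_cast hDD
  have hNC : (N : ℂ) ^ codimInter P₂ P₁ ≠ 0 := pow_ne_zero _ (by exact_mod_cast hN0)
  apply mul_left_cancel₀ hNC
  change (N : ℂ) ^ codimInter P₂ P₁ * ∑ q₁, Φ q₁ = _
  rw [hbox]
  simp only [hΦ]
  rw [← Finset.mul_sum, Finset.sum_comm]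
  have hswap : ∀ c, ∑ p : Fin (codimInter P₂ P₁) → Fin N × Fin k, ∑ c', γ c c' * expi (∑ i,
      (((((p i).2 : ℕ) : ℤ) + k * (((p i).1 : ℕ) : ℤ) : ℤ) : ℝ) * t c c' i) =
      ∑ c', γ c c' * if q = q' ∧ c = c' then ((N * k : ℕ) : ℂ) ^ codimInter P₂ P₁ else 0 := by
    intro c
    rw [Finset.sum_comm]
    refine Finset.sum_congr rfl fun c' _ => ?_
    rw [← hchar, Finset.mul_sum]
    push_cast
    rfl
  simp only [hswap]
  by_cases hqq : q = q'
  · have hγ : ∀ c, γ c c = 1 := fun c => by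
      have hyy : y = y' := by simp only [y, y', hqq]
      have hbb : b = b' := by simp only [b, b', hyy]
      simp [γ, hbb, expi_zero]
    have hcard : Fintype.card ((Fin (codimInter P₂ P₁) → ℤ) ⧸ imageLattice (omega21 B₂ B₁)) =
        N := by rw [← hindex, Nat.card_eq_fintype_card]
    simp only [hqq, true_and, if_true, mul_ite, mul_zero, Finset.sum_ite_eq, Finset.mem_univ, hγ,
      one_mul, mul_one, Finset.sum_const, Finset.card_univ, hcard, nsmul_eq_mul]
    push_cast
    rw [mul_pow]
    linear_combination (N : ℂ) ^ codimInter P₂ P₁ * hD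
  · simp [hqq]

end AreCompatible

end Quantization

end

-- The operator of the pairing and its unitarity

noncomputable section

open scoped Matrix

section Quantization

variable {g : ℕ} {V : Type*} [AddCommGroup V] [Module ℝ V] {T : SymplecticTorus g V}
variable {P₂ P₁ : RealPolarization T} {k : ℕ} [NeZero k]

/-- The matrix of the pairing in the bases `σ_q`. -/
def pairingMatrix (k : ℕ) (B₂ : PolarizationBasis P₂) (B₁ : PolarizationBasis P₁) :
    Matrix (Fin g → ZMod k) (Fin g → ZMod k) ℂ := Matrix.of (orbitPairing k B₂ B₁)

lemma AreCompatible.pairingMatrix_mul_conjTranspose {B₂ : PolarizationBasis P₂}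
    {B₁ : PolarizationBasis P₁} (hc : AreCompatible B₂ B₁) (hk2 : Even k) :
    pairingMatrix k B₂ B₁ * (pairingMatrix k B₂ B₁)ᴴ = 1 := by
  ext q q'
  rw [Matrix.mul_apply, Matrix.one_apply, ← hc.sum_orbitPairing_mul_conj hk2]
  rfl

/-- The operator with the matrix of the pairing. -/
def bksOperator (hk2 : Even k) (B₂ : PolarizationBasis P₂) (B₁ : PolarizationBasis P₁) :
    QuantumSpace k P₁ →ₗ[ℂ] QuantumSpace k P₂ :=
  ∑ q₂, (∑ q₁, orbitPairing k B₂ B₁ q₂ q₁ • B₁.coeff q₁).smulRight (B₂.sigma hk2 q₂)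

lemma coeff_bksOperator (hk2 : Even k) (B₂ : PolarizationBasis P₂) (B₁ : PolarizationBasis P₁)
    (ψ : QuantumSpace k P₁) :
    (fun q => B₂.coeff q (bksOperator hk2 B₂ B₁ ψ)) =
      pairingMatrix k B₂ B₁ *ᵥ fun q => B₁.coeff q ψ := by
  ext q
  simp [bksOperator, PolarizationBasis.coeff_sigma, pairingMatrix, Matrix.mulVec, dotProduct]

lemma isBKSOperator_bksOperator (hk2 : Even k) (B₂ : PolarizationBasis P₂)
    (B₁ : PolarizationBasis P₁) : IsBKSOperator (bksOperator hk2 B₂ B₁) := by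
  intro ψ₂ ψ₁
  rw [B₂.quantumInner_eq hk2, bksPairing_eq hk2 B₂ B₁]
  refine Finset.sum_congr rfl fun q _ => ?_
  rw [congrFun (coeff_bksOperator hk2 B₂ B₁ ψ₁) q]
  simp only [pairingMatrix, Matrix.mulVec, dotProduct, Matrix.of_apply, Finset.mul_sum]
  exact Finset.sum_congr rfl fun q₁ _ => by ring

/-- Pairing with an orthonormal basis reads off coordinates. This gives uniqueness of F and its
matrix in every pair of bases, not only the one used to construct it. -/
lemma IsBKSOperator.coeff_eq {F : QuantumSpace k P₁ →ₗ[ℂ] QuantumSpace k P₂}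
    (hF : IsBKSOperator F) (hk2 : Even k) (B₂ : PolarizationBasis P₂) (ψ : QuantumSpace k P₁)
    (q : Fin g → ZMod k) : B₂.coeff q (F ψ) = bksPairing (B₂.sigma hk2 q) ψ := by
  rw [← B₂.quantumInner_sigma_left hk2, hF]

lemma IsBKSOperator.unique {F F' : QuantumSpace k P₁ →ₗ[ℂ] QuantumSpace k P₂}
    (hF : IsBKSOperator F) (hF' : IsBKSOperator F') (hk2 : Even k) (B₂ : PolarizationBasis P₂) :
    F' = F := by
  ext1 ψ
  rw [B₂.eq_sum_coeff hk2 (F' ψ), B₂.eq_sum_coeff hk2 (F ψ)]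
  simp only [hF.coeff_eq hk2 B₂, hF'.coeff_eq hk2 B₂]

namespace AreCompatible

variable {B₂ : PolarizationBasis P₂} {B₁ : PolarizationBasis P₁}

lemma quantumInner_bksOperator (hc : AreCompatible B₂ B₁) (hk2 : Even k)
    (ψ φ : QuantumSpace k P₁) :
    quantumInner (bksOperator hk2 B₂ B₁ ψ) (bksOperator hk2 B₂ B₁ φ) = quantumInner ψ φ := by
  -- Both quantum spaces have bases indexed by (ℤ/k)^g, so the matrix is square and a right inverse
  -- is a left inverse.
  have hM : (pairingMatrix k B₂ B₁)ᴴ * pairingMatrix k B₂ B₁ = 1 :=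
    mul_eq_one_comm.1 (hc.pairingMatrix_mul_conjTranspose hk2)
  have h : ∀ {P : RealPolarization T} (B : PolarizationBasis P) (ψ φ : QuantumSpace k P),
      quantumInner ψ φ = star (fun q => B.coeff q ψ) ⬝ᵥ fun q => B.coeff q φ := fun B ψ φ => by
    rw [B.quantumInner_eq hk2]
    rfl
  rw [h B₂, h B₁, coeff_bksOperator, coeff_bksOperator, Matrix.star_mulVec,
    Matrix.dotProduct_mulVec, Matrix.vecMul_vecMul, hM, Matrix.vecMul_one]

lemma bijective_bksOperator (hc : AreCompatible B₂ B₁) (hk2 : Even k) :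
    Function.Bijective (bksOperator hk2 B₂ B₁) := by
  have hM := hc.pairingMatrix_mul_conjTranspose hk2
  have hM' := mul_eq_one_comm.1 hM
  constructor
  · refine (injective_iff_map_eq_zero _).2 fun ψ hψ => ?_
    have h := coeff_bksOperator hk2 B₂ B₁ ψ
    rw [hψ] at h
    have h' := congrArg (fun x => (pairingMatrix k B₂ B₁)ᴴ *ᵥ x) h
    simp only [map_zero, Matrix.mulVec_mulVec, hM', Matrix.one_mulVec] at h'
    rw [B₁.eq_sum_coeff hk2 ψ]
    refine Finset.sum_eq_zero fun q _ => ?_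
    rw [← congrFun h' q]
    simp [Matrix.mulVec, dotProduct]
  · intro φ
    let x := (pairingMatrix k B₂ B₁)ᴴ *ᵥ fun q => B₂.coeff q φ
    have hcoeff : (fun q => B₁.coeff q (∑ q, x q • B₁.sigma hk2 q)) = x := by
      ext q
      simp [PolarizationBasis.coeff_sigma]
    have h := coeff_bksOperator hk2 B₂ B₁ (∑ q, x q • B₁.sigma hk2 q)
    rw [hcoeff, Matrix.mulVec_mulVec, hM, Matrix.one_mulVec] at h
    exact ⟨_, (B₂.sigmaBasis hk2).ext_elem fun q => congrFun h q⟩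

end AreCompatible

end Quantization

end

theorem mainTheorem5 {V : Type*} [AddCommGroup V] [Module ℝ V] (g : ℕ) (T : SymplecticTorus g V)
    (k : ℕ) (hk : 0 < k) (hk2 : Even k) (P₁ P₂ : RealPolarization T) :
    -- the forms on the two quantum spaces are inner products
    (∃ c : InnerProductSpace.Core ℂ (QuantumSpace k P₁), ∀ ψ φ, c.inner ψ φ = quantumInner ψ φ) ∧
    (∃ c : InnerProductSpace.Core ℂ (QuantumSpace k P₂), ∀ ψ φ, c.inner ψ φ = quantumInner ψ φ) ∧
    -- the pairing induces a unique linear operator, and it is unitary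
    ∃ F : QuantumSpace k P₁ →ₗ[ℂ] QuantumSpace k P₂,
      IsBKSOperator F ∧
      (∀ F' : QuantumSpace k P₁ →ₗ[ℂ] QuantumSpace k P₂, IsBKSOperator F' → F' = F) ∧
      Function.Bijective F ∧
      (∀ ψ φ, quantumInner (F ψ) (F φ) = quantumInner ψ φ) ∧
      -- compatible symplectic bases exist, and they give the matrix of the operator
      (∃ (B₁ : PolarizationBasis P₁) (B₂ : PolarizationBasis P₂), AreCompatible B₂ B₁) ∧
      ∀ (B₁ : PolarizationBasis P₁) (B₂ : PolarizationBasis P₂), AreCompatible B₂ B₁ →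
        (omega21 B₂ B₁).det ≠ 0 ∧
        ∃ (σ₁ : Module.Basis (Fin g → ZMod k) ℂ (QuantumSpace k P₁))
          (σ₂ : Module.Basis (Fin g → ZMod k) ℂ (QuantumSpace k P₂)),
          IsStandardFamily B₁ σ₁ ∧ IsStandardFamily B₂ σ₂ ∧
          (∀ q q', quantumInner (σ₁ q) (σ₁ q') = if q = q' then 1 else 0) ∧
          (∀ q q', quantumInner (σ₂ q) (σ₂ q') = if q = q' then 1 else 0) ∧
          ∀ r : ((Fin (codimInter P₂ P₁) → ℤ) ⧸ imageLattice (omega21 B₂ B₁)) →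
              (Fin (codimInter P₂ P₁) → ℤ),
            (∀ c, QuotientAddGroup.mk (r c) = c) →
            ∀ q₂ q₁ : Fin g → ℤ,
              σ₂.repr (F (σ₁ fun i => (q₁ i : ZMod k))) (fun i => (q₂ i : ZMod k)) =
                bksMatrix k B₂ B₁ r q₂ q₁ := by

  have : NeZero k := ⟨hk.ne'⟩
  obtain ⟨B₁, B₂, hc⟩ := exists_compatible_bases P₂ P₁
  have hF := isBKSOperator_bksOperator hk2 B₂ B₁
  refine ⟨B₁.exists_innerCore hk2, B₂.exists_innerCore hk2, bksOperator hk2 B₂ B₁, hF,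
    fun F' hF' => hF.unique hF' hk2 B₂, hc.bijective_bksOperator hk2,
    hc.quantumInner_bksOperator hk2, ⟨B₁, B₂, hc⟩, fun C₁ C₂ hC => ⟨hC.det_omega21_ne_zero,
      C₁.sigmaBasis hk2, C₂.sigmaBasis hk2, C₁.isStandardFamily_sigmaBasis hk2,
      C₂.isStandardFamily_sigmaBasis hk2, fun q q' => ?_, fun q q' => ?_, fun r hr q₂ q₁ => ?_⟩⟩
  · rw [C₁.sigmaBasis_apply, C₁.sigmaBasis_apply, C₁.quantumInner_sigma_left, C₁.coeff_sigma]
  · rw [C₂.sigmaBasis_apply, C₂.sigmaBasis_apply, C₂.quantumInner_sigma_left, C₂.coeff_sigma]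
  -- F was built from B₁ and B₂, but its defining property mentions no basis, so its matrix can be
  -- read off in C₁ and C₂.
  · rw [C₂.sigmaBasis_repr, C₁.sigmaBasis_apply, hF.coeff_eq hk2 C₂, bksPairing_sigma,
      hC.orbitPairing_eq_bksMatrix hk2 r hr]
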